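/- Let $S$ be a finite set of sorts, let $I$ be an index set, let $L_\cap$ be a first-order language with set of sorts $S$, and let $(L_i)_{i\in I}$ be countable first-order languages with the same set of sorts $S$, such that $L_\cap\subseteq L_i$ for all $i$ and $L_i\cap L_j=L_\cap$ for $i\neq j$. For each $i\in I$ let $T_i$ be an $L_i$-theory, such that all the $T_i$ have the same set $T_\cap$ of $L_\cap$-consequences. Put $L_\cup=\bigcup_i L_i$ and $T_\cup=\bigcup_i T_i$, and assume that $T_\cup$ is consistent. In structures all sorts are nonempty. For a structure $\mathcal M_\cup\models T_\cup$ let $\mathcal M_i$ and $\mathcal M_\cap$ be its reducts to $L_i$ and $L_\cap$. Write $\mathrm{acl}_i$ and $\mathrm{acl}_\cap$ for algebraic closure with respect to $L_i$ and $L_\cap$. A theory is called $\aleph_0$-categorical if it is complete and any two of its models of cardinality $\aleph_0$ are isomorphic. A model $\mathcal M_\cup\models T_\cup$ is *interpolative* if for every finite $J\subseteq I$ and all $\mathcal M_i$-definable sets $X_i\subseteq M^x$ ($i\in J$; $x$ a finite tuple of variables; definable means with parameters) with $\bigcap_{i\in J}X_i=\emptyset$ there are $\mathcal M_\cap$-definable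 sets $Y_i\supseteq X_i$ ($i\in J$) with $\bigcap_{i\in J}Y_i=\emptyset$. If the class of interpolative models of $T_\cup$ is elementary, we say that $T^*_\cup$ exists, and denote by $T^*_\cup$ the theory of this class. Let $\widehat T$ be a complete $L$-theory with monster model $\mathbb M$. A *stationary independence relation* in $\widehat T$ is a relation $A\perp_C B$ between small subsets of $\mathbb M$ which is invariant under automorphisms of $\mathbb M$ and satisfies: (algebraic independence) if $A\perp_C B$ then $\mathrm{acl}(AC)\cap\mathrm{acl}(BC)=\mathrm{acl}(C)$; (stationarity) if $C=\mathrm{acl}(C)$, $\mathrm{tp}(A/C)=\mathrm{tp}(A^*/C)$, $A\perp_C B$ and $A^*\perp_C B$, then $\mathrm{tp}(A/BC)=\mathrm{tp}(A^*/BC)$. If $\widehat T'\supseteq\widehat T$ is a complete theory in a language $L'\supseteq L$ with the same sorts, then $\perp$ is *extendable to* $\widehat T'$ if, in a monster model of $\widehat T'$, for all small $A,B,C$ with $C=\mathrm{acl}_{L'}(C)$ there is $A^*$ with $\mathrm{tp}_{L'}(A^*/C)=\mathrm{tp}_{L'}(A/C)$ and $A^*\perp_C B$ in the $L$-reduct.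 (Equivalently, $\perp$ is a relation on subsets of models of $\widehat T$ which depends only on the $L$-type over $\emptyset$ of the sets involved, and $A^*$ is found in an elementary extension.) We say that $T_\cap$ *admits a stationary and extendable independence relation* if, whenever $\widehat T_\cap$ is a completion of $T_\cap$ and, for each $i$, $\widehat T_i\supseteq\widehat T_\cap$ is a completion of $T_i$, there is a stationary independence relation in $\widehat T_\cap$ which is extendable to $\widehat T_i$ for every $i\in I$. **Theorem.** Assume that $T_\cap$ admits a stationary and extendable independence relation, that each $T_i$ is $\aleph_0$-categorical, and that there is $i^*\in I$ such that for all $i\neq i^*$ we have $\mathrm{acl}_i(A)=\mathrm{acl}_\cap(A)$ for all subsets $A$ of models of $T_i$. Then: 1. $T^*_\cup$ exists. 2. If $I$ is finite, then every completion of $T^*_\cup$ is $\aleph_0$-categorical. 3. If $I$ is finite and $\emptyset$ is $\mathrm{acl}_i$-closed for every $i\in I$ (that is, $\mathrm{acl}_i(\emptyset)=\emptyset$ in models of $T_i$), then $T^*_\cup$ is complete and $\aleph_0$-categorical. -/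

import Mathlib

universe u

namespace ManySorted

/-! ### Many-sorted first-order logic -/

/-- A many-sorted first-order language with set of sorts `S`. A symbol has an arity, the list of the
sorts of its arguments; a function symbol also has a value sort. Constants are function symbols of
arity `[]`. -/
structure SortedLanguage (S : Type u) where
  Func : List S → S → Type u
  Rel : List S → Type u

variable {S : Type u}

/-- A language is countable if it has countably many symbols. -/
def SortedLanguage.IsCountable (L : SortedLanguage S) : Prop :=
  Countable (Σ p : List S × S, L.Func p.1 p.2) ∧ Countable (Σ σ : List S, L.Rel σ)

/-- `Var Γ s` is the set of positions of sort `s` in the list of sorts `Γ`. A list of sorts serves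
as a finite tuple of variables: its `k`-th entry is the sort of the `k`-th variable. -/
inductive Var : List S → S → Type u
  | zero {Γ : List S} {s : S} : Var (s :: Γ) s
  | succ {Γ : List S} {s t : S} : Var Γ s → Var (t :: Γ) s

/-- Sort-preserving maps between families of sets indexed by the sorts; a (possibly infinite) tuple
of elements of `Y` in the variables `X`. -/
abbrev Tuple (X Y : S → Type u) : Type u := ∀ s, X s → Y s

/-- `A ⊆ X` for families of sets indexed by the sorts. -/
abbrev SubFamily (X : S → Type u) : Type u := ∀ s, Set (X s)

/-- `M^x` for the finite tuple of variables `x = Γ`. -/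
abbrev Env (M : S → Type u) (Γ : List S) : Type u := Tuple (Var Γ) M

/-- The tuple `(a, v)`. -/
def Env.cons {M : S → Type u} {Γ : List S} {t : S} (a : M t) (v : Env M Γ) : Env M (t :: Γ)
  | _, .zero => a
  | _, .succ x => v _ x

/-- The concatenation of two tuples. -/
def Env.append {M : S → Type u} : {Γ Δ : List S} → Env M Γ → Env M Δ → Env M (Γ ++ Δ)
  | [], _, _, b => b
  | _ :: _, _, a, b => Env.cons (a _ .zero) (Env.append (fun s x => a s x.succ) b)

/-- `L`-terms of sort `s` in the variables `Γ`. -/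
inductive Term (L : SortedLanguage S) (Γ : List S) : S → Type u
  | var {s : S} (x : Var Γ s) : Term L Γ s
  | app {σ : List S} {s : S} (f : L.Func σ s) (ts : ∀ t, Var σ t → Term L Γ t) : Term L Γ s

/-- `L`-formulas with free variables among `Γ`; a quantifier binds the first variable. -/
inductive Formula (L : SortedLanguage S) : List S → Type u
  | falsum {Γ : List S} : Formula L Γ
  | eq {Γ : List S} {s : S} (t₁ t₂ : Term L Γ s) : Formula L Γ
  | rel {Γ : List S} {σ : List S} (R : L.Rel σ) (ts : ∀ t, Var σ t → Term L Γ t) : Formula L Γ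
  | imp {Γ : List S} (φ ψ : Formula L Γ) : Formula L Γ
  | all {Γ : List S} (s : S) (φ : Formula L (s :: Γ)) : Formula L Γ

/-- The negation of a formula. -/
def Formula.neg {L : SortedLanguage S} {Γ : List S} (φ : Formula L Γ) : Formula L Γ :=
  φ.imp .falsum

/-- A sentence is a formula without free variables. -/
abbrev Sentence (L : SortedLanguage S) : Type u := Formula L []

/-- A theory is a set of sentences. -/
abbrev Theory (L : SortedLanguage S) : Type u := Set (Sentence L)

/-- An `L`-structure: a nonempty set for each sort, with interpretations of the symbols. -/
structure Struct (L : SortedLanguage S) where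
  carrier : S → Type u
  nonempty : ∀ s, Nonempty (carrier s)
  func : ∀ {σ : List S} {s : S}, L.Func σ s → Env carrier σ → carrier s
  rel : ∀ {σ : List S}, L.Rel σ → Env carrier σ → Prop

/-- The value of a term. -/
def Term.eval {L : SortedLanguage S} (M : Struct L) {Γ : List S} (v : Env M.carrier Γ) :
    {s : S} → Term L Γ s → M.carrier s
  | _, .var x => v _ x
  | _, .app f ts => M.func f (fun t x => (ts t x).eval M v)

/-- `φ.Realize M v` means `M ⊨ φ(v)`. -/
def Formula.Realize {L : SortedLanguage S} (M : Struct L) :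
    {Γ : List S} → Formula L Γ → Env M.carrier Γ → Prop
  | _, .falsum, _ => False
  | _, .eq t₁ t₂, v => t₁.eval M v = t₂.eval M v
  | _, .rel R ts, v => M.rel R (fun t x => (ts t x).eval M v)
  | _, .imp φ ψ, v => φ.Realize M v → ψ.Realize M v
  | _, .all s φ, v => ∀ a : M.carrier s, φ.Realize M (Env.cons a v)

/-- `M ⊨ φ` for a sentence `φ`. -/
def Struct.Satisfies {L : SortedLanguage S} (M : Struct L) (φ : Sentence L) : Prop :=
  φ.Realize M (fun _ x => nomatch x)

/-- `M ⊨ T`. -/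
def Struct.Models {L : SortedLanguage S} (M : Struct L) (T : Theory L) : Prop :=
  ∀ φ ∈ T, M.Satisfies φ

/-- `T ⊨ φ`. -/
def Theory.Entails {L : SortedLanguage S} (T : Theory L) (φ : Sentence L) : Prop :=
  ∀ M : Struct L, M.Models T → M.Satisfies φ

/-- A theory is consistent if it has a model. -/
def Theory.Consistent {L : SortedLanguage S} (T : Theory L) : Prop :=
  ∃ M : Struct L, M.Models T

/-- A theory is complete if it is consistent and decides every sentence. -/
def Theory.Complete {L : SortedLanguage S} (T : Theory L) : Prop :=
  T.Consistent ∧ ∀ φ : Sentence L, T.Entails φ ∨ T.Entails φ.neg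

/-- `T'` is a completion of `T`. -/
def Theory.IsCompletion {L : SortedLanguage S} (T T' : Theory L) : Prop :=
  T'.Complete ∧ T ⊆ T'

/-- Isomorphisms of `L`-structures. -/
structure Iso {L : SortedLanguage S} (M N : Struct L) where
  toEquiv : ∀ s, M.carrier s ≃ N.carrier s
  map_func : ∀ {σ : List S} {s : S} (f : L.Func σ s) (v : Env M.carrier σ),
    toEquiv s (M.func f v) = N.func f (fun t x => toEquiv t (v t x))
  map_rel : ∀ {σ : List S} (R : L.Rel σ) (v : Env M.carrier σ),
    M.rel R v ↔ N.rel R (fun t x => toEquiv t (v t x))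

/-- A theory is `ℵ₀`-categorical if it is complete and any two of its models of cardinality `ℵ₀`
are isomorphic. (The cardinality of a structure is that of the disjoint union of its sorts.) -/
def Theory.Aleph0Categorical {L : SortedLanguage S} (T : Theory L) : Prop :=
  T.Complete ∧ ∀ M N : Struct L, M.Models T → N.Models T →
    Cardinal.mk (Σ s, M.carrier s) = Cardinal.aleph0 →
    Cardinal.mk (Σ s, N.carrier s) = Cardinal.aleph0 → Nonempty (Iso M N)

/-! ### Definable sets, algebraic closure, types -/

/-- A subset of `M^x` which is definable in `M`, with parameters. -/
def Struct.Definable {L : SortedLanguage S} (M : Struct L) {Γ : List S}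
    (X : Set (Env M.carrier Γ)) : Prop :=
  ∃ (Δ : List S) (φ : Formula L (Γ ++ Δ)) (b : Env M.carrier Δ),
    X = {a | φ.Realize M (Env.append a b)}

/-- The algebraic closure of `A` in `M`. -/
def Struct.acl {L : SortedLanguage S} (M : Struct L) (A : SubFamily M.carrier) :
    SubFamily M.carrier :=
  fun s => {b | ∃ (Δ : List S) (φ : Formula L (s :: Δ)) (a : Env M.carrier Δ),
    (∀ t x, a t x ∈ A t) ∧ φ.Realize M (Env.cons b a) ∧
      {c : M.carrier s | φ.Realize M (Env.cons c a)}.Finite}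

/-- `tp_M(x) = tp_N(y)`, for tuples `x` in `M` and `y` in `N` in the same variables `X`. -/
def SameType {L : SortedLanguage S} (M N : Struct L) {X : S → Type u}
    (x : Tuple X M.carrier) (y : Tuple X N.carrier) : Prop :=
  ∀ (Γ : List S) (φ : Formula L Γ) (g : Tuple (Var Γ) X),
    φ.Realize M (fun s k => x s (g s k)) ↔ φ.Realize N (fun s k => y s (g s k))

/-- `tp(x / C) = tp(y / C)` in `M`. -/
def SameTypeOver {L : SortedLanguage S} (M : Struct L) (C : SubFamily M.carrier) {X : S → Type u}
    (x y : Tuple X M.carrier) : Prop :=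
  SameType M M (X := fun s => X s ⊕ C s)
    (fun s => Sum.elim (x s) Subtype.val) (fun s => Sum.elim (y s) Subtype.val)

/-- `j : M → N` is an elementary embedding. -/
def IsElementaryEmbedding {L : SortedLanguage S} (M N : Struct L) (j : Tuple M.carrier N.carrier) :
    Prop :=
  ∀ (Γ : List S) (φ : Formula L Γ) (v : Env M.carrier Γ),
    φ.Realize M v ↔ φ.Realize N (fun s k => j s (v s k))

/-- The image of a subset under a sort-preserving map. -/
def SubFamily.image {X Y : S → Type u} (f : Tuple X Y) (A : SubFamily X) : SubFamily Y :=
  fun s => f s '' A s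

/-- The set enumerated by a tuple. -/
def Tuple.range {X Y : S → Type u} (f : Tuple X Y) : SubFamily Y :=
  fun s => Set.range (f s)

/-! ### SortedLanguage maps and reducts -/

/-- A map of languages with the same sorts. -/
structure LHom (L L' : SortedLanguage S) where
  onFunc : ∀ {σ : List S} {s : S}, L.Func σ s → L'.Func σ s
  onRel : ∀ {σ : List S}, L.Rel σ → L'.Rel σ

/-- An `L`-term as an `L'`-term. -/
def LHom.onTerm {L L' : SortedLanguage S} (h : LHom L L') {Γ : List S} :
    {s : S} → Term L Γ s → Term L' Γ s
  | _, .var x => .var x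
  | _, .app f ts => .app (h.onFunc f) (fun t x => h.onTerm (ts t x))

/-- An `L`-formula as an `L'`-formula. -/
def LHom.onFormula {L L' : SortedLanguage S} (h : LHom L L') :
    {Γ : List S} → Formula L Γ → Formula L' Γ
  | _, .falsum => .falsum
  | _, .eq t₁ t₂ => .eq (h.onTerm t₁) (h.onTerm t₂)
  | _, .rel R ts => .rel (h.onRel R) (fun t x => h.onTerm (ts t x))
  | _, .imp φ ψ => .imp (h.onFormula φ) (h.onFormula ψ)
  | _, .all s φ => .all s (h.onFormula φ)

/-- An `L`-theory as an `L'`-theory. -/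
def LHom.onTheory {L L' : SortedLanguage S} (h : LHom L L') (T : Theory L) : Theory L' :=
  (fun φ : Sentence L => h.onFormula φ) '' T

/-- The `L`-reduct of an `L'`-structure. -/
def Struct.reduct {L L' : SortedLanguage S} (M : Struct L') (h : LHom L L') : Struct L where
  carrier := M.carrier
  nonempty := M.nonempty
  func f v := M.func (h.onFunc f) v
  rel R v := M.rel (h.onRel R) v

/-- The set of `L`-consequences of an `L'`-theory. -/
def LHom.consequences {L L' : SortedLanguage S} (h : LHom L L') (T' : Theory L') : Theory L :=
  {φ : Sentence L | T'.Entails (h.onFormula φ)}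

/-! ### Stationary and extendable independence relations

The monster model of a complete theory `T` is used in the following form: a small subset of the
monster model is a subset of a model of `T`, a relation on the small subsets which is invariant
under automorphisms is a relation on the subsets of models of `T` which only depends on types over
the empty set, and to find something in the monster model is to find it in an elementary
extension. -/

/-- A ternary relation on the subsets of `L`-structures. `ind M A B C` means that `A` is independent
from `B` over `C` in `M`. -/
abbrev TernaryRelation (L : SortedLanguage S) : Type (u + 1) :=
  ∀ M : Struct L, SubFamily M.carrier → SubFamily M.carrier → SubFamily M.carrier → Prop

/-- `ind` is a stationary independence relation in the complete theory `T`. -/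
structure IsStationaryIndependence {L : SortedLanguage S} (T : Theory L) (ind : TernaryRelation L) :
    Prop where
  invariance : ∀ M N : Struct L, M.Models T → N.Models T →
    ∀ (X : S → Type u) (x : Tuple X M.carrier) (y : Tuple X N.carrier), SameType M N x y →
    ∀ A B C : SubFamily X,
      ind M (A.image x) (B.image x) (C.image x) ↔ ind N (A.image y) (B.image y) (C.image y)
  algebraic_independence : ∀ M : Struct L, M.Models T → ∀ A B C : SubFamily M.carrier,
    ind M A B C → M.acl (A ⊔ C) ⊓ M.acl (B ⊔ C) = M.acl C
  stationarity : ∀ M : Struct L, M.Models T → ∀ (X : S → Type u) (a a' : Tuple X M.carrier)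
    (B C : SubFamily M.carrier), M.acl C = C → SameTypeOver M C a a' →
    ind M a.range B C → ind M a'.range B C → SameTypeOver M (B ⊔ C) a a'

/-- Full existence over algebraically closed sets in `T'`, where `T'` is a complete theory in a
language `L'` expanding `L`, for a ternary relation on subsets of `L`-structures. -/
def IsExtendable {L L' : SortedLanguage S} (h : LHom L L') (T' : Theory L')
    (ind : TernaryRelation L) : Prop :=
  ∀ M : Struct L', M.Models T' → ∀ (X : S → Type u) (a : Tuple X M.carrier)
    (B C : SubFamily M.carrier), M.acl C = C →
    ∃ (N : Struct L') (j : Tuple M.carrier N.carrier) (a' : Tuple X N.carrier),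
      IsElementaryEmbedding M N j ∧
      SameTypeOver N (C.image j) a' (fun s k => j s (a s k)) ∧
      ind (N.reduct h) a'.range (B.image j) (C.image j)

/-! ### Interpolative fusions

Languages `L_i` (for `i ∈ I`) with `L_i ∩ L_j = L_∩` for distinct `i` and `j` are given by the
language `L_∩` and, for each `i`, the language `E i` of the symbols of `L_i` which are not in
`L_∩`. -/

/-- The disjoint union of two languages. -/
def SortedLanguage.sum (L E : SortedLanguage S) : SortedLanguage S where
  Func σ s := L.Func σ s ⊕ E.Func σ s
  Rel σ := L.Rel σ ⊕ E.Rel σ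

/-- The disjoint union of a family of languages. -/
def SortedLanguage.sigma {I : Type u} (E : I → SortedLanguage S) : SortedLanguage S where
  Func σ s := Σ i, (E i).Func σ s
  Rel σ := Σ i, (E i).Rel σ

section Fusion

variable {I : Type u} (Lcap : SortedLanguage S) (E : I → SortedLanguage S)

/-- The language `L_i`. -/
abbrev langOf (i : I) : SortedLanguage S := Lcap.sum (E i)

/-- The language `L_∪`, the union of the `L_i`. -/
abbrev langUnion : SortedLanguage S := Lcap.sum (SortedLanguage.sigma E)

/-- The inclusion of `L_∩` in `L_i`. -/
def capToLang (i : I) : LHom Lcap (langOf Lcap E i) where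
  onFunc := Sum.inl
  onRel := Sum.inl

/-- The inclusion of `L_i` in `L_∪`. -/
def langToUnion (i : I) : LHom (langOf Lcap E i) (langUnion Lcap E) where
  onFunc := Sum.map id (fun f => ⟨i, f⟩)
  onRel := Sum.map id (fun R => ⟨i, R⟩)

/-- The inclusion of `L_∩` in `L_∪`. -/
def capToUnion : LHom Lcap (langUnion Lcap E) where
  onFunc := Sum.inl
  onRel := Sum.inl

variable {Lcap E}

/-- The theory `T_∪`, the union of the `T_i`. -/
def theoryUnion (T : ∀ i, Theory (langOf Lcap E i)) : Theory (langUnion Lcap E) :=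
  ⋃ i, (langToUnion Lcap E i).onTheory (T i)

/-- `M` is an interpolative model of `T_∪`. -/
def IsInterpolative (T : ∀ i, Theory (langOf Lcap E i)) (M : Struct (langUnion Lcap E)) : Prop :=
  M.Models (theoryUnion T) ∧
    ∀ (J : Finset I) (Γ : List S) (X : I → Set (Env M.carrier Γ)),
      (∀ i ∈ J, (M.reduct (langToUnion Lcap E i)).Definable (X i)) → (⋂ i ∈ J, X i) = ∅ →
      ∃ Y : I → Set (Env M.carrier Γ),
        (∀ i ∈ J, (M.reduct (capToUnion Lcap E)).Definable (Y i) ∧ X i ⊆ Y i) ∧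
        (⋂ i ∈ J, Y i) = ∅

/-- "`T_∪^*` exists": the class of interpolative models of `T_∪` is elementary. -/
def FusionExists (T : ∀ i, Theory (langOf Lcap E i)) : Prop :=
  ∃ Θ : Theory (langUnion Lcap E), ∀ M, M.Models Θ ↔ IsInterpolative T M

/-- The theory `T_∪^*` of the class of interpolative models of `T_∪`; if this class is elementary,
this is the interpolative fusion of the `T_i` over `T_∩`. -/
def interpolativeFusion (T : ∀ i, Theory (langOf Lcap E i)) : Theory (langUnion Lcap E) :=
  {φ | ∀ M, IsInterpolative T M → M.Satisfies φ}

/-- `T_∩` admits a stationary and extendable independence relation: whenever `Ucap` is a completion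
of `T_∩` and `U i`, extending `Ucap`, is a completion of `T_i` for each `i`, there is a stationary
independence relation in `Ucap` which is extendable to `U i` for each `i`. -/
def AdmitsStationaryExtendable (Tcap : Theory Lcap) (T : ∀ i, Theory (langOf Lcap E i)) : Prop :=
  ∀ (Ucap : Theory Lcap) (U : ∀ i, Theory (langOf Lcap E i)), Tcap.IsCompletion Ucap →
    (∀ i, (T i).IsCompletion (U i) ∧ Ucap ⊆ (capToLang Lcap E i).consequences (U i)) →
    ∃ ind : TernaryRelation Lcap, IsStationaryIndependence Ucap ind ∧
      ∀ i, IsExtendable (capToLang Lcap E i) (U i) ind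

end Fusion

end ManySorted

open ManySorted

/-!
Every model of a theory `T_i` is oligomorphic, by the Ryll-Nardzewski theorem
(`Aleph0Categorical.oligomorphic`, via omitting types). Hence the algebraic closure of a finite set is
finite, the type of a finite tuple is isolated, having the same type is a first-order relation, and
arbitrary unions of types over a finite tuple are definable.

The heart of the matter is a separation criterion. Let `C` be algebraically closed for `T_{i*}`; then
it is algebraically closed for all `T_i`, as the others have the closure of `L_∩`. If sets `X_i`,
definable over `C` in `M_i`, contain points `a_i` of the same `L_∩`-type over `C`, then the `X_i` cannot
be separated by `L_∩`-definable sets `Y_i` (`TameFusion.iInter_nonempty_of_subset`). By extendability,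
each `a_i` has the same `L_i`-type over `C` as some point `a_i'` of an elementary extension of `M_i`
which is independent from `M` over `C`. By stationarity, in an amalgam of the `L_∩`-reducts, all `a_i'`
have the same `L_∩`-type over `M`. So they all satisfy every formula which defines one of the `Y_i`,
and `⋂ Y_i` is nonempty. Conversely, if the `X_i` contain no points of the same `L_∩`-type over a finite
`C`, then the unions of the `L_∩`-types over `C` which meet the `X_i` separate them. Thus `M` is
interpolative if and only if, for all finite algebraically closed `C`, sets `X_i` as above always have a
common point. This is expressed by sentences, one for each isolated type of an enumeration of `C` and
each choice of formulas, so the interpolative models form an elementary class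
(`TameFusion.isInterpolative_of_models`).

Let `I` be finite. The pairs of finite algebraically closed tuples which have the same `L_i`-type for all
`i` form a back-and-forth system between any two interpolative models (`BackForth`): to extend such a
pair, the `L_i`-types which are to be realized are isolated and induce the same `L_∩`-type, so that the
criterion provides a common realization (`TameFusion.exists_extension`). Members of the system have the
same `L_∪`-type, and between countable models they extend to isomorphisms. In models of one completion a
member is found by realizing the isolating formulas of an enumeration of the closure of `∅`; if this
closure is empty, then the empty tuple is a member for any two interpolative models, which gives
completeness as soon as there is an interpolative model.

That one exists is shown for finite `I` by a generic construction (`TameFusion.exists_isInterpolative`):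
countable models of the `T_i` are identified along generic `L_∩`-elementary bijections, where the
finite conditions are tuples of the same `L_∩`-type. For given `X_i`, a condition can either be extended
so as to put a common point into the `X_i`, or the `L_∩`-types over this condition separate them.

First-order definability is handled semantically throughout: `FO` says that a property of possibly
infinite tuples is defined by one formula in all structures of a family, and has the evident closure
properties.
-/

namespace ManySorted

variable {S : Type u}

/-! ### Variables and tuples -/

instance Var.instFinite (Γ : List S) (s : S) : Finite (Var Γ s) := by
  induction Γ with
  | nil => exact Finite.of_injective (fun x : Var [] s => (nomatch x : Empty)) (fun x => nomatch x)
  | cons t Γ ih =>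
    by_cases h : t = s
    · subst h
      refine Finite.of_surjective
        (fun o : Option (Var Γ t) => (o.elim Var.zero Var.succ : Var (t :: Γ) t)) fun x => ?_
      cases x with
      | zero => exact ⟨none, rfl⟩
      | succ x => exact ⟨some x, rfl⟩
    · refine Finite.of_surjective (fun x : Var Γ s => (x.succ : Var (t :: Γ) s)) fun x => ?_
      cases x with
      | zero => exact absurd rfl h
      | succ x => exact ⟨x, rfl⟩

/-- The composition of a tuple with a renaming of its variables. -/
abbrev Tuple.comp {X Y Z : S → Type u} (x : Tuple Y Z) (f : Tuple X Y) : Tuple X Z :=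
  fun s k => x s (f s k)

/-- The disjoint union of two families of variables. -/
abbrev VSum (X Y : S → Type u) : S → Type u := fun s => X s ⊕ Y s

/-- The concatenation `(x, y)` of two possibly infinite tuples. -/
abbrev Tuple.sum {X Y Z : S → Type u} (x : Tuple X Z) (y : Tuple Y Z) : Tuple (VSum X Y) Z :=
  fun s => Sum.elim (x s) (y s)

/-- The first summand of a disjoint union of variables. -/
abbrev vinl {X Y : S → Type u} : Tuple X (VSum X Y) := fun _ => Sum.inl

/-- The second summand of a disjoint union of variables. -/
abbrev vinr {X Y : S → Type u} : Tuple Y (VSum X Y) := fun _ => Sum.inr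

/-- The empty tuple. -/
def Env.nil {M : S → Type u} : Env M [] := fun _ x => nomatch x

theorem Env.eq_nil {M : S → Type u} (v w : Env M []) : v = w := by
  funext s x; exact nomatch x

theorem comp_cons {M N : S → Type u} {Γ : List S} {t : S} (x : Tuple M N) (a : M t) (v : Env M Γ) :
    x.comp (Env.cons a v) = Env.cons (x t a) (x.comp v) := by
  funext s k; cases k <;> rfl

theorem comp_append {M N : S → Type u} {Γ Δ : List S} (x : Tuple M N) (a : Env M Γ)
    (b : Env M Δ) : x.comp (Env.append a b) = Env.append (x.comp a) (x.comp b) := by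
  induction Γ with
  | nil => rfl
  | cons t Γ ih =>
    simp only [Env.append]
    rw [comp_cons, ih]

/-- The variables of `Γ` inside `Γ ++ Δ`. -/
def Var.left : {Γ : List S} → (Δ : List S) → Tuple (Var Γ) (Var (Γ ++ Δ))
  | _ :: _, _, _, .zero => .zero
  | _ :: _, Δ, _, .succ x => .succ (Var.left Δ _ x)

/-- The variables of `Δ` inside `Γ ++ Δ`. -/
def Var.right : (Γ : List S) → {Δ : List S} → Tuple (Var Δ) (Var (Γ ++ Δ))
  | [], _, _, x => x
  | _ :: Γ, _, _, x => .succ (Var.right Γ _ x)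

theorem Env.append_left {M : S → Type u} {Γ Δ : List S} (a : Env M Γ) (b : Env M Δ) :
    (Env.append a b : Tuple _ M).comp (Var.left Δ) = a := by
  induction Γ with
  | nil => exact Env.eq_nil _ _
  | cons t Γ ih =>
    funext s x
    cases x with
    | zero => rfl
    | succ x => exact congrFun (congrFun (ih (fun s x => a s x.succ)) s) x

theorem Env.append_right {M : S → Type u} {Γ Δ : List S} (a : Env M Γ) (b : Env M Δ) :
    (Env.append a b : Tuple _ M).comp (Var.right Γ) = b := by
  induction Γ with
  | nil => rfl
  | cons t Γ ih =>
    funext s x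
    exact congrFun (congrFun (ih (fun s x => a s x.succ)) s) x

theorem Tuple.sum_comp {W X Y Z : S → Type u} (w : Tuple Z W) (x : Tuple X Z) (y : Tuple Y Z) :
    w.comp (x.sum y) = (w.comp x).sum (w.comp y) := by
  funext s k; cases k <;> rfl

theorem Tuple.sum_eta {X Y Z : S → Type u} (z : Tuple (VSum X Y) Z) :
    (z.comp vinl).sum (z.comp vinr) = z := by
  funext s k; cases k <;> rfl

/-! ### Renaming variables -/

variable {L L' : SortedLanguage S}

instance (Γ : List S) : Inhabited (Formula L Γ) := ⟨.falsum⟩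

instance Struct.instNonempty (M : Struct L) (s : S) : Nonempty (M.carrier s) := M.nonempty s

/-- Renaming the variables of a term. -/
def Term.rename {Γ Δ : List S} (f : Tuple (Var Γ) (Var Δ)) : {s : S} → Term L Γ s → Term L Δ s
  | _, .var x => .var (f _ x)
  | _, .app F ts => .app F (fun t x => (ts t x).rename f)

/-- A renaming of variables, extended by the identity on a bound variable. -/
def Var.lift {Γ Δ : List S} (t : S) (f : Tuple (Var Γ) (Var Δ)) :
    Tuple (Var (t :: Γ)) (Var (t :: Δ)) :=
  Env.cons (M := Var (t :: Δ)) .zero (fun s x => (f s x).succ)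

/-- Renaming the free variables of a formula. -/
def Formula.rename : {Γ Δ : List S} → Tuple (Var Γ) (Var Δ) → Formula L Γ → Formula L Δ
  | _, _, _, .falsum => .falsum
  | _, _, f, .eq t₁ t₂ => .eq (t₁.rename f) (t₂.rename f)
  | _, _, f, .rel R ts => .rel R (fun t x => (ts t x).rename f)
  | _, _, f, .imp φ ψ => .imp (φ.rename f) (ψ.rename f)
  | _, _, f, .all s φ => .all s (φ.rename (Var.lift s f))

theorem Term.eval_rename (M : Struct L) {Γ Δ : List S} (f : Tuple (Var Γ) (Var Δ)) {s : S}
    (t : Term L Γ s) (v : Env M.carrier Δ) :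
    (t.rename f).eval M v = t.eval M ((v : Tuple _ _).comp f) := by
  induction t with
  | var x => rfl
  | app F ts ih =>
    simp only [Term.rename, Term.eval]
    congr 1
    funext t x
    exact ih t x

theorem Formula.realize_rename (M : Struct L) {Γ Δ : List S} (f : Tuple (Var Γ) (Var Δ))
    (φ : Formula L Γ) (v : Env M.carrier Δ) :
    (φ.rename f).Realize M v ↔ φ.Realize M ((v : Tuple _ _).comp f) := by
  induction φ generalizing Δ with
  | falsum => rfl
  | eq t₁ t₂ => simp only [Formula.rename, Formula.Realize, Term.eval_rename]
  | rel R ts => simp only [Formula.rename, Formula.Realize, Term.eval_rename]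
  | imp φ ψ ih₁ ih₂ => simp only [Formula.rename, Formula.Realize, ih₁ f v, ih₂ f v]
  | all s φ ih =>
    simp only [Formula.rename, Formula.Realize]
    refine forall_congr' fun a => ?_
    rw [ih]
    have : (Env.cons a v : Tuple _ M.carrier).comp (Var.lift s f) =
        Env.cons a ((v : Tuple _ _).comp f) := by
      unfold Var.lift
      rw [comp_cons]
      rfl
    rw [this]

theorem LHom.eval_onTerm (h : LHom L L') (M : Struct L') {Γ : List S} {s : S} (t : Term L Γ s)
    (v : Env M.carrier Γ) : (h.onTerm t).eval M v = t.eval (M.reduct h) v := by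
  induction t with
  | var x => rfl
  | app F ts ih =>
    simp only [LHom.onTerm, Term.eval]
    change M.func _ _ = M.func _ _
    congr 1
    funext t x
    exact ih t x

theorem LHom.realize_onFormula (h : LHom L L') (M : Struct L') {Γ : List S} (φ : Formula L Γ)
    (v : Env M.carrier Γ) : (h.onFormula φ).Realize M v ↔ φ.Realize (M.reduct h) v := by
  induction φ with
  | falsum => rfl
  | eq t₁ t₂ => simp only [LHom.onFormula, Formula.Realize, LHom.eval_onTerm]; rfl
  | rel R ts => simp only [LHom.onFormula, Formula.Realize, LHom.eval_onTerm]; rfl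
  | imp φ ψ ih₁ ih₂ => simp only [LHom.onFormula, Formula.Realize, ih₁ v, ih₂ v]
  | all s φ ih =>
    simp only [LHom.onFormula, Formula.Realize]
    exact forall_congr' fun a => ih _

theorem Iso.eval {M N : Struct L} (e : Iso M N) {Γ : List S} {s : S} (t : Term L Γ s)
    (v : Env M.carrier Γ) :
    e.toEquiv s (t.eval M v) = t.eval N (fun s k => e.toEquiv s (v s k)) := by
  induction t with
  | var x => rfl
  | app F ts ih =>
    simp only [Term.eval, e.map_func]
    congr 1
    funext t x
    exact ih t x

theorem Iso.realize {M N : Struct L} (e : Iso M N) {Γ : List S} (φ : Formula L Γ)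
    (v : Env M.carrier Γ) : φ.Realize M v ↔ φ.Realize N (fun s k => e.toEquiv s (v s k)) := by
  induction φ with
  | falsum => rfl
  | eq t₁ t₂ => simp only [Formula.Realize, ← e.eval, EmbeddingLike.apply_eq_iff_eq]
  | rel R ts => simp only [Formula.Realize, ← e.eval, e.map_rel]
  | imp φ ψ ih₁ ih₂ => simp only [Formula.Realize, ih₁ v, ih₂ v]
  | all s φ ih =>
    simp only [Formula.Realize]
    rw [← (e.toEquiv s).forall_congr_right]
    refine forall_congr' fun a => ?_
    rw [ih]
    have := comp_cons (fun s => e.toEquiv s) a v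
    exact iff_of_eq (congrArg _ this)

/-! ### First-order properties of tuples -/

/-- A property of `X`-tuples in the structures of a family is first-order if a single formula
defines it in all of them. The family `X` of variables may be infinite; the formula mentions
finitely many of them. -/
def FO {ι : Sort*} (𝓜 : ι → Struct L) (X : S → Type u)
    (P : ∀ i, Tuple X (𝓜 i).carrier → Prop) : Prop :=
  ∃ (Γ : List S) (φ : Formula L Γ) (g : Tuple (Var Γ) X), ∀ i x, P i x ↔ φ.Realize (𝓜 i) (x.comp g)

namespace FO

variable {ι : Sort*} {𝓜 : ι → Struct L} {X Y : S → Type u}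

theorem realize {Γ : List S} (φ : Formula L Γ) (g : Tuple (Var Γ) X) :
    FO 𝓜 X (fun i x => φ.Realize (𝓜 i) (x.comp g)) := ⟨Γ, φ, g, fun _ _ => Iff.rfl⟩

theorem congr {P Q : ∀ i, Tuple X (𝓜 i).carrier → Prop} (h : FO 𝓜 X P)
    (hPQ : ∀ i x, Q i x ↔ P i x) : FO 𝓜 X Q := by
  obtain ⟨Γ, φ, g, hφ⟩ := h
  exact ⟨Γ, φ, g, fun i x => (hPQ i x).trans (hφ i x)⟩

theorem comp {P : ∀ i, Tuple X (𝓜 i).carrier → Prop} (h : FO 𝓜 X P) (f : Tuple X Y) :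
    FO 𝓜 Y (fun i y => P i (y.comp f)) := by
  obtain ⟨Γ, φ, g, hφ⟩ := h
  exact ⟨Γ, φ, f.comp g, fun i y => hφ i _⟩

/-- A first-order property of a family of structures is first-order for a reindexed family. -/
theorem pull {κ : Sort*} {P : ∀ i, Tuple X (𝓜 i).carrier → Prop} (h : FO 𝓜 X P) (f : κ → ι) :
    FO (fun k => 𝓜 (f k)) X (fun k => P (f k)) := by
  obtain ⟨Γ, φ, g, hφ⟩ := h
  exact ⟨Γ, φ, g, fun i y => hφ _ _⟩

theorem reduct {𝓝 : ι → Struct L'} (e : LHom L L')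
    {P : ∀ i, Tuple X (𝓝 i).carrier → Prop} (h : FO (fun i => (𝓝 i).reduct e) X P) :
    FO 𝓝 X P := by
  obtain ⟨Γ, φ, g, hφ⟩ := h
  exact ⟨Γ, e.onFormula φ, g, fun i y => (hφ _ _).trans (e.realize_onFormula _ _ _).symm⟩

theorem const_false : FO 𝓜 X (fun _ _ => False) :=
  ⟨[], .falsum, Env.nil, fun _ _ => Iff.rfl⟩

theorem imp {P Q : ∀ i, Tuple X (𝓜 i).carrier → Prop} (hP : FO 𝓜 X P) (hQ : FO 𝓜 X Q) :
    FO 𝓜 X (fun i x => P i x → Q i x) := by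
  obtain ⟨Γ, φ, g, hφ⟩ := hP
  obtain ⟨Δ, ψ, h, hψ⟩ := hQ
  refine ⟨Γ ++ Δ, .imp (φ.rename (Var.left Δ)) (ψ.rename (Var.right Γ)),
    Env.append g h, fun i x => ?_⟩
  simp only [Formula.Realize, Formula.realize_rename, comp_append]
  rw [Env.append_left, Env.append_right, hφ, hψ]

theorem not {P : ∀ i, Tuple X (𝓜 i).carrier → Prop} (hP : FO 𝓜 X P) :
    FO 𝓜 X (fun i x => ¬ P i x) := hP.imp const_false

theorem const_true : FO 𝓜 X (fun _ _ => True) := const_false.not.congr (by simp)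

theorem and {P Q : ∀ i, Tuple X (𝓜 i).carrier → Prop} (hP : FO 𝓜 X P) (hQ : FO 𝓜 X Q) :
    FO 𝓜 X (fun i x => P i x ∧ Q i x) :=
  (hP.imp hQ.not).not.congr fun i x => by tauto

theorem iff {P Q : ∀ i, Tuple X (𝓜 i).carrier → Prop} (hP : FO 𝓜 X P) (hQ : FO 𝓜 X Q) :
    FO 𝓜 X (fun i x => P i x ↔ Q i x) :=
  ((hP.imp hQ).and (hQ.imp hP)).congr fun i x => by tauto

/-- A proposition which depends neither on the structure nor on the tuple. -/
theorem const (p : Prop) : FO 𝓜 X (fun _ _ => p) := by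
  by_cases h : p
  · exact const_true.congr (by simp [h])
  · exact const_false.congr (by simp [h])

theorem eq {s : S} (a b : X s) : FO 𝓜 X (fun _ x => x s a = x s b) :=
  ⟨[s, s], .eq (.var .zero) (.var (.succ .zero)),
    Env.cons a (Env.cons b Env.nil), fun _ _ => Iff.rfl⟩

theorem forall_finite {κ : Type*} [Finite κ] {P : κ → ∀ i, Tuple X (𝓜 i).carrier → Prop}
    (h : ∀ k, FO 𝓜 X (P k)) : FO 𝓜 X (fun i x => ∀ k, P k i x) := by
  have := Fintype.ofFinite κ
  suffices ∀ F : Finset κ, FO 𝓜 X (fun i x => ∀ k ∈ F, P k i x) from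
    (this Finset.univ).congr (by simp)
  intro F
  classical
  induction F using Finset.induction_on with
  | empty => exact const_true.congr (by simp)
  | insert a F _ ih => exact ((h a).and ih).congr (by simp)

theorem exists_finite {κ : Type*} [Finite κ] {P : κ → ∀ i, Tuple X (𝓜 i).carrier → Prop}
    (h : ∀ k, FO 𝓜 X (P k)) : FO 𝓜 X (fun i x => ∃ k, P k i x) :=
  (forall_finite fun k => (h k).not).not.congr (by simp)

/-- Quantification over a finite tuple which stands in front of the other variables. -/
theorem forall_env_aux {Γ Δ : List S} (φ : Formula L (Γ ++ Δ)) :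
    ∃ ψ : Formula L Δ, ∀ (M : Struct L) (d : Env M.carrier Δ),
      ψ.Realize M d ↔ ∀ a : Env M.carrier Γ, φ.Realize M (Env.append a d) := by
  induction Γ with
  | nil => exact ⟨φ, fun M d => ⟨fun h a => h, fun h => h Env.nil⟩⟩
  | cons s Γ ih =>
    obtain ⟨ψ, hψ⟩ := ih (.all s φ)
    refine ⟨ψ, fun M d => (hψ M d).trans ⟨fun h a => h _ _, fun h a b => ?_⟩⟩
    exact h (Env.cons b a)

/-- A first-order property of the pairs `(v, x)`, where `v` is a finite tuple, is defined by a
formula in which the variables of `v` stand in front. -/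
theorem exists_formula_append {Γ : List S}
    {P : ∀ i, Tuple (VSum (Var Γ) X) (𝓜 i).carrier → Prop} (h : FO 𝓜 (VSum (Var Γ) X) P) :
    ∃ (Δ : List S) (φ : Formula L (Γ ++ Δ)) (g : Tuple (Var Δ) X),
      ∀ i (v : Env (𝓜 i).carrier Γ) (x : Tuple X (𝓜 i).carrier),
        P i (Tuple.sum v x) ↔ φ.Realize (𝓜 i) (Env.append v (x.comp g)) := by
  obtain ⟨Δ, φ, g, hφ⟩ := h
  -- The variables of `φ` which are sent to `X` by `g` are collected in a context `Δ'`.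
  have split : ∀ (Δ : List S) (g : Tuple (Var Δ) (VSum (Var Γ) X)), ∃ (Δ' : List S)
      (f : Tuple (Var Δ) (Var (Γ ++ Δ'))) (g' : Tuple (Var Δ') X), ∀ s k,
      g s k = Env.append (M := VSum (Var Γ) X) vinl (fun s k => .inr (g' s k)) s (f s k) := by
    intro Δ
    induction Δ with
    | nil => exact fun g => ⟨[], Env.nil, Env.nil, fun s k => nomatch k⟩
    | cons t Δ ih =>
      intro g
      obtain ⟨Δ', f, g', hg⟩ := ih (fun s k => g s k.succ)
      rcases hz : g t .zero with a | b
      · refine ⟨Δ', Env.cons (M := Var (Γ ++ Δ')) (Var.left Δ' t a) f, g', fun s k => ?_⟩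
        cases k with
        | zero =>
          rw [hz]
          exact (congrFun (congrFun (Env.append_left (M := VSum (Var Γ) X) vinl
            (fun s k => .inr (g' s k))) t) a).symm
        | succ k => exact hg s k
      · refine ⟨t :: Δ', Env.cons (M := Var (Γ ++ t :: Δ')) (Var.right Γ t .zero)
          (Tuple.comp (Env.append (M := Var (Γ ++ t :: Δ')) (Var.left (t :: Δ'))
            (fun s k => Var.right Γ s k.succ)) f), Env.cons b g', fun s k => ?_⟩
        cases k with
        | zero =>
          rw [hz]
          exact (congrFun (congrFun (Env.append_right (M := VSum (Var Γ) X) vinl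
            (fun s k => .inr (Env.cons b g' s k))) t) .zero).symm
        | succ k =>
          rw [hg s k]
          set W : Env (VSum (Var Γ) X) (Γ ++ t :: Δ') :=
            Env.append (M := VSum (Var Γ) X) vinl (fun s k => .inr (Env.cons b g' s k)) with hW
          have h1 : Tuple.comp W (Var.left _) = vinl := Env.append_left _ _
          have h2 : Tuple.comp W (Var.right _) = (fun s k => .inr (Env.cons b g' s k)) :=
            Env.append_right _ _
          have := comp_append (Γ := Γ) (Δ := Δ') W (Var.left (t :: Δ'))
            (fun s k => Var.right Γ s k.succ)
          refine Eq.trans ?_ (congrFun (congrFun this.symm s) (f s k))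
          rw [h1]
          congr 1
          funext s' k'
          exact (congrFun (congrFun h2 s') k'.succ).symm
  obtain ⟨Δ', f, g', hg⟩ := split Δ g
  refine ⟨Δ', φ.rename f, g', fun i v x => ?_⟩
  rw [hφ, Formula.realize_rename]
  have h1 : Env.append v (x.comp g') =
      (Tuple.sum v x).comp (Env.append (M := VSum (Var Γ) X) vinl (fun s k => .inr (g' s k))) := by
    rw [comp_append]; rfl
  rw [h1]
  have : (Tuple.sum v x).comp g = ((Tuple.sum v x).comp
      (Env.append (M := VSum (Var Γ) X) vinl (fun s k => .inr (g' s k)))).comp f := by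
    funext s k
    exact congrArg _ (hg s k)
  rw [this]

theorem forall_env {Γ : List S} {P : ∀ i, Tuple (VSum (Var Γ) X) (𝓜 i).carrier → Prop}
    (h : FO 𝓜 (VSum (Var Γ) X) P) :
    FO 𝓜 X (fun i x => ∀ v : Env (𝓜 i).carrier Γ, P i (Tuple.sum v x)) := by
  obtain ⟨Δ, φ, g, hφ⟩ := h.exists_formula_append
  obtain ⟨ψ, hψ⟩ := forall_env_aux φ
  exact ⟨Δ, ψ, g, fun i x => by simp only [hψ, hφ]⟩

/-- Quantification over an arbitrary family of variables. Since all sorts are nonempty, the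
variables which the formula does not mention do no harm. -/
theorem ex [Finite S] {Q : ∀ i, Tuple X (𝓜 i).carrier → Tuple Y (𝓜 i).carrier → Prop}
    (h : FO 𝓜 (VSum X Y) (fun i z => Q i (z.comp vinl) (z.comp vinr))) :
    FO 𝓜 X (fun i x => ∃ y, Q i x y) := by
  classical
  obtain ⟨Γ, φ, g, hφ⟩ := h
  have hQ : ∀ i x y, Q i x y ↔ φ.Realize (𝓜 i) ((Tuple.sum x y).comp g) :=
    fun i x y => hφ i (Tuple.sum x y)
  -- The values of all variables of `φ` are quantified, subject to the equations which `g` imposes.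
  have key : FO 𝓜 (VSum (Var Γ) X) (fun i z => φ.Realize (𝓜 i) (z.comp vinl) →
      (∀ s, ∀ k : Var Γ s, ∀ k' : Var Γ s, g s k = g s k' → z s (.inl k) = z s (.inl k')) →
      ¬ ∀ s, ∀ k : Var Γ s, Sum.elim (fun a => z s (.inl k) = z s (.inr a)) (fun _ => True)
        (g s k)) := by
    refine (FO.realize φ vinl).imp (FO.imp ?_ (FO.not ?_))
    · exact forall_finite fun s => forall_finite fun k => forall_finite fun k' =>
        (FO.const _).imp (FO.eq _ _)
    · refine forall_finite fun s => forall_finite fun k => ?_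
      rcases g s k with a | b
      · exact FO.eq _ _
      · exact const_true
  refine key.forall_env.not.congr fun i x => ?_
  rw [Classical.not_forall]
  simp only [Classical.not_imp, Classical.not_not]
  constructor
  · rintro ⟨y, hy⟩
    refine ⟨(Tuple.sum x y).comp g, (hQ _ _ _).1 hy,
      fun s k k' hk => congrArg (Tuple.sum x y s) hk, fun s k => ?_⟩
    rcases hk : g s k with a | b
    · change x.sum y s (g s k) = x s a
      rw [hk]
      rfl
    · trivial
  · rintro ⟨v, hv, h1, h2⟩
    have := fun s => (𝓜 i).nonempty s
    refine ⟨fun s b => if hb : ∃ k, g s k = .inr b then v s hb.choose else Classical.arbitrary _,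
      (hQ _ _ _).2 ?_⟩
    convert hv using 1
    funext s k
    have h2 := h2 s k
    rcases hk : g s k with a | b
    · rw [hk] at h2
      simpa [Tuple.comp, hk] using h2.symm
    · have hb : ∃ k, g s k = .inr b := ⟨k, hk⟩
      simp only [Tuple.comp, hk, Sum.elim_inr, dif_pos hb]
      exact h1 s _ _ (hb.choose_spec.trans hk.symm)

theorem all [Finite S] {Q : ∀ i, Tuple X (𝓜 i).carrier → Tuple Y (𝓜 i).carrier → Prop}
    (h : FO 𝓜 (VSum X Y) (fun i z => Q i (z.comp vinl) (z.comp vinr))) :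
    FO 𝓜 X (fun i x => ∀ y, Q i x y) :=
  (FO.ex (Q := fun i x y => ¬ Q i x y) h.not).not.congr (by simp)

/-- Quantification over a single element. -/
theorem ex_one [Finite S] {s : S} {Q : ∀ i, Tuple X (𝓜 i).carrier → (𝓜 i).carrier s → Prop}
    (h : FO 𝓜 (VSum X (Var [s])) (fun i z => Q i (z.comp vinl) (z s (.inr .zero)))) :
    FO 𝓜 X (fun i x => ∃ c, Q i x c) :=
  (FO.ex (Y := Var [s]) (Q := fun i x y => Q i x (y s .zero)) h).congr fun _ _ =>
    ⟨fun ⟨c, hc⟩ => ⟨Env.cons c Env.nil, hc⟩, fun ⟨_, hy⟩ => ⟨_, hy⟩⟩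

theorem all_one [Finite S] {s : S} {Q : ∀ i, Tuple X (𝓜 i).carrier → (𝓜 i).carrier s → Prop}
    (h : FO 𝓜 (VSum X (Var [s])) (fun i z => Q i (z.comp vinl) (z s (.inr .zero)))) :
    FO 𝓜 X (fun i x => ∀ c, Q i x c) :=
  (FO.ex_one (Q := fun i x c => ¬ Q i x c) h.not).not.congr (by simp)

theorem realize_append {Γ Δ : List S} (φ : Formula L (Γ ++ Δ)) (f : Tuple (Var Γ) X)
    (g : Tuple (Var Δ) X) :
    FO 𝓜 X (fun i x => φ.Realize (𝓜 i) (Env.append (x.comp f) (x.comp g))) :=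
  (FO.realize φ (Env.append f g)).congr fun i x => by rw [comp_append]

theorem realize_cons {Γ : List S} {t : S} (φ : Formula L (t :: Γ)) (a : X t)
    (g : Tuple (Var Γ) X) :
    FO 𝓜 X (fun i x => φ.Realize (𝓜 i) (Env.cons (x t a) (x.comp g))) :=
  (FO.realize φ (Env.cons a g)).congr fun i x => by rw [comp_cons]

end FO

/-! ### Types -/

theorem SameType.symm {M N : Struct L} {X : S → Type u} {x : Tuple X M.carrier}
    {y : Tuple X N.carrier} (h : SameType M N x y) : SameType N M y x :=
  fun Γ φ g => (h Γ φ g).symm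

theorem SameType.refl {M : Struct L} {X : S → Type u} (x : Tuple X M.carrier) :
    SameType M M x x := fun _ _ _ => Iff.rfl

theorem SameType.trans {M N K : Struct L} {X : S → Type u} {x : Tuple X M.carrier}
    {y : Tuple X N.carrier} {z : Tuple X K.carrier} (h : SameType M N x y)
    (h' : SameType N K y z) : SameType M K x z :=
  fun Γ φ g => (h Γ φ g).trans (h' Γ φ g)

theorem SameType.comp {M N : Struct L} {X Y : S → Type u} {x : Tuple X M.carrier}
    {y : Tuple X N.carrier} (h : SameType M N x y) (f : Tuple Y X) :
    SameType M N (x.comp f) (y.comp f) := fun Γ φ g => h Γ φ (f.comp g)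

theorem SameType.reduct {M N : Struct L'} {X : S → Type u} {x : Tuple X M.carrier}
    {y : Tuple X N.carrier} (h : SameType M N x y) (e : LHom L L') :
    SameType (M.reduct e) (N.reduct e) x y := fun Γ φ g => by
  have := h Γ (e.onFormula φ) g
  rwa [LHom.realize_onFormula, LHom.realize_onFormula] at this

theorem SameType.iff {M N : Struct L} {X : S → Type u} {x : Tuple X M.carrier}
    {y : Tuple X N.carrier} (h : SameType M N x y)
    {P : ∀ M : Struct L, Tuple X M.carrier → Prop} (hP : FO (fun M : Struct L => M) X P) :
    P M x ↔ P N y := by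
  obtain ⟨Γ, φ, g, hφ⟩ := hP
  exact (hφ M x).trans ((h Γ φ g).trans (hφ N y).symm)

theorem sameType_env_iff {M N : Struct L} {Γ : List S} {x : Env M.carrier Γ}
    {y : Env N.carrier Γ} :
    SameType M N x y ↔ ∀ φ : Formula L Γ, φ.Realize M x ↔ φ.Realize N y := by
  refine ⟨fun h φ => h Γ φ fun _ k => k, fun h Δ φ g => ?_⟩
  have := h (φ.rename g)
  rwa [Formula.realize_rename, Formula.realize_rename] at this

theorem SameType.eq_iff {M N : Struct L} {X : S → Type u} {x : Tuple X M.carrier}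
    {y : Tuple X N.carrier} (h : SameType M N x y) {s : S} (a b : X s) :
    x s a = x s b ↔ y s a = y s b :=
  h.iff (P := fun _ x => x s a = x s b) (FO.eq a b)

theorem IsElementaryEmbedding.sameType {M N : Struct L} {j : Tuple M.carrier N.carrier}
    (hj : IsElementaryEmbedding M N j) {X : S → Type u} (x : Tuple X M.carrier) :
    SameType M N x (j.comp x) := fun Γ φ g => hj Γ φ (x.comp g)

theorem SameType.isElementaryEmbedding {M N : Struct L} {j : Tuple M.carrier N.carrier}
    (h : SameType M N (fun _ a => a) j) : IsElementaryEmbedding M N j := fun Γ φ v => h Γ φ v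

theorem IsElementaryEmbedding.reduct {M N : Struct L'} {j : Tuple M.carrier N.carrier}
    (hj : IsElementaryEmbedding M N j) (e : LHom L L') :
    IsElementaryEmbedding (M.reduct e) (N.reduct e) j :=
  SameType.isElementaryEmbedding ((hj.sameType (fun _ a => a)).reduct e)

/-- Elementary equivalence of structures: the empty tuples have the same type. -/
def ElemEquiv (M N : Struct L) : Prop :=
  SameType (X := fun _ => PEmpty) M N (fun _ x => x.elim) (fun _ x => x.elim)

theorem elemEquiv_iff {M N : Struct L} :
    ElemEquiv M N ↔ ∀ φ : Sentence L, M.Satisfies φ ↔ N.Satisfies φ := by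
  constructor
  · intro h φ
    have := h [] φ (fun _ k => nomatch k)
    unfold Struct.Satisfies
    convert this using 2 <;> exact Env.eq_nil _ _
  · intro h Γ φ g
    cases Γ with
    | nil =>
      have := h φ
      unfold Struct.Satisfies at this
      convert this using 2 <;> exact Env.eq_nil _ _
    | cons s Γ => exact (g s .zero).elim

theorem SameType.elemEquiv {M N : Struct L} {X : S → Type u} {x : Tuple X M.carrier}
    {y : Tuple X N.carrier} (h : SameType M N x y) : ElemEquiv M N := by
  have := h.comp (Y := fun _ => PEmpty) (fun _ k => k.elim)
  unfold ElemEquiv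
  convert this using 1 <;> exact funext fun s => funext fun k => k.elim

theorem ElemEquiv.symm {M N : Struct L} (h : ElemEquiv M N) : ElemEquiv N M := SameType.symm h

theorem ElemEquiv.reduct {M N : Struct L'} (h : ElemEquiv M N) (e : LHom L L') :
    ElemEquiv (M.reduct e) (N.reduct e) := SameType.reduct h e

theorem ElemEquiv.models {M N : Struct L} (h : ElemEquiv M N) {T : Theory L} (hM : M.Models T) :
    N.Models T := fun φ hφ => (elemEquiv_iff.1 h φ).1 (hM φ hφ)

theorem ElemEquiv.iff {M N : Struct L} (h : ElemEquiv M N)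
    {P : Struct L → Prop} (hP : FO (fun M : Struct L => M) (fun _ => PEmpty) fun M _ => P M) :
    P M ↔ P N := SameType.iff (P := fun M _ => P M) h hP

theorem Theory.Complete.elemEquiv {T : Theory L} (hT : T.Complete) {M N : Struct L}
    (hM : M.Models T) (hN : N.Models T) : ElemEquiv M N := by
  refine elemEquiv_iff.2 fun φ => ?_
  rcases hT.2 φ with h | h
  · exact iff_of_true (h M hM) (h N hN)
  · exact iff_of_false (h M hM) (h N hN)

theorem Iso.elemEquiv {M N : Struct L} (e : Iso M N) : ElemEquiv M N :=
  fun Γ φ g => by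
    rw [e.realize]
    convert Iff.rfl using 4 with s k
    exact (g s k).elim

end ManySorted

namespace ManySorted

variable {S : Type u} {L : SortedLanguage S}

/-! ### Ultraproducts and compactness -/

section Ultraproduct

variable {ι : Type u} (𝒰 : Ultrafilter ι) (M : ι → Struct L)

/-- The ultraproduct of a family of structures. A symbol is interpreted on representatives. -/
noncomputable def ultraproduct : Struct L where
  carrier s := (𝒰 : Filter ι).Product fun i => (M i).carrier s
  nonempty s := ⟨Quotient.mk _ fun i => ((M i).nonempty s).some⟩
  func f v := Quotient.mk _ fun i => (M i).func f fun t x => (v t x).out i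
  rel R v := ∀ᶠ i in 𝒰, (M i).rel R fun t x => (v t x).out i

variable {M}

/-- The class of a family of tuples in the ultraproduct. -/
def ultraproduct.mk {X : S → Type u} (w : ∀ i, Tuple X (M i).carrier) :
    Tuple X (ultraproduct 𝒰 M).carrier :=
  fun s k => Quotient.mk _ fun i => w i s k

theorem ultraproduct.eventually_out [Finite S] {Γ : List S} (w : ∀ i, Env (M i).carrier Γ) :
    ∀ᶠ i in 𝒰, (fun t x => (ultraproduct.mk 𝒰 w t x).out i : Env (M i).carrier Γ) = w i := by
  have : ∀ᶠ i in 𝒰, ∀ t, ∀ x : Var Γ t, (ultraproduct.mk 𝒰 w t x).out i = w i t x := by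
    refine Filter.eventually_all.2 fun t => Filter.eventually_all.2 fun x => ?_
    exact Quotient.exact (Quotient.out_eq (ultraproduct.mk 𝒰 w t x))
  exact this.mono fun i hi => funext fun t => funext fun x => hi t x

theorem ultraproduct.eval [Finite S] {Γ : List S} {s : S} (t : Term L Γ s)
    (w : ∀ i, Env (M i).carrier Γ) :
    t.eval (ultraproduct 𝒰 M) (ultraproduct.mk 𝒰 w) =
      Quotient.mk _ fun i => t.eval (M i) (w i) := by
  induction t with
  | var x => rfl
  | app f ts ih =>
    simp only [Term.eval, ih]
    refine Quotient.sound ?_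
    refine (ultraproduct.eventually_out 𝒰
      fun i => (fun t x => (ts t x).eval (M i) (w i))).mono fun i hi => ?_
    exact congrArg ((M i).func f) hi

/-- Łoś's theorem. -/
theorem ultraproduct.realize [Finite S] {Γ : List S} (φ : Formula L Γ)
    (w : ∀ i, Env (M i).carrier Γ) :
    φ.Realize (ultraproduct 𝒰 M) (ultraproduct.mk 𝒰 w) ↔ ∀ᶠ i in 𝒰, φ.Realize (M i) (w i) := by
  induction φ with
  | falsum => simp [Formula.Realize, 𝒰.neBot.ne]
  | eq t₁ t₂ =>
    simp only [Formula.Realize, ultraproduct.eval]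
    exact Quotient.eq
  | rel R ts =>
    simp only [Formula.Realize, ultraproduct.eval]
    refine Filter.eventually_congr ?_
    refine (ultraproduct.eventually_out 𝒰
      fun i => (fun t x => (ts t x).eval (M i) (w i))).mono fun i hi => ?_
    exact iff_of_eq (congrArg ((M i).rel R) hi)
  | imp φ ψ ih₁ ih₂ => simp only [Formula.Realize, ih₁, ih₂, Ultrafilter.eventually_imp]
  | all s φ ih =>
    simp only [Formula.Realize]
    have key : ∀ a : ∀ i, (M i).carrier s, φ.Realize (ultraproduct 𝒰 M)
        (Env.cons (Quotient.mk _ a) (ultraproduct.mk 𝒰 w)) ↔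
          ∀ᶠ i in 𝒰, φ.Realize (M i) (Env.cons (a i) (w i)) := by
      intro a
      rw [← ih]
      apply iff_of_eq
      congr 1
      funext t x
      cases x <;> rfl
    constructor
    · intro h
      by_contra hn
      rw [← Ultrafilter.eventually_not] at hn
      have hex : ∀ i, ∃ a, (∃ a, ¬ φ.Realize (M i) (Env.cons a (w i))) →
          ¬ φ.Realize (M i) (Env.cons a (w i)) := fun i => by
        have := (M i).nonempty s
        by_cases hi : ∃ a, ¬ φ.Realize (M i) (Env.cons a (w i))
        · exact ⟨hi.choose, fun _ => hi.choose_spec⟩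
        · exact ⟨Classical.arbitrary _, fun h => (hi h).elim⟩
      choose a ha using hex
      have h1 := (key a).1 (h _)
      refine (h1.and hn).exists.elim fun i hi => ?_
      exact ha i (by simpa using hi.2) hi.1
    · intro h a
      induction a using Quotient.inductionOn with
      | h a => exact (key a).2 (h.mono fun i hi => hi (a i))

end Ultraproduct

/-- An `L`-formula whose variables are named by elements of `X`. -/
abbrev NamedFormula (L : SortedLanguage S) (X : S → Type u) : Type u :=
  Σ Γ : List S, Formula L Γ × Tuple (Var Γ) X

/-- The tuple `x` satisfies the formula `q`. -/
def NamedFormula.Holds {X : S → Type u} (q : NamedFormula L X) (M : Struct L)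
    (x : Tuple X M.carrier) : Prop :=
  q.2.1.Realize M (x.comp q.2.2)

/-- Compactness for types in arbitrarily many variables. -/
theorem compactness [Finite S] {X : S → Type u} (p : Set (NamedFormula L X))
    (h : ∀ F : Finset (NamedFormula L X), (∀ q ∈ F, q ∈ p) →
      ∃ (M : Struct L) (x : Tuple X M.carrier), ∀ q ∈ F, q.Holds M x) :
    ∃ (M : Struct L) (x : Tuple X M.carrier), ∀ q ∈ p, q.Holds M x := by
  classical
  have h' : ∀ F : Finset p, ∃ (M : Struct L) (x : Tuple X M.carrier),
      ∀ q ∈ F, NamedFormula.Holds q.1 M x := fun F => by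
    obtain ⟨M, x, hx⟩ := h (F.image Subtype.val) (by simp +contextual)
    exact ⟨M, x, fun q hq => hx q.1 (Finset.mem_image_of_mem _ hq)⟩
  choose M x hx using h'
  let 𝒰 : Ultrafilter (Finset p) := Ultrafilter.of Filter.atTop
  refine ⟨ultraproduct 𝒰 M, ultraproduct.mk 𝒰 x, fun q hq => ?_⟩
  refine (ultraproduct.realize 𝒰 q.2.1 fun i => (x i).comp q.2.2).2 ?_
  have : ∀ᶠ F in (Filter.atTop : Filter (Finset p)), (⟨q, hq⟩ : p) ∈ F :=
    (Filter.eventually_ge_atTop {(⟨q, hq⟩ : p)}).mono fun F hF => hF (Finset.mem_singleton_self _)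
  exact Filter.mem_of_superset (Ultrafilter.of_le _ this) fun F hF => hx F _ hF

/-- Compactness for types over a structure: if all finite parts of `p` are realized in `M`, then
`p` is realized in a structure elementarily equivalent to `M`. -/
theorem compactness_elemEquiv [Finite S] {M : Struct L} {X : S → Type u}
    (p : Set (NamedFormula L X))
    (h : ∀ F : Finset (NamedFormula L X), (∀ q ∈ F, q ∈ p) →
      ∃ x : Tuple X M.carrier, ∀ q ∈ F, q.Holds M x) :
    ∃ (N : Struct L) (x : Tuple X N.carrier), ElemEquiv M N ∧ ∀ q ∈ p, q.Holds N x := by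
  classical
  let th : Set (NamedFormula L X) :=
    {q | ∃ φ : Sentence L, M.Satisfies φ ∧ q = ⟨[], φ, fun _ k => nomatch k⟩}
  obtain ⟨N, x, hN⟩ := compactness (p ∪ th) fun F hF => by
    obtain ⟨x, hx⟩ := h (F.filter (· ∈ p)) (by simp)
    refine ⟨M, x, fun q hq => ?_⟩
    rcases hF q hq with hp | ⟨φ, hφ, rfl⟩
    · exact hx q (by simp [hp, hq])
    · unfold Struct.Satisfies at hφ
      unfold NamedFormula.Holds
      convert hφ using 1
      exact Env.eq_nil _ _
  have hsat : ∀ φ : Sentence L, M.Satisfies φ → N.Satisfies φ := fun φ hφ => by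
    have := hN _ (Or.inr ⟨φ, hφ, rfl⟩)
    unfold Struct.Satisfies
    unfold NamedFormula.Holds at this
    convert this using 1
    exact Env.eq_nil _ _
  refine ⟨N, x, elemEquiv_iff.2 fun φ => ⟨hsat φ, fun hφ => ?_⟩, fun q hq => hN q (Or.inl hq)⟩
  by_contra hn
  exact hsat φ.neg hn hφ

/-- Amalgamation of two elementary extensions. -/
theorem exists_amalgam [Finite S] {M N₁ N₂ : Struct L} {j₁ : Tuple M.carrier N₁.carrier}
    {j₂ : Tuple M.carrier N₂.carrier} (h₁ : IsElementaryEmbedding M N₁ j₁)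
    (h₂ : IsElementaryEmbedding M N₂ j₂) :
    ∃ (N : Struct L) (e₁ : Tuple N₁.carrier N.carrier) (e₂ : Tuple N₂.carrier N.carrier),
      IsElementaryEmbedding N₁ N e₁ ∧ IsElementaryEmbedding N₂ N e₂ ∧
        e₁.comp j₁ = e₂.comp j₂ := by
  classical
  -- The union of the elementary diagrams, with the two copies of `M` identified.
  let p₁ : Set (NamedFormula L (VSum N₁.carrier N₂.carrier)) :=
    {q | ∃ (Γ : List S) (φ : Formula L Γ) (v : Env N₁.carrier Γ), φ.Realize N₁ v ∧
      q = ⟨Γ, φ, Tuple.comp vinl v⟩}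
  let p₂ : Set (NamedFormula L (VSum N₁.carrier N₂.carrier)) :=
    {q | ∃ (Γ : List S) (φ : Formula L Γ) (v : Env N₂.carrier Γ), φ.Realize N₂ v ∧
      q = ⟨Γ, φ, Tuple.comp vinr v⟩}
  let eqn : ∀ s, M.carrier s → NamedFormula L (VSum N₁.carrier N₂.carrier) := fun s m =>
    ⟨[s, s], .eq (.var .zero) (.var (.succ .zero)),
      Env.cons (.inl (j₁ s m)) (Env.cons (.inr (j₂ s m)) Env.nil)⟩
  let p₃ : Set (NamedFormula L (VSum N₁.carrier N₂.carrier)) := {q | ∃ s m, q = eqn s m}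
  obtain ⟨N, x, hx⟩ := compactness (p₁ ∪ p₂ ∪ p₃) fun F hF => by
    -- Finitely many formulas of the diagram of `N₁` speak of a finite tuple over `M`, which is
    -- found in `N₂`.
    have key : ∀ F : Finset (NamedFormula L (VSum N₁.carrier N₂.carrier)),
        ∃ Q : ∀ K : Struct L, Tuple (VSum M.carrier N₁.carrier) K.carrier → Prop,
          FO (fun K : Struct L => K) (VSum M.carrier N₁.carrier) Q ∧
          Q N₁ (Tuple.sum j₁ fun _ a => a) ∧
          ∀ z : Tuple (VSum M.carrier N₁.carrier) N₂.carrier, Q N₂ z →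
            z.comp vinl = j₂ → ∀ q ∈ F, q ∈ p₁ ∪ p₂ ∪ p₃ →
              q.Holds N₂ (Tuple.sum (z.comp vinr) fun _ a => a) := by
      intro F
      induction F using Finset.induction_on with
      | empty => exact ⟨fun _ _ => True, FO.const_true, trivial, by simp⟩
      | insert q F _ ih =>
        obtain ⟨Q, hQ, hQ₁, hQ₂⟩ := ih
        have step : ∃ R : ∀ K : Struct L, Tuple (VSum M.carrier N₁.carrier) K.carrier → Prop,
            FO (fun K : Struct L => K) (VSum M.carrier N₁.carrier) R ∧
            R N₁ (Tuple.sum j₁ fun _ a => a) ∧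
            ∀ z : Tuple (VSum M.carrier N₁.carrier) N₂.carrier, R N₂ z →
              z.comp vinl = j₂ → q ∈ p₁ ∪ p₂ ∪ p₃ →
                q.Holds N₂ (Tuple.sum (z.comp vinr) fun _ a => a) := by
          by_cases hq₁ : q ∈ p₁
          · obtain ⟨Γ, φ, v, hφ, rfl⟩ := hq₁
            exact ⟨_, FO.realize φ (Tuple.comp vinr v), hφ, fun z hz _ _ => hz⟩
          · by_cases hq₃ : q ∈ p₃
            · obtain ⟨s, m, rfl⟩ := hq₃
              refine ⟨_, FO.eq (s := s) (.inr (j₁ s m)) (.inl m), rfl, fun z hz hj _ => ?_⟩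
              have := congrFun (congrFun hj s) m
              exact hz.trans this
            · refine ⟨_, FO.const_true, trivial, fun z _ _ hq => ?_⟩
              rcases hq with (hq | ⟨Γ, φ, v, hφ, rfl⟩) | hq
              · exact (hq₁ hq).elim
              · exact hφ
              · exact (hq₃ hq).elim
        obtain ⟨R, hR, hR₁, hR₂⟩ := step
        refine ⟨_, hQ.and hR, ⟨hQ₁, hR₁⟩, fun z hz hj q' hq' hmem => ?_⟩
        rcases Finset.mem_insert.1 hq' with rfl | hq'
        · exact hR₂ z hz.2 hj hmem
        · exact hQ₂ z hz.1 hj q' hq' hmem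
    obtain ⟨Q, hQ, hQ₁, hQ₂⟩ := key F
    have hst : SameType N₁ N₂ j₁ j₂ :=
      ((h₁.sameType (fun _ a => a)).symm).trans (h₂.sameType (fun _ a => a))
    have hex : FO (fun K : Struct L => K) M.carrier (fun K m =>
        ∃ y : Tuple N₁.carrier K.carrier, Q K (Tuple.sum m y)) :=
      FO.ex (Q := fun K m y => Q K (Tuple.sum m y))
        (hQ.congr fun K z => by rw [Tuple.sum_eta])
    obtain ⟨y, hy⟩ := (hst.iff hex).1 ⟨_, hQ₁⟩
    exact ⟨N₂, _, fun q hq => hQ₂ _ hy rfl q hq (hF q hq)⟩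
  have hdiag : ∀ (K : Struct L) (e : Tuple K.carrier N.carrier),
      (∀ (Γ : List S) (φ : Formula L Γ) (v : Env K.carrier Γ), φ.Realize K v →
        φ.Realize N (e.comp v)) → IsElementaryEmbedding K N e := fun K e he Γ φ v =>
    ⟨he Γ φ v, fun hn => by
      by_contra hK
      exact he Γ φ.neg v hK hn⟩
  refine ⟨N, x.comp vinl, x.comp vinr, hdiag _ _ fun Γ φ v hφ => ?_,
    hdiag _ _ fun Γ φ v hφ => ?_, ?_⟩
  · exact hx _ (Or.inl (Or.inl ⟨Γ, φ, v, hφ, rfl⟩))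
  · exact hx _ (Or.inl (Or.inr ⟨Γ, φ, v, hφ, rfl⟩))
  · funext s m
    exact hx _ (Or.inr ⟨s, m, rfl⟩)

/-! ### Elementary substructures -/

/-- The Tarski–Vaught test: a subset which contains witnesses for all formulas with parameters in it
is the universe of an elementary substructure. -/
theorem exists_elementary_substructure (N : Struct L) (A : SubFamily N.carrier)
    (hA : ∀ (Γ : List S) (s : S) (φ : Formula L (s :: Γ)) (v : Env N.carrier Γ),
      (∀ t k, v t k ∈ A t) → (∃ a, φ.Realize N (Env.cons a v)) →
        ∃ a ∈ A s, φ.Realize N (Env.cons a v)) :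
    ∃ (K : Struct L) (j : Tuple K.carrier N.carrier), IsElementaryEmbedding K N j ∧
      (∀ s, Function.Injective (j s)) ∧ j.range = A := by
  have hf : ∀ {σ : List S} {s : S} (f : L.Func σ s) (v : Env (fun s => A s) σ),
      N.func f (fun t x => (v t x).1) ∈ A s := fun {σ s} f v => by
    obtain ⟨a, ha, h⟩ := hA σ s (.eq (.var .zero) (.app f fun t x => .var x.succ))
      (fun t x => (v t x).1) (fun t k => (v t k).2)
      ⟨N.func f fun t x => (v t x).1, rfl⟩
    have h' : a = N.func f fun t x => (v t x).1 := h
    rwa [h'] at ha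
  let K : Struct L :=
    { carrier := fun s => A s
      nonempty := fun s => by
        obtain ⟨a, ha, -⟩ := hA [] s (.eq (.var .zero) (.var .zero)) Env.nil
          (fun t k => nomatch k) ⟨(N.nonempty s).some, rfl⟩
        exact ⟨a, ha⟩
      func := fun f v => ⟨_, hf f v⟩
      rel := fun R v => N.rel R (fun t x => (v t x).1) }
  have heval : ∀ {Γ : List S} {s : S} (t : Term L Γ s) (v : Env K.carrier Γ),
      (t.eval K v).1 = t.eval N (fun s k => (v s k).1) := fun t v => by
    induction t with
    | var x => rfl
    | app f ts ih =>
      simp only [Term.eval, ← ih]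
      rfl
  refine ⟨K, fun s a => a.1, fun Γ φ v => ?_, fun s => Subtype.val_injective, ?_⟩
  · induction φ with
    | falsum => rfl
    | eq t₁ t₂ =>
      simp only [Formula.Realize, ← heval]
      exact Subtype.ext_iff
    | rel R ts => simp only [Formula.Realize, ← heval]; rfl
    | imp φ ψ ih₁ ih₂ => simp only [Formula.Realize, ih₁ v, ih₂ v]
    | @all Γ s φ ih =>
      have hc : ∀ a : K.carrier s, (fun t k => (Env.cons a v t k).1 : Env N.carrier (s :: Γ)) =
          Env.cons a.1 (fun t k => (v t k).1) := fun a => by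
        funext t k; cases k <;> rfl
      simp only [Formula.Realize, ih, hc]
      refine ⟨fun h => ?_, fun h a => h a.1⟩
      by_contra hn
      push Not at hn
      obtain ⟨a, ha, hφ⟩ := hA _ s φ.neg (fun t k => (v t k).1) (fun t k => (v t k).2) hn
      exact hφ (h ⟨a, ha⟩)
  · funext s
    exact Subtype.range_val

/-- The terms of depth at most `n`. -/
def Term.lvl (L : SortedLanguage S) (Γ : List S) : ℕ → ∀ s, Set (Term L Γ s)
  | 0, _ => ∅
  | n + 1, _ => {t | (∃ x, t = .var x) ∨
      ∃ (σ : List S) (f : L.Func σ _) (ts : ∀ t, Var σ t → Term L Γ t),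
        (∀ u x, ts u x ∈ Term.lvl L Γ n u) ∧ t = .app f ts}

theorem Term.lvl_mono {Γ : List S} : ∀ {m n : ℕ}, m ≤ n → ∀ s,
    Term.lvl L Γ m s ⊆ Term.lvl L Γ n s
  | 0, _, _, _ => fun _ h => h.elim
  | m + 1, 0, h, _ => by omega
  | m + 1, n + 1, h, s => by
    rintro t (⟨x, rfl⟩ | ⟨σ, f, ts, hts, rfl⟩)
    · exact Or.inl ⟨x, rfl⟩
    · exact Or.inr ⟨σ, f, ts, fun u x => Term.lvl_mono (by omega) u (hts u x), rfl⟩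

/-- Finitely many eventually true statements, one for each variable of a context, are true from a
common stage on. -/
theorem exists_uniform_bound [Finite S] {Γ : List S} {P : ∀ s, Var Γ s → ℕ → Prop}
    (hP : ∀ s x m n, m ≤ n → P s x m → P s x n) (h : ∀ s x, ∃ n, P s x n) :
    ∃ n, ∀ s x, P s x n := by
  have := Fintype.ofFinite (Σ s, Var Γ s)
  choose n hn using h
  refine ⟨Finset.univ.sup fun p : Σ s, Var Γ s => n p.1 p.2, fun s x => hP s x _ _ ?_ (hn s x)⟩
  exact Finset.le_sup (f := fun p : Σ s, Var Γ s => n p.1 p.2) (Finset.mem_univ ⟨s, x⟩)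

theorem Term.exists_mem_lvl [Finite S] {Γ : List S} {s : S} (t : Term L Γ s) :
    ∃ n, t ∈ Term.lvl L Γ n s := by
  induction t with
  | var x => exact ⟨1, Or.inl ⟨x, rfl⟩⟩
  | @app σ s f ts ih =>
    obtain ⟨n, hn⟩ := exists_uniform_bound (P := fun t x n => ts t x ∈ Term.lvl L Γ n t)
      (fun s x m n hmn h => Term.lvl_mono hmn s h) ih
    exact ⟨n + 1, Or.inr ⟨σ, f, ts, hn, rfl⟩⟩

theorem SortedLanguage.IsCountable.func (hL : L.IsCountable) (s : S) :
    Countable (Σ σ, L.Func σ s) := by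
  have := hL.1
  refine Function.Injective.countable
    (f := fun p : Σ σ, L.Func σ s => (⟨(p.1, s), p.2⟩ : Σ p : List S × S, L.Func p.1 p.2)) ?_
  rintro ⟨σ, f⟩ ⟨τ, g⟩ h
  simpa using h

theorem Term.countable [Finite S] (hL : L.IsCountable) (Γ : List S) (s : S) :
    Countable (Term L Γ s) := by
  have hlvl : ∀ n s, (Term.lvl L Γ n s).Countable := by
    intro n
    induction n with
    | zero => exact fun s => Set.countable_empty
    | succ n ih =>
      intro s
      have := hL.func s
      have := fun t => (ih t).to_subtype
      refine ((Set.countable_range fun x : Var Γ s => (Term.var x : Term L Γ s)).union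
        (Set.countable_range fun p : Σ f : (Σ σ, L.Func σ s),
          (∀ t, Var f.1 t → Term.lvl L Γ n t) =>
            (Term.app p.1.2 (fun t x => (p.2 t x).1) : Term L Γ s))).mono ?_
      rintro t (⟨x, rfl⟩ | ⟨σ, f, ts, hts, rfl⟩)
      · exact Or.inl ⟨x, rfl⟩
      · exact Or.inr ⟨⟨⟨σ, f⟩, fun t x => ⟨ts t x, hts t x⟩⟩, rfl⟩
  rw [← Set.countable_univ_iff]
  refine (Set.countable_iUnion fun n => hlvl n s).mono fun t _ => ?_
  exact Set.mem_iUnion.2 t.exists_mem_lvl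

/-- The formulas of depth at most `n`. -/
def Formula.lvl (L : SortedLanguage S) : ℕ → ∀ Γ, Set (Formula L Γ)
  | 0, _ => ∅
  | n + 1, Γ => {φ | φ = .falsum ∨ (∃ (s : S) (t₁ t₂ : Term L Γ s), φ = .eq t₁ t₂) ∨
      (∃ (σ : List S) (R : L.Rel σ) (ts : ∀ t, Var σ t → Term L Γ t), φ = .rel R ts) ∨
      (∃ α ∈ Formula.lvl L n Γ, ∃ β ∈ Formula.lvl L n Γ, φ = .imp α β) ∨
      ∃ (s : S), ∃ α ∈ Formula.lvl L n (s :: Γ), φ = .all s α}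

theorem Formula.lvl_mono : ∀ {m n : ℕ}, m ≤ n → ∀ Γ, Formula.lvl L m Γ ⊆ Formula.lvl L n Γ
  | 0, _, _, _ => fun _ h => h.elim
  | m + 1, 0, h, _ => by omega
  | m + 1, n + 1, h, Γ => by
    have ih : ∀ Γ, Formula.lvl L m Γ ⊆ Formula.lvl L n Γ := Formula.lvl_mono (by omega)
    rintro φ (h | h | h | ⟨α, hα, β, hβ, rfl⟩ | ⟨s, α, hα, rfl⟩)
    · exact Or.inl h
    · exact Or.inr (Or.inl h)
    · exact Or.inr (Or.inr (Or.inl h))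
    · exact Or.inr (Or.inr (Or.inr (Or.inl ⟨α, ih _ hα, β, ih _ hβ, rfl⟩)))
    · exact Or.inr (Or.inr (Or.inr (Or.inr ⟨s, α, ih _ hα, rfl⟩)))

theorem Formula.exists_mem_lvl {Γ : List S} (φ : Formula L Γ) : ∃ n, φ ∈ Formula.lvl L n Γ := by
  induction φ with
  | falsum => exact ⟨1, Or.inl rfl⟩
  | eq t₁ t₂ => exact ⟨1, Or.inr (Or.inl ⟨_, t₁, t₂, rfl⟩)⟩
  | rel R ts => exact ⟨1, Or.inr (Or.inr (Or.inl ⟨_, R, ts, rfl⟩))⟩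
  | imp φ ψ ih₁ ih₂ =>
    obtain ⟨m, hm⟩ := ih₁
    obtain ⟨n, hn⟩ := ih₂
    exact ⟨max m n + 1, Or.inr (Or.inr (Or.inr (Or.inl
      ⟨φ, Formula.lvl_mono (le_max_left _ _) _ hm, ψ, Formula.lvl_mono (le_max_right _ _) _ hn,
        rfl⟩)))⟩
  | all s φ ih =>
    obtain ⟨n, hn⟩ := ih
    exact ⟨n + 1, Or.inr (Or.inr (Or.inr (Or.inr ⟨s, φ, hn, rfl⟩)))⟩

theorem Formula.countable [Finite S] (hL : L.IsCountable) (Γ : List S) :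
    Countable (Formula L Γ) := by
  have hlvl : ∀ n Γ, (Formula.lvl L n Γ).Countable := by
    intro n
    induction n with
    | zero => exact fun s => Set.countable_empty
    | succ n ih =>
      intro Γ
      have := hL.2
      have := Term.countable hL Γ
      have := fun Γ => (ih Γ).to_subtype
      refine ((Set.countable_singleton (Formula.falsum : Formula L Γ)).union
        ((Set.countable_range fun p : Σ s, Term L Γ s × Term L Γ s =>
          (Formula.eq p.2.1 p.2.2 : Formula L Γ)).union
        ((Set.countable_range fun p : Σ R : (Σ σ, L.Rel σ), (∀ t, Var R.1 t → Term L Γ t) =>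
          (Formula.rel p.1.2 p.2 : Formula L Γ)).union
        ((Set.countable_range fun p : Formula.lvl L n Γ × Formula.lvl L n Γ =>
          (Formula.imp p.1.1 p.2.1 : Formula L Γ)).union
        (Set.countable_range fun p : Σ s, Formula.lvl L n (s :: Γ) =>
          (Formula.all p.1 p.2.1 : Formula L Γ)))))).mono ?_
      rintro φ (rfl | ⟨s, t₁, t₂, rfl⟩ | ⟨σ, R, ts, rfl⟩ | ⟨α, hα, β, hβ, rfl⟩ | ⟨s, α, hα, rfl⟩)
      · exact Or.inl rfl
      · exact Or.inr (Or.inl ⟨⟨s, t₁, t₂⟩, rfl⟩)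
      · exact Or.inr (Or.inr (Or.inl ⟨⟨⟨σ, R⟩, ts⟩, rfl⟩))
      · exact Or.inr (Or.inr (Or.inr (Or.inl ⟨⟨⟨α, hα⟩, ⟨β, hβ⟩⟩, rfl⟩)))
      · exact Or.inr (Or.inr (Or.inr (Or.inr ⟨⟨s, ⟨α, hα⟩⟩, rfl⟩)))
  rw [← Set.countable_univ_iff]
  refine (Set.countable_iUnion fun n => hlvl n Γ).mono fun φ _ => ?_
  exact Set.mem_iUnion.2 φ.exists_mem_lvl

/-- The downward Löwenheim–Skolem theorem: a countable subset is contained in a countable elementary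
substructure. -/
theorem exists_countable_elementary [Finite S] (hL : L.IsCountable) (N : Struct L)
    (A : SubFamily N.carrier) (hA : ∀ s, (A s).Countable) :
    ∃ (K : Struct L) (j : Tuple K.carrier N.carrier), IsElementaryEmbedding K N j ∧
      (∀ s, Countable (K.carrier s)) ∧ A ≤ j.range := by
  classical
  have := Formula.countable hL
  have hex : ∀ (Γ : List S) (s : S) (φ : Formula L (s :: Γ)) (v : Env N.carrier Γ),
      ∃ a, (∃ a, φ.Realize N (Env.cons a v)) → φ.Realize N (Env.cons a v) := fun Γ s φ v => by
    by_cases h : ∃ a, φ.Realize N (Env.cons a v)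
    · exact ⟨h.choose, fun _ => h.choose_spec⟩
    · exact ⟨(N.nonempty s).some, fun h' => (h h').elim⟩
  choose w hw using hex
  let step : SubFamily N.carrier → SubFamily N.carrier := fun B s =>
    B s ∪ Set.range fun p : Σ Γ : List S, Formula L (s :: Γ) × (∀ t, Var Γ t → B t) =>
      w p.1 s p.2.1 fun t x => (p.2.2 t x).1
  let B : ℕ → SubFamily N.carrier := fun n => n.rec A fun _ => step
  have hB : ∀ n s, (B n s).Countable := by
    intro n
    induction n with
    | zero => exact hA
    | succ n ih =>
      intro s
      have := fun t => (ih t).to_subtype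
      exact (ih s).union (Set.countable_range _)
  have hBmono : ∀ m n, m ≤ n → ∀ s, B m s ⊆ B n s := fun m n h s => by
    induction h with
    | refl => exact subset_rfl
    | step _ ih => exact ih.trans Set.subset_union_left
  obtain ⟨K, j, hj, hinj, hr⟩ := exists_elementary_substructure N (fun s => ⋃ n, B n s)
    fun Γ s φ v hv hφ => by
      obtain ⟨n, hn⟩ := exists_uniform_bound (P := fun t x n => v t x ∈ B n t)
        (fun s x m n hmn h => hBmono m n hmn s h) (fun t x => Set.mem_iUnion.1 (hv t x))
      refine ⟨w Γ s φ v, Set.mem_iUnion.2 ⟨n + 1, Or.inr ?_⟩, hw Γ s φ v hφ⟩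
      exact ⟨⟨Γ, φ, fun t x => ⟨v t x, hn t x⟩⟩, rfl⟩
  refine ⟨K, j, hj, fun s => ?_, fun s a ha => ?_⟩
  · have h1 : (Set.range (j s)).Countable := by
      have : j.range s = ⋃ n, B n s := congrFun hr s
      rw [Tuple.range] at this
      rw [this]
      exact Set.countable_iUnion fun n => hB n s
    have := h1.to_subtype
    exact (Set.injective_codRestrict (f := j s) (Set.mem_range_self)).2 (hinj s) |>.countable
  · rw [hr]
    exact Set.mem_iUnion.2 ⟨0, ha⟩

end ManySorted

namespace ManySorted

variable {S : Type u} {L : SortedLanguage S}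

/-! ### Counting -/

/-- The Rasiowa–Sikorski lemma, with the generic ideal given by an increasing sequence. -/
theorem exists_generic_sequence {P τ : Type*} [Preorder P] [Countable τ] (p : P) (C : τ → Set P)
    (hC : ∀ t, IsCofinal (C t)) :
    ∃ q : ℕ → P, Monotone q ∧ q 0 = p ∧ ∀ t, ∃ n, q n ∈ C t := by
  have : Encodable τ := Encodable.ofCountable τ
  let 𝒟 : τ → Order.Cofinal P := fun t => ⟨C t, hC t⟩
  exact ⟨Order.sequenceOfCofinals p 𝒟, Order.sequenceOfCofinals.monotone p 𝒟, rfl,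
    fun t => ⟨_, Order.sequenceOfCofinals.encode_mem p 𝒟 t⟩⟩

theorem FO.exists_formula {ι : Sort*} {𝓜 : ι → Struct L} {Γ : List S}
    {P : ∀ i, Env (𝓜 i).carrier Γ → Prop} (h : FO 𝓜 (Var Γ) P) :
    ∃ φ : Formula L Γ, ∀ i v, P i v ↔ φ.Realize (𝓜 i) v := by
  obtain ⟨Δ, φ, g, hφ⟩ := h
  exact ⟨φ.rename g, fun i v => by rw [hφ, Formula.realize_rename]⟩

/-- It is first-order that at most `n` elements have a given first-order property. -/
theorem FO.exists_bound [Finite S] {ι : Sort*} {𝓜 : ι → Struct L} {X : S → Type u} {s : S}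
    {Q : ∀ i, Tuple X (𝓜 i).carrier → (𝓜 i).carrier s → Prop}
    (h : FO 𝓜 (VSum X (Var [s])) (fun i z => Q i (z.comp vinl) (z s (.inr .zero)))) (n : ℕ) :
    FO 𝓜 X (fun i x => ∃ y : Fin n → (𝓜 i).carrier s, ∀ c, Q i x c → ∃ k, c = y k) := by
  classical
  refine (FO.ex (Y := fun _ => ULift (Fin n))
    (Q := fun i x y => ∀ c, Q i x c → ∃ k : Fin n, c = y s ⟨k⟩) ?_).congr fun i x => ?_
  · refine FO.all_one (X := VSum X fun _ => ULift (Fin n))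
      (Q := fun i z c => Q i (z.comp vinl) c → ∃ k : Fin n, c = z s (Sum.inr ⟨k⟩))
      (FO.imp (h.comp (fun s => Sum.map Sum.inl id)) (FO.exists_finite fun k =>
        FO.eq (X := VSum (VSum X fun _ => ULift (Fin n)) (Var [s])) (.inr .zero) (.inl (.inr ⟨k⟩))))
  · refine ⟨fun ⟨y, hy⟩ => ?_, fun ⟨y, hy⟩ => ⟨fun k => y s ⟨k⟩, hy⟩⟩
    have := fun s => (𝓜 i).nonempty s
    refine ⟨fun t k => if ht : s = t then ht ▸ y k.down else Classical.arbitrary _, ?_⟩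
    simpa using hy

theorem finite_iff_exists_bound {α : Type*} (p : α → Prop) :
    {a | p a}.Finite ↔ ∃ (n : ℕ) (y : Fin n → α), ∀ c, p c → ∃ k, c = y k := by
  constructor
  · intro h
    obtain ⟨n, ⟨e⟩⟩ := h.to_subtype.exists_equiv_fin
    exact ⟨n, fun k => (e.symm k).1, fun c hc => ⟨e ⟨c, hc⟩, by simp⟩⟩
  · rintro ⟨n, y, hy⟩
    refine (Set.finite_range y).subset fun c hc => ?_
    obtain ⟨k, rfl⟩ := hy c hc
    exact ⟨k, rfl⟩

/-- Finiteness of a definable set only depends on the type of the parameters. -/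
theorem SameType.finite_iff [Finite S] {M N : Struct L} {X : S → Type u} {x : Tuple X M.carrier}
    {y : Tuple X N.carrier} (hxy : SameType M N x y) {s : S}
    {Q : ∀ K : Struct L, Tuple X K.carrier → K.carrier s → Prop}
    (h : FO (fun K : Struct L => K) (VSum X (Var [s]))
      (fun i z => Q i (z.comp vinl) (z s (.inr .zero)))) :
    {c | Q M x c}.Finite ↔ {c | Q N y c}.Finite := by
  rw [finite_iff_exists_bound, finite_iff_exists_bound]
  exact exists_congr fun n => hxy.iff (FO.exists_bound h n)

theorem ElemEquiv.infinite [Finite S] {M N : Struct L} (h : ElemEquiv M N)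
    (hM : Infinite (Σ s, M.carrier s)) : Infinite (Σ s, N.carrier s) := by
  by_contra hN
  rw [not_infinite_iff_finite] at hN
  have h1 : ∀ s, Finite (M.carrier s) := fun s => by
    have h2 : Finite (N.carrier s) :=
      Finite.of_injective (fun a => (⟨s, a⟩ : Σ s, N.carrier s)) sigma_mk_injective
    have := (h.finite_iff (s := s) (Q := fun K _ _ => True) FO.const_true).2 (Set.toFinite _)
    exact Set.finite_univ_iff.1 this
  exact not_finite (Σ s, M.carrier s)

/-! ### The theorem of Ryll-Nardzewski -/

/-- A set of finite tuples which is definable without parameters. -/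
def Struct.ZeroDef (M : Struct L) {Γ : List S} (D : Set (Env M.carrier Γ)) : Prop :=
  ∃ φ : Formula L Γ, D = {v | φ.Realize M v}

theorem FO.zeroDef {M : Struct L} {Γ : List S} {P : Unit → Env M.carrier Γ → Prop}
    (h : FO (fun _ : Unit => M) (Var Γ) P) : M.ZeroDef {v | P () v} := by
  obtain ⟨φ, hφ⟩ := h.exists_formula
  exact ⟨φ, Set.ext fun v => hφ () v⟩

/-- A structure is oligomorphic if there are only finitely many sets definable without parameters
in each finite tuple of variables. -/
def Struct.Oligomorphic (M : Struct L) : Prop :=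
  ∀ Γ : List S, {D : Set (Env M.carrier Γ) | M.ZeroDef D}.Finite

/-- A nonempty first-order set of infinite tuples; the finite approximations to a generic tuple.
The smaller set is the stronger condition. -/
structure Approx (M : Struct L) (X : S → Type u) where
  /-- The underlying set of tuples. -/
  set : Set (Tuple X M.carrier)
  nonempty : set.Nonempty
  fo : FO (fun _ : Unit => M) X (fun _ x => x ∈ set)

instance (M : Struct L) (X : S → Type u) : Preorder (Approx M X) where
  le p q := q.set ⊆ p.set
  le_refl _ := subset_rfl
  le_trans _ _ _ h h' := h'.trans h

/-- The omitting types theorem: a type which is not isolated in `M` is omitted in a countable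
structure which is elementarily equivalent to `M`. -/
theorem exists_omitting [Finite S] (hL : L.IsCountable) (M : Struct L) {Γ : List S}
    (p : Set (Formula L Γ))
    (hp : ∀ D : Set (Env M.carrier Γ), M.ZeroDef D → D.Nonempty →
      ∃ χ ∈ p, ∃ v ∈ D, ¬ χ.Realize M v) :
    ∃ N : Struct L, ElemEquiv M N ∧ (∀ s, Countable (N.carrier s)) ∧
      ∀ v : Env N.carrier Γ, ∃ χ ∈ p, ¬ χ.Realize N v := by
  classical
  let X : S → Type u := fun _ => ULift.{u} ℕ
  have := Formula.countable hL
  let Task : Type u := (Σ (Δ : List S) (s : S), Formula L (s :: Δ) × Tuple (Var Δ) X) ⊕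
    Tuple (Var Γ) X
  have : Countable Task := inferInstance
  -- The first kind of task provides a witness for a formula, the second kind prevents a tuple from
  -- realizing the type.
  let C : Task → Set (Approx M X) := fun
    | .inl ⟨Δ, s, φ, g⟩ => {D | ∃ k : X s, ∀ x ∈ D.set, (∃ a, φ.Realize M (Env.cons a (x.comp g))) →
        φ.Realize M (Env.cons (x s k) (x.comp g))}
    | .inr g => {D | ∃ χ ∈ p, ∀ x ∈ D.set, ¬ χ.Realize M (x.comp g)}
  have hC : ∀ τ, IsCofinal (C τ) := by
    rintro (⟨Δ, s, φ, g⟩ | g) D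
    · obtain ⟨Δ₀, φ₀, g₀, h₀⟩ := D.fo
      -- A variable which occurs neither in the condition nor in `φ` is free to take a witness.
      obtain ⟨k, hk⟩ : ∃ k : X s, k ∉ Set.range (g₀ s) ∪ Set.range (g s) :=
        ((Set.finite_range _).union (Set.finite_range _)).exists_notMem
      have hk₀ : ∀ j, g₀ s j ≠ k := fun j hj => hk (Or.inl ⟨j, hj⟩)
      have hk₁ : ∀ j, g s j ≠ k := fun j hj => hk (Or.inr ⟨j, hj⟩)
      refine ⟨⟨D.set ∩ {x | (∃ a, φ.Realize M (Env.cons a (x.comp g))) →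
        φ.Realize M (Env.cons (x s k) (x.comp g))}, ?_, ?_⟩, ⟨k, fun x hx => hx.2⟩,
        Set.inter_subset_left⟩
      · obtain ⟨x, hx⟩ := D.nonempty
        by_cases hex : ∃ a, φ.Realize M (Env.cons a (x.comp g))
        · obtain ⟨a, ha⟩ := hex
          let x' : Tuple X M.carrier := Function.update x s (Function.update (x s) k a)
          have hx' : ∀ t j, (t = s → HEq j k → False) → x' t j = x t j := fun t j hj => by
            by_cases ht : t = s
            · subst ht
              simp only [x', Function.update_self]
              exact Function.update_of_ne (fun h => hj rfl (heq_of_eq h)) _ _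
            · simp [x', Function.update_of_ne ht]
          have e₀ : x'.comp g₀ = x.comp g₀ := by
            funext t j
            refine hx' _ _ fun ht hj => ?_
            subst ht
            exact hk₀ j (eq_of_heq hj)
          have e₁ : x'.comp g = x.comp g := by
            funext t j
            refine hx' _ _ fun ht hj => ?_
            subst ht
            exact hk₁ j (eq_of_heq hj)
          refine ⟨x', (h₀ () x').2 ?_, fun _ => ?_⟩
          · rw [e₀]
            exact (h₀ () x).1 hx
          · rw [e₁]
            simpa [x'] using ha
        · exact ⟨x, hx, fun h => (hex h).elim⟩
      · exact D.fo.and (FO.imp (FO.ex_one (FO.realize_cons (X := VSum X (Var [s])) φ (.inr .zero)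
          (Tuple.comp vinl g))) (FO.realize_cons _ _ _))
    · obtain ⟨χ, hχ, v, ⟨x, hx, hxv⟩, hv⟩ := hp {v | ∃ x : Tuple X M.carrier, x ∈ D.set ∧
          ∀ s k, x s (g s k) = v s k} (FO.zeroDef (P := fun _ v =>
            ∃ x : Tuple X M.carrier, x ∈ D.set ∧ ∀ s k, x s (g s k) = v s k)
          (FO.ex (Q := fun _ v x => x ∈ D.set ∧ ∀ s k, x s (g s k) = v s k)
            ((D.fo.comp vinr).and (FO.forall_finite fun s => FO.forall_finite fun k =>
              FO.eq _ _)))) (by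
            obtain ⟨x, hx⟩ := D.nonempty
            exact ⟨x.comp g, x, hx, fun _ _ => rfl⟩)
      obtain rfl : x.comp g = v := funext fun s => funext fun k => hxv s k
      refine ⟨⟨D.set ∩ {x | ¬ χ.Realize M (x.comp g)}, ⟨x, hx, ?_⟩, ?_⟩, ⟨χ, hχ, fun x hx => hx.2⟩,
        Set.inter_subset_left⟩
      · exact hv
      · exact D.fo.and (FO.realize χ g).not
  have hM : ∀ s, Nonempty (M.carrier s) := M.nonempty
  obtain ⟨q, hq, -, hqC⟩ := exists_generic_sequence
    (⟨Set.univ, ⟨fun s _ => Classical.arbitrary _, trivial⟩, FO.const_true⟩ : Approx M X) C hC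
  -- The formulas forced by the generic sequence are realized by a tuple `x`, whose range is an
  -- elementary substructure.
  let th : Set (NamedFormula L X) := {α | ∃ n, ∀ x ∈ (q n).set, α.Holds M x}
  obtain ⟨N, x, hMN, hx⟩ := compactness_elemEquiv (M := M) th fun F hF => by
    choose! n hn using hF
    obtain ⟨x, hx⟩ := (q (F.sup n)).nonempty
    exact ⟨x, fun α hα => hn α hα x (hq (Finset.le_sup hα) hx)⟩
  have hforce : ∀ {P : ∀ K : Struct L, Tuple X K.carrier → Prop},
      FO (fun K : Struct L => K) X P → (∃ n, ∀ x ∈ (q n).set, P M x) → P N x := by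
    rintro P ⟨Δ, φ, g, hφ⟩ ⟨n, hn⟩
    exact (hφ N x).2 (hx ⟨Δ, φ, g⟩ ⟨n, fun y hy => (hφ M y).1 (hn y hy)⟩)
  have hrange : ∀ {Δ : List S} (v : Env N.carrier Δ), (∀ t k, v t k ∈ x.range t) →
      ∃ g : Tuple (Var Δ) X, x.comp g = v := fun v hv => by
    choose g hg using hv
    exact ⟨g, funext fun t => funext fun k => hg t k⟩
  obtain ⟨K, j, hj, hinj, hr⟩ := exists_elementary_substructure N x.range fun Δ s φ v hv hφ => by
    obtain ⟨g, rfl⟩ := hrange v hv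
    obtain ⟨n, k, hk⟩ := hqC (.inl ⟨Δ, s, φ, g⟩)
    refine ⟨x s k, ⟨k, rfl⟩, ?_⟩
    refine hforce (P := fun K x => (∃ a, φ.Realize K (Env.cons a (x.comp g))) →
      φ.Realize K (Env.cons (x s k) (x.comp g))) ?_ ⟨n, hk⟩ hφ
    exact FO.imp (FO.ex_one (FO.realize_cons (X := VSum X (Var [s])) φ (.inr .zero)
      (Tuple.comp vinl g)))
      (FO.realize_cons _ _ _)
  refine ⟨K, SameType.trans hMN (hj.sameType (X := Var []) Env.nil).elemEquiv.symm, fun s => ?_,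
    fun v => ?_⟩
  · have h1 : (Set.range (j s)).Countable := by
      have : j.range s = x.range s := congrFun hr s
      rw [Tuple.range] at this
      rw [this]
      exact Set.countable_range _
    have := h1.to_subtype
    exact ((hinj s).codRestrict Set.mem_range_self).countable
  · obtain ⟨g, hg⟩ := hrange ((j : Tuple _ _).comp v) fun t k => by
      rw [← hr]
      exact ⟨_, rfl⟩
    obtain ⟨n, χ, hχ, hn⟩ := hqC (.inr g)
    refine ⟨χ, hχ, fun hv => ?_⟩
    refine hforce (FO.realize χ g).not ⟨n, hn⟩ ?_
    rw [hg]
    exact (hj _ χ v).1 hv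

/-- The Ryll-Nardzewski theorem. If a context has infinitely many definable sets in an infinite model,
then it has a type which is not isolated. One countable model realizes it, another one omits it, and
they cannot be isomorphic. -/
theorem Aleph0Categorical.oligomorphic [Finite S] (hL : L.IsCountable) {T : Theory L}
    (hT : T.Aleph0Categorical) {M : Struct L} (hM : M.Models T) : M.Oligomorphic := by
  intro Γ
  rcases finite_or_infinite (Σ s, M.carrier s) with hfin | hinf
  · have : ∀ s, Finite (M.carrier s) := fun s =>
      Finite.of_injective (fun a => (⟨s, a⟩ : Σ s, M.carrier s)) sigma_mk_injective
    exact Set.toFinite _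
  by_contra hB
  -- The complements of the atoms of the Boolean algebra of definable sets lie in an ultrafilter.
  let atoms : Set (Set (Env M.carrier Γ)) := {A | M.ZeroDef A ∧
    ∀ D, M.ZeroDef D → A ⊆ D ∨ A ⊆ Dᶜ}
  have hfip : ∀ F : Finset (Set (Env M.carrier Γ)), (↑F ⊆ atoms) → (⋂ A ∈ F, Aᶜ).Nonempty := by
    intro F hF
    by_contra hemp
    rw [Set.not_nonempty_iff_eq_empty] at hemp
    refine hB (Set.Finite.subset ((Set.finite_range fun G : Set F => ⋃ A ∈ G, A.1)) ?_)
    intro D hD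
    refine ⟨{A | A.1 ⊆ D}, Set.Subset.antisymm (Set.iUnion₂_subset fun A hA => hA) ?_⟩
    intro v hv
    have : v ∉ ⋂ A ∈ F, Aᶜ := by simp [hemp]
    simp only [Set.mem_iInter, not_forall, Set.mem_compl_iff, not_not] at this
    obtain ⟨A, hA, hvA⟩ := this
    refine Set.mem_iUnion₂.2 ⟨⟨A, hA⟩, ?_, hvA⟩
    exact ((hF hA).2 D hD).resolve_right fun h => h hvA hv
  obtain ⟨𝒰, h𝒰⟩ : ∃ 𝒰 : Ultrafilter (Env M.carrier Γ), ∀ A ∈ atoms, Aᶜ ∈ 𝒰 := by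
    have hne : (Filter.generate (compl '' atoms)).NeBot := by
      rw [Filter.generate_neBot_iff]
      intro t ht hfin
      obtain ⟨F, hF, hFfin, rfl⟩ := Set.exists_subset_image_finite_and.1 ⟨t, ht, hfin, rfl⟩
      obtain ⟨v, hv⟩ := hfip hFfin.toFinset (by simpa using hF)
      refine ⟨v, ?_⟩
      rintro _ ⟨A, hA, rfl⟩
      exact Set.mem_iInter₂.1 hv A (hFfin.mem_toFinset.2 hA)
    refine ⟨Ultrafilter.of (Filter.generate (compl '' atoms)), fun A hA => ?_⟩
    exact Ultrafilter.of_le _ (Filter.mem_generate_of_mem ⟨A, hA, rfl⟩)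
  let p : Set (Formula L Γ) := {χ | {v | χ.Realize M v} ∈ 𝒰}
  obtain ⟨N₁, hN₁, hc₁, homit⟩ := exists_omitting hL M p fun D hD hne => by
    by_contra hcon
    push Not at hcon
    obtain ⟨φ, rfl⟩ := hD
    have hatom : {v | φ.Realize M v} ∈ atoms := ⟨⟨φ, rfl⟩, by
      rintro D ⟨χ, rfl⟩
      by_cases h : {v | χ.Realize M v} ∈ 𝒰
      · exact Or.inl fun v hv => hcon χ h v hv
      · exact Or.inr fun v hv => hcon χ.neg (Ultrafilter.compl_mem_iff_notMem.2 h) v hv⟩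
    obtain ⟨v, hv⟩ := hne
    exact hcon φ.neg (h𝒰 _ hatom) v hv hv
  obtain ⟨N, v, hN, hv⟩ := compactness_elemEquiv (M := M) (X := Var Γ)
    {α | ∃ χ ∈ p, α = ⟨Γ, χ, fun _ k => k⟩} fun F hF => by
      have : (⋂ α ∈ F, {v | α.Holds M v}) ∈ 𝒰 := by
        refine (Filter.biInter_finset_mem F).2 fun α hα => ?_
        obtain ⟨χ, hχ, rfl⟩ := hF α hα
        exact hχ
      obtain ⟨v, hv⟩ := 𝒰.nonempty_of_mem this
      exact ⟨v, fun α hα => Set.mem_iInter₂.1 hv α hα⟩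
  obtain ⟨N₂, j, hj, hc₂, hr⟩ := exists_countable_elementary hL N (Tuple.range v)
    fun s => (Set.finite_range _).countable
  have hr' : ∀ s k, ∃ a, j s a = v s k := fun s k => hr s ⟨k, rfl⟩
  choose w hw using hr'
  have hN₂ : ElemEquiv M N₂ :=
    SameType.trans hN (hj.sameType (X := Var []) Env.nil).elemEquiv.symm
  have hcard : ∀ K : Struct L, ElemEquiv M K → (∀ s, Countable (K.carrier s)) →
      Cardinal.mk (Σ s, K.carrier s) = Cardinal.aleph0 := fun K hK hc => by
    have := hK.infinite hinf
    exact Cardinal.mk_eq_aleph0 _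
  obtain ⟨e⟩ := hT.2 N₂ N₁ (hN₂.models hM) (hN₁.models hM) (hcard _ hN₂ hc₂) (hcard _ hN₁ hc₁)
  obtain ⟨χ, hχ, hn⟩ := homit (fun s k => e.toEquiv s (w s k))
  rw [← e.realize, hj] at hn
  refine hn ?_
  have := hv _ ⟨χ, hχ, rfl⟩
  unfold NamedFormula.Holds at this
  convert this using 1
  funext s k
  exact hw s k

end ManySorted

namespace ManySorted

variable {S : Type u} {L L' : SortedLanguage S}

/-! ### Algebraic closure -/

/-- Membership in the algebraic closure, with parameters from a possibly infinite tuple. -/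
theorem mem_acl_of_fo {M : Struct L} {A : SubFamily M.carrier} {X : S → Type u}
    {x : Tuple X M.carrier} (hx : ∀ s k, x s k ∈ A s) {s : S} {b : M.carrier s}
    {Q : Tuple X M.carrier → M.carrier s → Prop}
    (h : FO (fun _ : Unit => M) (VSum X (Var [s]))
      (fun _ z => Q (z.comp vinl) (z s (.inr .zero))))
    (hb : Q x b) (hfin : {c | Q x c}.Finite) : b ∈ M.acl A s := by
  obtain ⟨Δ, φ, g, hφ⟩ := (h.comp (Y := VSum (Var [s]) X)
    (fun t => Sum.elim Sum.inr Sum.inl)).exists_formula_append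
  have key : ∀ c, Q x c ↔ φ.Realize M (Env.cons c (x.comp g)) := fun c =>
    hφ () (Env.cons c Env.nil) x
  simp only [key] at hfin
  exact ⟨Δ, φ, x.comp g, fun t k => hx t _, (key b).1 hb, hfin⟩

theorem le_acl (M : Struct L) (A : SubFamily M.carrier) : A ≤ M.acl A := fun s b hb =>
  mem_acl_of_fo (X := fun s => A s) (x := fun _ a => a.1) (fun _ k => k.2)
    (Q := fun x c => c = x s ⟨b, hb⟩) (FO.eq (s := s) _ _) rfl (by simp)

theorem acl_reduct_le (e : LHom L L') (M : Struct L') (A : SubFamily M.carrier) :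
    (M.reduct e).acl A ≤ M.acl A := by
  rintro s b ⟨Δ, φ, a, ha, hb, hfin⟩
  refine ⟨Δ, e.onFormula φ, a, ha, (e.realize_onFormula M φ _).2 hb, ?_⟩
  simp only [LHom.realize_onFormula]
  exact hfin

theorem acl_acl [Finite S] (M : Struct L) (A : SubFamily M.carrier) :
    M.acl (M.acl A) = M.acl A := by
  refine le_antisymm ?_ (le_acl _ _)
  rintro s b ⟨Δ, φ, a, ha, hb, hfin⟩
  choose Δ' ψ d hd hψ hψfin using ha
  obtain ⟨n, hn⟩ := (finite_iff_exists_bound _).1 hfin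
  let gd : ∀ t k, Tuple (Var (Δ' t k)) (fun s => A s) := fun t k u l => ⟨d t k u l, hd t k u l⟩
  -- The parameters `a` run through a finite set definable over `A`, and those instances of `φ` which
  -- have at most `n` solutions are taken together.
  refine mem_acl_of_fo (X := fun s => A s) (x := fun _ a => a.1) (fun _ k => k.2)
    (Q := fun x (c : M.carrier s) => ∃ a' : Env M.carrier Δ,
      (∀ t k, (ψ t k).Realize M (Env.cons (a' t k) (x.comp (gd t k)))) ∧
      (∃ y : Fin n → M.carrier s, ∀ c', φ.Realize M (Env.cons c' a') → ∃ k, c' = y k) ∧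
      φ.Realize M (Env.cons c a')) ?_ ⟨a, hψ, hn, hb⟩ ?_
  · refine FO.ex (X := VSum (fun s => A s) (Var [s])) (Q := fun _ z (a' : Env M.carrier Δ) =>
      (∀ t k, (ψ t k).Realize M (Env.cons (a' t k) ((Tuple.comp z vinl).comp (gd t k)))) ∧
      (∃ y : Fin n → M.carrier s, ∀ c', φ.Realize M (Env.cons c' a') → ∃ k, c' = y k) ∧
      φ.Realize M (Env.cons (z s (.inr .zero)) a')) (FO.and ?_ (FO.and ?_ ?_))
    · exact FO.forall_finite fun t => FO.forall_finite fun k =>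
        FO.realize_cons (X := VSum (VSum _ _) (Var Δ)) (ψ t k) (.inr k)
          (Tuple.comp vinl (Tuple.comp vinl (gd t k)))
    · exact FO.exists_bound (Q := fun _ z c' => φ.Realize M (Env.cons c' (Tuple.comp z vinr)))
        (FO.realize_cons (X := VSum (VSum (VSum _ _) (Var Δ)) (Var [s])) φ (.inr .zero)
          (Tuple.comp vinl vinr)) n
    · exact FO.realize_cons (X := VSum (VSum _ (Var [s])) (Var Δ)) φ (.inl (.inr .zero)) vinr
  · have hpi : {a' : Env M.carrier Δ | ∀ t k,
        (ψ t k).Realize M (Env.cons (a' t k) (d t k))}.Finite := by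
      refine (Set.Finite.pi' fun t => Set.Finite.pi' fun k => hψfin t k).subset fun a' h => h
    refine ((hpi.inter_of_left {a' | ∃ y : Fin n → M.carrier s, ∀ c',
      φ.Realize M (Env.cons c' a') → ∃ k, c' = y k}).biUnion
      fun a' h => (finite_iff_exists_bound _).2 ⟨n, h.2⟩).subset ?_
    rintro c ⟨a', h1, h2, h3⟩
    exact Set.mem_biUnion (x := a') ⟨h1, h2⟩ h3

/-- Whether the range of a tuple is algebraically closed only depends on the type of the tuple. -/
theorem SameType.acl_range [Finite S] {M N : Struct L} {X : S → Type u} {x : Tuple X M.carrier}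
    {y : Tuple X N.carrier} (h : SameType M N x y) (hx : M.acl x.range = x.range) :
    N.acl y.range = y.range := by
  classical
  refine le_antisymm ?_ (le_acl _ _)
  rintro s b ⟨Δ, φ, a, ha, hb, hfin⟩
  choose g hg using ha
  obtain rfl : y.comp g = a := funext fun t => funext fun k => hg t k
  have hfin' : {c | φ.Realize M (Env.cons c (x.comp g))}.Finite :=
    (h.finite_iff (Q := fun K x c => φ.Realize K (Env.cons c (x.comp g)))
      (FO.realize_cons (X := VSum X (Var [s])) φ (.inr .zero) (Tuple.comp vinl g))).2 hfin
  have hmem : ∀ c, φ.Realize M (Env.cons c (x.comp g)) → ∃ k, x s k = c := fun c hc => by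
    have : c ∈ M.acl x.range s := ⟨Δ, φ, x.comp g, fun t k => ⟨_, rfl⟩, hc, hfin'⟩
    rwa [hx] at this
  let F : Set (M.carrier s) := {c | φ.Realize M (Env.cons c (x.comp g))}
  have hF : Finite F := hfin'.to_subtype
  choose k hk using fun m : F => hmem m.1 m.2
  -- The elements of the finite set are named by variables, and this is part of the type of `x`.
  have := (h.iff (P := fun K z => ∀ c, φ.Realize K (Env.cons c (z.comp g)) →
      ∃ m : F, c = z s (k m)) ?_).1 ?_ b hb
  · obtain ⟨m, hm⟩ := this
    exact ⟨k m, hm.symm⟩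
  · exact FO.all_one (Q := fun K z c => φ.Realize K (Env.cons c (z.comp g)) → ∃ m, c = z s (k m))
      (FO.imp (FO.realize_cons (X := VSum X (Var [s])) φ (.inr .zero) (Tuple.comp vinl g))
        (FO.exists_finite fun m =>
          FO.eq (X := VSum X (Var [s])) (s := s) (.inr .zero) (.inl (k m))))
  · intro c hc
    exact ⟨⟨c, hc⟩, (hk ⟨c, hc⟩).symm⟩

theorem Tuple.range_comp {X Y Z : S → Type u} (f : Tuple Y Z) (x : Tuple X Y) :
    (f.comp x).range = x.range.image f := by
  funext s
  exact Set.range_comp (f s) (x s)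

theorem Tuple.range_val {X : S → Type u} (A : SubFamily X) :
    Tuple.range (X := fun s => A s) (fun _ a => a.1) = A := by
  funext s
  exact Subtype.range_val

theorem IsElementaryEmbedding.acl_image [Finite S] {M N : Struct L}
    {j : Tuple M.carrier N.carrier} (hj : IsElementaryEmbedding M N j) {A : SubFamily M.carrier}
    (hA : M.acl A = A) : N.acl (A.image j) = A.image j := by
  have h := (hj.sameType (X := fun s => A s) (fun _ a => a.1)).acl_range
    (by rw [Tuple.range_val, hA])
  have e : Tuple.range (j.comp (X := fun s => A s) fun _ a => a.1) = A.image j :=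
    (Tuple.range_comp j _).trans (by rw [Tuple.range_val])
  rwa [e] at h

/-- A finite subset is enumerated by a finite tuple. -/
theorem exists_env_range [Finite S] {X : S → Type u} {A : SubFamily X}
    (hA : ∀ s, (A s).Finite) : ∃ (Δ : List S) (d : Env X Δ), Tuple.range d = A := by
  classical
  have key : ∀ F : Finset (Σ s, X s), ∃ (Δ : List S) (d : Env X Δ),
      ∀ s a, a ∈ Tuple.range d s ↔ ⟨s, a⟩ ∈ F := fun F => by
    induction F using Finset.induction_on with
    | empty => exact ⟨[], Env.nil, fun s a => ⟨fun ⟨k, _⟩ => (nomatch k), by simp⟩⟩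
    | insert p F _ ih =>
      obtain ⟨Δ, d, hd⟩ := ih
      obtain ⟨t, b⟩ := p
      refine ⟨t :: Δ, Env.cons b d, fun s a => ?_⟩
      rw [Finset.mem_insert, ← hd]
      constructor
      · rintro ⟨k, rfl⟩
        cases k with
        | zero => exact Or.inl rfl
        | succ k => exact Or.inr ⟨k, rfl⟩
      · rintro (h | ⟨k, rfl⟩)
        · cases h
          exact ⟨.zero, rfl⟩
        · exact ⟨k.succ, rfl⟩
  have hfin : {p : Σ s, X s | p.2 ∈ A p.1}.Finite := by
    have := fun s => (hA s).to_subtype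
    refine (Set.finite_range fun p : Σ s, A s => (⟨p.1, p.2.1⟩ : Σ s, X s)).subset ?_
    rintro ⟨s, a⟩ ha
    exact ⟨⟨s, a, ha⟩, rfl⟩
  obtain ⟨Δ, d, hd⟩ := key hfin.toFinset
  exact ⟨Δ, d, funext fun s => Set.ext fun a => by simp [hd]⟩

/-! ### Oligomorphic structures -/

namespace Struct.Oligomorphic

variable {M : Struct L}

theorem acl_finite [Finite S] (hM : M.Oligomorphic) {A : SubFamily M.carrier}
    (hA : ∀ s, (A s).Finite) (s : S) :
    (M.acl A s).Finite := by
  obtain ⟨Δ, d, rfl⟩ := exists_env_range hA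
  refine (((hM (s :: Δ)).inter_of_left {D | {c | Env.cons c d ∈ D}.Finite}).biUnion
    (t := fun D => {c | Env.cons c d ∈ D}) fun D hD => hD.2).subset ?_
  rintro b ⟨Δ', φ, a, ha, hb, hfin⟩
  choose g hg using ha
  obtain rfl : Tuple.comp d g = a := funext fun t => funext fun k => hg t k
  have hD : M.ZeroDef {v : Env M.carrier (s :: Δ) |
      φ.Realize M (Env.cons (v s .zero) fun t k => v t (g t k).succ)} :=
    FO.zeroDef (P := fun _ v => φ.Realize M (Env.cons (v s .zero) fun t k => v t (g t k).succ))
      (FO.realize_cons φ (Var.zero (Γ := Δ)) fun t k => (g t k).succ)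
  exact Set.mem_biUnion (t := fun D => {c | Env.cons c d ∈ D}) ⟨hD, hfin⟩ hb

/-- Arbitrary unions of sets definable without parameters are definable without parameters, since they
are finite unions. -/
theorem zeroDef_sUnion (hM : M.Oligomorphic) {Γ : List S} {𝒟 : Set (Set (Env M.carrier Γ))}
    (h𝒟 : ∀ D ∈ 𝒟, M.ZeroDef D) : M.ZeroDef (⋃₀ 𝒟) := by
  have hfin : 𝒟.Finite := (hM Γ).subset h𝒟
  have := hfin.to_subtype
  choose φ hφ using h𝒟
  have h := FO.zeroDef (P := fun _ v => ∃ D : 𝒟, (φ D.1 D.2).Realize M v)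
    (FO.exists_finite fun D => FO.realize (𝓜 := fun _ : Unit => M) (φ D.1 D.2) fun _ k => k)
  convert h using 1
  ext v
  constructor
  · rintro ⟨D, hD, hv⟩
    rw [hφ D hD] at hv
    exact ⟨⟨D, hD⟩, hv⟩
  · rintro ⟨⟨D, hD⟩, hv⟩
    refine ⟨D, hD, ?_⟩
    rw [hφ D hD]
    exact hv

/-- Every type is isolated, by a formula which does so in all elementarily equivalent structures. -/
theorem exists_isolating [Finite S] (hM : M.Oligomorphic) {Γ : List S} (v : Env M.carrier Γ) :
    ∃ θ : Formula L Γ, θ.Realize M v ∧ ∀ N : Struct L, ElemEquiv M N → ∀ w : Env N.carrier Γ,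
      θ.Realize N w → SameType M N v w := by
  obtain ⟨α, hα⟩ := hM.zeroDef_sUnion (𝒟 := {D | M.ZeroDef D ∧ v ∉ D}) fun D hD => hD.1
  have hv : ¬ α.Realize M v := fun h => by
    have : v ∈ ⋃₀ {D | M.ZeroDef D ∧ v ∉ D} := by rw [hα]; exact h
    obtain ⟨D, hD, hvD⟩ := this
    exact hD.2 hvD
  have key : ∀ φ : Formula L Γ, φ.Realize M v → ∀ N : Struct L, ElemEquiv M N →
      ∀ w : Env N.carrier Γ, α.neg.Realize N w → φ.Realize N w := fun φ hφ N hN => by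
    refine (hN.iff (P := fun K => ∀ w : Env K.carrier Γ, α.neg.Realize K w → φ.Realize K w)
      (FO.all (Q := fun K _ w => α.neg.Realize K w → φ.Realize K w)
        ((FO.realize _ vinr).imp (FO.realize _ vinr)))).1 fun w hw => ?_
    by_contra hn
    refine hw ?_
    have : w ∈ ⋃₀ {D | M.ZeroDef D ∧ v ∉ D} := ⟨_, ⟨⟨φ.neg, rfl⟩, fun h => h hφ⟩, hn⟩
    rwa [hα] at this
  refine ⟨α.neg, hv, fun N hN w hw => sameType_env_iff.2 fun φ => ⟨fun h => key φ h N hN w hw,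
    fun h => ?_⟩⟩
  by_contra hn
  exact key φ.neg hn N hN w hw h

end Struct.Oligomorphic

theorem Tuple.comp_append_vars {X : S → Type u} {Γ Δ : List S} (a : Env X Γ) (b : Env X Δ) :
    Tuple.comp (Tuple.sum a b) (Env.append (M := VSum (Var Γ) (Var Δ)) vinl vinr) =
      Env.append a b := by
  rw [comp_append]
  rfl

theorem Tuple.sum_eq_append_comp {X : S → Type u} {Γ Δ : List S} (a : Env X Γ) (b : Env X Δ) :
    Tuple.comp (Env.append a b)
      (Tuple.sum (Var.left Δ) (Var.right Γ) : Tuple (VSum (Var Γ) (Var Δ)) (Var (Γ ++ Δ))) =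
      Tuple.sum a b := by
  rw [Tuple.sum_comp, Env.append_left, Env.append_right]

/-- Finite tuples may be concatenated as contexts or as families of variables. -/
theorem sameType_append_iff {M N : Struct L} {Γ Δ : List S} {a : Env M.carrier Γ}
    {b : Env M.carrier Δ} {a' : Env N.carrier Γ} {b' : Env N.carrier Δ} :
    SameType M N (Env.append a b) (Env.append a' b') ↔
      SameType M N (Tuple.sum a b) (Tuple.sum a' b') := by
  constructor
  · intro h
    have := h.comp (Tuple.sum (Var.left Δ) (Var.right Γ))
    rwa [Tuple.sum_eq_append_comp, Tuple.sum_eq_append_comp] at this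
  · intro h
    have := h.comp (Env.append (M := VSum (Var Γ) (Var Δ)) vinl vinr)
    rwa [Tuple.comp_append_vars, Tuple.comp_append_vars] at this

namespace Struct.Oligomorphic

variable {M : Struct L}

/-- The extension property: a tuple of `N` which has the type of a tuple of `M` can be extended
along with it. -/
theorem exists_extension [Finite S] (hM : M.Oligomorphic) {N : Struct L} {Γ Δ : List S}
    {x : Env M.carrier Γ} {y : Env N.carrier Γ} (h : SameType M N x y) (m : Env M.carrier Δ) :
    ∃ n : Env N.carrier Δ, SameType M N (Tuple.sum x m) (Tuple.sum y n) := by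
  obtain ⟨θ, hθ, hiso⟩ := hM.exists_isolating (Env.append x m)
  obtain ⟨n, hn⟩ := (h.iff (P := fun K x => ∃ n : Env K.carrier Δ, θ.Realize K (Env.append x n))
    (FO.ex (Q := fun K x n => θ.Realize K (Env.append x n)) (FO.realize_append θ vinl vinr))).1
    ⟨m, hθ⟩
  exact ⟨n, sameType_append_iff.1 (hiso N h.elemEquiv _ hn)⟩

/-- The set of all tuples which have the same type over a finite tuple `c` as an element of `X` is
definable with parameters `c`. -/
theorem definable_saturation [Finite S] (hM : M.Oligomorphic) {Γ Δ : List S}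
    (c : Env M.carrier Δ) (X : Set (Env M.carrier Γ)) :
    M.Definable {y | ∃ x ∈ X, SameType M M (Tuple.sum x c) (Tuple.sum y c)} := by
  choose θ hθ hiso using fun v : Env M.carrier (Γ ++ Δ) => hM.exists_isolating v
  obtain ⟨φ, hφ⟩ := hM.zeroDef_sUnion
    (𝒟 := {D | ∃ x ∈ X, D = {v | (θ (Env.append x c)).Realize M v}}) (by
      rintro _ ⟨x, -, rfl⟩
      exact ⟨_, rfl⟩)
  refine ⟨Δ, φ, c, Set.ext fun y => ?_⟩
  have hy : Env.append y c ∈ ⋃₀ {D | ∃ x ∈ X, D = {v | (θ (Env.append x c)).Realize M v}} ↔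
      φ.Realize M (Env.append y c) := by
    rw [hφ]; rfl
  refine Iff.trans ?_ hy
  constructor
  · rintro ⟨x, hx, hxy⟩
    exact ⟨_, ⟨x, hx, rfl⟩, (sameType_env_iff.1 (sameType_append_iff.2 hxy) _).1 (hθ _)⟩
  · rintro ⟨_, ⟨x, hx, rfl⟩, hv⟩
    exact ⟨x, hx, sameType_append_iff.1 (hiso _ M (SameType.refl _) _ hv)⟩

/-- Having the same type is a first-order property of pairs of finite tuples. -/
theorem fo_sameType [Finite S] (hM : M.Oligomorphic) (Γ : List S) :
    FO (fun K : {K : Struct L // ElemEquiv M K} => K.1) (VSum (Var Γ) (Var Γ))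
      (fun K z => SameType K.1 K.1 (z.comp vinl) (z.comp vinr)) := by
  have := (hM Γ).to_subtype
  choose φ hφ using fun D : {D : Set (Env M.carrier Γ) | M.ZeroDef D} => D.2
  refine (FO.forall_finite fun D => (FO.realize (φ D) vinl).iff (FO.realize (φ D) vinr)).congr
    fun K z => sameType_env_iff.trans ⟨fun h D => h (φ D), fun h ψ => ?_⟩
  have hD := hφ ⟨{v | ψ.Realize M v}, ψ, rfl⟩
  have heq : ∀ v : Env K.1.carrier Γ,
      ψ.Realize K.1 v ↔ (φ ⟨{v | ψ.Realize M v}, ψ, rfl⟩).Realize K.1 v := by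
    refine (K.2.iff (P := fun K => ∀ v : Env K.carrier Γ,
      ψ.Realize K v ↔ (φ ⟨{v | ψ.Realize M v}, ψ, rfl⟩).Realize K v)
      (FO.all (Q := fun K _ v => ψ.Realize K v ↔
        (φ ⟨{v | ψ.Realize M v}, ψ, rfl⟩).Realize K v)
        ((FO.realize _ vinr).iff (FO.realize _ vinr)))).1 fun v => ?_
    exact Set.ext_iff.1 hD v
  rw [heq, heq]
  exact h _

theorem reduct {M : Struct L'} (hM : M.Oligomorphic) (e : LHom L L') :
    (M.reduct e).Oligomorphic := fun Γ => (hM Γ).subset <| by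
  rintro D ⟨φ, rfl⟩
  exact ⟨e.onFormula φ, Set.ext fun v => (e.realize_onFormula M φ v).symm⟩

end Struct.Oligomorphic

end ManySorted

namespace ManySorted

variable {S : Type u} {L L' : SortedLanguage S}

/-! ### Types over a set and independence -/

/-- The elements of `C` may be named by an arbitrary family, also with repetitions. -/
theorem sameTypeOver_iff {M : Struct L} {C : SubFamily M.carrier} {X : S → Type u}
    {x y : Tuple X M.carrier} :
    SameTypeOver M C x y ↔ ∀ (Z : S → Type u) (c : Tuple Z M.carrier), (∀ s k, c s k ∈ C s) →
      SameType M M (x.sum c) (y.sum c) := by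
  refine ⟨fun h Z c hc => ?_, fun h => h (fun s => C s) (fun _ a => a.1) fun _ a => a.2⟩
  let f : Tuple (VSum X Z) (VSum X fun s => C s) :=
    fun s => Sum.map id fun k => ⟨c s k, hc s k⟩
  have e : ∀ x : Tuple X M.carrier,
      Tuple.comp (Tuple.sum x (X := X) (Y := fun s => C s) fun _ a => a.1) f = x.sum c :=
    fun x => by funext s k; cases k <;> rfl
  have := SameType.comp (h : SameType M M _ _) f
  rw [← e, ← e]
  exact this

theorem sameTypeOver_range_iff {M : Struct L} {X Z : S → Type u} {c : Tuple Z M.carrier}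
    {x y : Tuple X M.carrier} :
    SameTypeOver M c.range x y ↔ SameType M M (x.sum c) (y.sum c) := by
  refine ⟨fun h => sameTypeOver_iff.1 h Z c fun s k => ⟨k, rfl⟩, fun h => ?_⟩
  refine sameTypeOver_iff.2 fun W d hd => ?_
  choose g hg using hd
  obtain rfl : c.comp g = d := funext fun s => funext fun k => hg s k
  have := h.comp (Y := VSum X W) fun s => Sum.map id (g s)
  convert this using 1 <;> · funext s k; cases k <;> rfl

theorem SameTypeOver.symm {M : Struct L} {C : SubFamily M.carrier} {X : S → Type u}
    {x y : Tuple X M.carrier} (h : SameTypeOver M C x y) : SameTypeOver M C y x :=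
  SameType.symm h

theorem SameTypeOver.trans {M : Struct L} {C : SubFamily M.carrier} {X : S → Type u}
    {x y z : Tuple X M.carrier} (h : SameTypeOver M C x y) (h' : SameTypeOver M C y z) :
    SameTypeOver M C x z :=
  SameType.trans h h'

theorem SameTypeOver.reduct {M : Struct L'} {C : SubFamily M.carrier} {X : S → Type u}
    {x y : Tuple X M.carrier} (h : SameTypeOver M C x y) (e : LHom L L') :
    SameTypeOver (M.reduct e) C x y :=
  SameType.reduct h e

theorem SameTypeOver.image {M N : Struct L} {C : SubFamily M.carrier} {X : S → Type u}
    {x y : Tuple X M.carrier} (h : SameTypeOver M C x y) {e : Tuple M.carrier N.carrier}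
    (he : IsElementaryEmbedding M N e) : SameTypeOver N (C.image e) (e.comp x) (e.comp y) := by
  refine sameTypeOver_iff.2 fun Z c hc => ?_
  choose d hd hdc using hc
  obtain rfl : e.comp d = c := funext fun s => funext fun k => hdc s k
  rw [← Tuple.sum_comp, ← Tuple.sum_comp]
  exact ((he.sameType _).symm.trans (sameTypeOver_iff.1 h Z d hd)).trans (he.sameType _)

theorem SubFamily.image_image {X Y Z : S → Type u} (g : Tuple Y Z) (f : Tuple X Y)
    (A : SubFamily X) : (A.image f).image g = A.image (g.comp f) := by
  funext s
  exact Set.image_image _ _ _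

theorem IsElementaryEmbedding.comp {M N K : Struct L} {g : Tuple N.carrier K.carrier}
    {f : Tuple M.carrier N.carrier} (hg : IsElementaryEmbedding N K g)
    (hf : IsElementaryEmbedding M N f) : IsElementaryEmbedding M K (g.comp f) :=
  fun Γ φ v => (hf Γ φ v).trans (hg Γ φ _)

/-- An independence relation is preserved by elementary embeddings, since it depends only on the type of
the sets involved. -/
theorem IsStationaryIndependence.image_iff {T : Theory L} {ind : TernaryRelation L}
    (h : IsStationaryIndependence T ind) {M N : Struct L} (hM : M.Models T)
    {e : Tuple M.carrier N.carrier} (he : IsElementaryEmbedding M N e)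
    (A B C : SubFamily M.carrier) :
    ind M A B C ↔ ind N (A.image e) (B.image e) (C.image e) := by
  have hid : ∀ D : SubFamily M.carrier, D.image (fun _ a => a) = D := fun D => by
    funext s
    exact Set.image_id' _
  have hN : N.Models T := (he.sameType (X := Var []) Env.nil).elemEquiv.models hM
  have := h.invariance M N hM hN M.carrier (fun _ a => a) e (he.sameType fun _ a => a) A B C
  rwa [hid, hid, hid] at this

theorem SameType.comp_append {M N : Struct L} {X : S → Type u} {x : Tuple X M.carrier}
    {y : Tuple X N.carrier} (h : SameType M N x y) {Γ Δ : List S} (f : Env X Γ) (g : Env X Δ) :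
    SameType M N (Env.append (x.comp f) (x.comp g)) (Env.append (y.comp f) (y.comp g)) := by
  rw [← ManySorted.comp_append, ← ManySorted.comp_append]
  exact h.comp _

/-- Two realizations of the same type over `C`, in elementary extensions of `M`, which are independent
from `M` over `C` have the same type over `M`. This is stationarity, applied in an amalgam of the two
extensions. -/
theorem IsStationaryIndependence.sameType_sum [Finite S] {T : Theory L} {ind : TernaryRelation L}
    (h : IsStationaryIndependence T ind) {M N₁ N₂ : Struct L} (hM : M.Models T)
    {j₁ : Tuple M.carrier N₁.carrier} {j₂ : Tuple M.carrier N₂.carrier}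
    (h₁ : IsElementaryEmbedding M N₁ j₁) (h₂ : IsElementaryEmbedding M N₂ j₂)
    {C : SubFamily M.carrier} (hC : M.acl C = C) {X : S → Type u} {a₁ a₂ : Tuple X M.carrier}
    (ha : SameTypeOver M C a₁ a₂) {b₁ : Tuple X N₁.carrier} {b₂ : Tuple X N₂.carrier}
    (hb₁ : SameTypeOver N₁ (C.image j₁) b₁ (j₁.comp a₁))
    (hb₂ : SameTypeOver N₂ (C.image j₂) b₂ (j₂.comp a₂))
    (hi₁ : ind N₁ b₁.range (SubFamily.image j₁ ⊤) (C.image j₁))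
    (hi₂ : ind N₂ b₂.range (SubFamily.image j₂ ⊤) (C.image j₂)) :
    SameType N₁ N₂ (b₁.sum j₁) (b₂.sum j₂) := by
  obtain ⟨K, e₁, e₂, he₁, he₂, hcomm⟩ := exists_amalgam h₁ h₂
  have hmodels : ∀ {N : Struct L} {j : Tuple M.carrier N.carrier},
      IsElementaryEmbedding M N j → N.Models T := fun hj =>
    (hj.sameType (X := Var []) Env.nil).elemEquiv.models hM
  have hk₁ := (h.image_iff (hmodels h₁) he₁ _ _ _).1 hi₁
  have hk₂ := (h.image_iff (hmodels h₂) he₂ _ _ _).1 hi₂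
  have hc₁ := hb₁.image he₁
  have hc₂ := hb₂.image he₂
  rw [SubFamily.image_image, SubFamily.image_image, ← Tuple.range_comp] at hk₁ hk₂
  rw [SubFamily.image_image] at hc₁ hc₂
  rw [← hcomm] at hk₂ hc₂
  have hf : IsElementaryEmbedding M K (e₁.comp j₁) := he₁.comp h₁
  have ha' := ha.image hf
  have e : e₂.comp (j₂.comp a₂) = (e₁.comp j₁).comp a₂ :=
    congrArg (fun g => Tuple.comp g a₂) hcomm.symm
  rw [e] at hc₂
  have hst := sameTypeOver_iff.1 (h.stationarity K (hmodels hf) X _ _ _ _ (hf.acl_image hC)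
    ((hc₁.trans ha').trans hc₂.symm) hk₁ hk₂) M.carrier (e₁.comp j₁)
    fun s m => Or.inl ⟨m, trivial, rfl⟩
  have h1 := he₁.sameType (b₁.sum j₁)
  have h2 := he₂.sameType (b₂.sum j₂)
  rw [Tuple.sum_comp] at h1 h2
  rw [← hcomm] at h2
  exact (h1.trans hst).trans h2.symm

/-- A set definable with parameters from `C`. -/
def Struct.DefinableOver (M : Struct L) (C : SubFamily M.carrier) {Γ : List S}
    (X : Set (Env M.carrier Γ)) : Prop :=
  ∃ (Δ : List S) (φ : Formula L (Γ ++ Δ)) (c : Env M.carrier Δ), (∀ t k, c t k ∈ C t) ∧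
    X = {x | φ.Realize M (Env.append x c)}

theorem Struct.DefinableOver.exists_formula {M : Struct L} {Γ Δ : List S} {c : Env M.carrier Δ}
    {X : Set (Env M.carrier Γ)} (h : M.DefinableOver (Tuple.range c) X) :
    ∃ φ : Formula L (Γ ++ Δ), X = {x | φ.Realize M (Env.append x c)} := by
  obtain ⟨Δ', φ, d, hd, rfl⟩ := h
  choose g hg using hd
  obtain rfl : Tuple.comp c g = d := funext fun s => funext fun k => hg s k
  refine ⟨φ.rename (Env.append (M := Var (Γ ++ Δ)) (Var.left Δ)
    (Tuple.comp (Var.right Γ) g)), Set.ext fun x => ?_⟩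
  change φ.Realize M _ ↔ Formula.Realize M (Formula.rename _ φ) _
  rw [Formula.realize_rename, comp_append, Env.append_left]
  have : Tuple.comp (Env.append x c) (Tuple.comp (Var.right Γ) g) = Tuple.comp c g :=
    congrArg (fun f => Tuple.comp f g) (Env.append_right x c)
  rw [this]

/-! ### Separation over an algebraically closed set -/

section Fusion

variable {I : Type u} {Lcap : SortedLanguage S} {E : I → SortedLanguage S}
  {T : ∀ i, Theory (langOf Lcap E i)}

/-- The reduct `M_i` of an `L_∪`-structure. -/
abbrev Struct.red (M : Struct (langUnion Lcap E)) (i : I) : Struct (langOf Lcap E i) :=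
  M.reduct (langToUnion Lcap E i)

/-- The reduct `M_∩` of an `L_∪`-structure. -/
abbrev Struct.redCap (M : Struct (langUnion Lcap E)) : Struct Lcap :=
  M.reduct (capToUnion Lcap E)

theorem models_theoryUnion_iff {M : Struct (langUnion Lcap E)} :
    M.Models (theoryUnion T) ↔ ∀ i, (M.red i).Models (T i) := by
  constructor
  · intro h i φ hφ
    exact (LHom.realize_onFormula _ M φ _).1 (h _ (Set.mem_iUnion.2 ⟨i, φ, hφ, rfl⟩))
  · intro h ψ hψ
    obtain ⟨i, φ, hφ, rfl⟩ := Set.mem_iUnion.1 hψ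
    exact (LHom.realize_onFormula _ M φ _).2 (h i φ hφ)

/-- The properties of the theories `T_i` on which the construction of the interpolative fusion
rests. -/
structure TameFusion (T : ∀ i, Theory (langOf Lcap E i)) (iStar : I) : Prop where
  complete : ∀ i, (T i).Complete
  oligomorphic : ∀ i (M : Struct (langOf Lcap E i)), M.Models (T i) → M.Oligomorphic
  independence : ∃ (Ucap : Theory Lcap) (ind : TernaryRelation Lcap),
    IsStationaryIndependence Ucap ind ∧ (∀ i, IsExtendable (capToLang Lcap E i) (T i) ind) ∧
    ∀ i (M : Struct (langOf Lcap E i)), M.Models (T i) →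
      (M.reduct (capToLang Lcap E i)).Models Ucap
  acl_eq : ∀ i, i ≠ iStar → ∀ M : Struct (langOf Lcap E i), M.Models (T i) →
    ∀ A : SubFamily M.carrier, M.acl A = (M.reduct (capToLang Lcap E i)).acl A

namespace TameFusion

variable {iStar : I}

/-- A set which is algebraically closed for the one theory with a nontrivial algebraic closure is
algebraically closed for all of them. -/
theorem acl_red_eq (h : TameFusion T iStar) {M : Struct (langUnion Lcap E)}
    (hM : M.Models (theoryUnion T)) {C : SubFamily M.carrier}
    (hC : (M.red iStar).acl C = C) (i : I) : (M.red i).acl C = C := by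
  by_cases hi : i = iStar
  · exact hi ▸ hC
  · refine le_antisymm ?_ (le_acl _ _)
    rw [h.acl_eq i hi _ (models_theoryUnion_iff.1 hM i) C]
    exact (acl_reduct_le (capToLang Lcap E iStar) (M.red iStar) C).trans hC.le

theorem oligomorphic_red (h : TameFusion T iStar) {M : Struct (langUnion Lcap E)}
    (hM : M.Models (theoryUnion T)) (i : I) : (M.red i).Oligomorphic :=
  h.oligomorphic i _ (models_theoryUnion_iff.1 hM i)

theorem oligomorphic_redCap (h : TameFusion T iStar) {M : Struct (langUnion Lcap E)}
    (hM : M.Models (theoryUnion T)) : M.redCap.Oligomorphic :=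
  (h.oligomorphic_red hM iStar).reduct (capToLang Lcap E iStar)

theorem elemEquiv_red (h : TameFusion T iStar) {M N : Struct (langUnion Lcap E)}
    (hM : M.Models (theoryUnion T)) (hN : N.Models (theoryUnion T)) (i : I) :
    ElemEquiv (M.red i) (N.red i) :=
  (h.complete i).elemEquiv (models_theoryUnion_iff.1 hM i) (models_theoryUnion_iff.1 hN i)

theorem elemEquiv_redCap (h : TameFusion T iStar) {M N : Struct (langUnion Lcap E)}
    (hM : M.Models (theoryUnion T)) (hN : N.Models (theoryUnion T)) :
    ElemEquiv M.redCap N.redCap :=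
  (h.elemEquiv_red hM hN iStar).reduct (capToLang Lcap E iStar)

/-- Sets `X_i`, definable in `M_i` over an algebraically closed set `C`, which contain points of the
same `L_∩`-type over `C`, cannot be separated by `M_∩`-definable sets: the points are replaced by
points in elementary extensions which are independent from `M` over `C`, and by stationarity these
have the same `L_∩`-type over `M`. -/
theorem iInter_nonempty_of_subset [Finite S] (h : TameFusion T iStar)
    {M : Struct (langUnion Lcap E)} (hM : M.Models (theoryUnion T)) {C : SubFamily M.carrier}
    (hC : ∀ i, (M.red i).acl C = C) {Γ : List S} (J : Finset I) (a : I → Env M.carrier Γ)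
    (ha : ∀ i ∈ J, ∀ k ∈ J, SameTypeOver M.redCap C (a i) (a k))
    (X Y : I → Set (Env M.carrier Γ)) (hX : ∀ i ∈ J, (M.red i).DefinableOver C (X i))
    (haX : ∀ i ∈ J, a i ∈ X i) (hY : ∀ i ∈ J, M.redCap.Definable (Y i))
    (hXY : ∀ i ∈ J, X i ⊆ Y i) : (⋂ i ∈ J, Y i).Nonempty := by
  obtain ⟨Ucap, ind, hstat, hext, hUcap⟩ := h.independence
  have hMi := models_theoryUnion_iff.1 hM
  choose N j a' hj hsame hind using fun i => hext i (M.red i) (hMi i) (Var Γ) (a i) ⊤ C (hC i)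
  have hjc : ∀ i, IsElementaryEmbedding M.redCap ((N i).reduct (capToLang Lcap E i)) (j i) :=
    fun i => (hj i).reduct (capToLang Lcap E i)
  have hCcap : M.redCap.acl C = C := le_antisymm
    ((acl_reduct_le (capToLang Lcap E iStar) (M.red iStar) C).trans (hC iStar).le) (le_acl _ _)
  have key : ∀ i ∈ J, ∀ k ∈ J, SameType ((N i).reduct (capToLang Lcap E i))
      ((N k).reduct (capToLang Lcap E k)) (Tuple.sum (a' i) (j i))
      (Tuple.sum (a' k) (j k)) := fun i hi k hk =>
    hstat.sameType_sum (hUcap i _ (hMi i)) (hjc i) (hjc k) hCcap (ha i hi k hk)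
      ((hsame i).reduct (capToLang Lcap E i)) ((hsame k).reduct (capToLang Lcap E k))
      (hind i) (hind k)
  rcases J.eq_empty_or_nonempty with rfl | ⟨i₀, hi₀⟩
  · have := fun s => M.nonempty s
    exact ⟨fun _ _ => Classical.arbitrary _, by simp⟩
  choose! Δ ψ b hb using hY
  -- The inclusion `X i ⊆ Y i` passes to `N i`, so `a' i` satisfies the formula defining `Y i`, and so
  -- does `a' i₀`, which has the same `L_∩`-type over `M`.
  have hmem : ∀ i ∈ J, (ψ i).Realize ((N i₀).reduct (capToLang Lcap E i₀))
      (Env.append (a' i₀) (Tuple.comp (j i₀) (b i))) := by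
    intro i hi
    obtain ⟨Δ', φ, c, hc, hφ⟩ := hX i hi
    have hφa : φ.Realize (M.red i) (Env.append (a i) c) := by
      have := haX i hi
      rwa [hφ] at this
    have hφa' : φ.Realize (N i) (Env.append (a' i) (Tuple.comp (j i) c)) := by
      have h1 := sameTypeOver_iff.1 (hsame i) (Var Δ') (Tuple.comp (j i) c)
        fun s k => ⟨c s k, hc s k, rfl⟩
      have h2 : SameType (M.red i) (N i) (Env.append (a i) c)
          (Env.append (Tuple.comp (j i) (a i)) (Tuple.comp (j i) c)) :=
        ((hj i).sameType fun _ m => m).comp_append (a i) c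
      exact (sameType_env_iff.1 (h2.trans (sameType_append_iff.2 h1).symm) φ).1 hφa
    have himp : ∀ x : Env M.carrier Γ, φ.Realize (M.red i) (Env.append x c) →
        (ψ i).Realize M.redCap (Env.append x (b i)) := fun x hx => by
      have h1 : x ∈ X i := by rw [hφ]; exact hx
      have h2 := hXY i hi h1
      rw [hb i hi] at h2
      exact h2
    have himp' := (((hj i).sameType fun _ m => m).iff
      (P := fun K m => ∀ x : Env K.carrier Γ, φ.Realize K (Env.append x (m.comp c)) →
        (ψ i).Realize (K.reduct (capToLang Lcap E i)) (Env.append x (m.comp (b i))))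
      (FO.all (Q := fun K m x => φ.Realize K (Env.append x (m.comp c)) →
        (ψ i).Realize (K.reduct (capToLang Lcap E i)) (Env.append x (m.comp (b i))))
        (FO.imp (FO.realize_append φ vinr (Tuple.comp vinl c)) (FO.reduct (capToLang Lcap E i)
          (FO.realize_append (ψ i) vinr (Tuple.comp vinl (b i))))))).1 himp _ hφa'
    have h3 : SameType ((N i).reduct (capToLang Lcap E i)) ((N i₀).reduct (capToLang Lcap E i₀))
        (Env.append (a' i) (Tuple.comp (j i) (b i)))
        (Env.append (a' i₀) (Tuple.comp (j i₀) (b i))) :=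
      (key i hi i₀ hi₀).comp_append vinl (Tuple.comp vinr (b i))
    exact (sameType_env_iff.1 h3 (ψ i)).1 himp'
  -- A common point of the sets `Y i` in `N i₀` yields one in `M`.
  obtain ⟨x, hx⟩ := (((hjc i₀).sameType fun _ m => m).iff
    (P := fun K m => ∃ x : Env K.carrier Γ, ∀ i : J,
      (ψ i).Realize K (Env.append x (m.comp (b i))))
    (FO.ex (Q := fun K m x => ∀ i : J, (ψ i).Realize K (Env.append x (m.comp (b i))))
      (FO.forall_finite fun i =>
        FO.realize_append (ψ i) vinr (Tuple.comp vinl (b i))))).2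
    ⟨a' i₀, fun i => hmem i.1 i.2⟩
  refine ⟨x, Set.mem_iInter₂.2 fun i hi => ?_⟩
  rw [hb i hi]
  exact hx ⟨i, hi⟩

/-- In an interpolative model, sets which are definable over an algebraically closed set `C` and
contain points of the same `L_∩`-type over `C` have a common point. -/
theorem iInter_nonempty [Finite S] (h : TameFusion T iStar)
    {M : Struct (langUnion Lcap E)} (hM : IsInterpolative T M) {C : SubFamily M.carrier}
    (hC : (M.red iStar).acl C = C) {Γ : List S} (J : Finset I) (a : I → Env M.carrier Γ)
    (ha : ∀ i ∈ J, ∀ k ∈ J, SameTypeOver M.redCap C (a i) (a k))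
    (X : I → Set (Env M.carrier Γ)) (hX : ∀ i ∈ J, (M.red i).DefinableOver C (X i))
    (haX : ∀ i ∈ J, a i ∈ X i) : (⋂ i ∈ J, X i).Nonempty := by
  by_contra hemp
  obtain ⟨Y, hY, hYemp⟩ := hM.2 J Γ X (fun i hi => by
    obtain ⟨Δ, φ, c, -, hφ⟩ := hX i hi
    exact ⟨Δ, φ, c, hφ⟩) (Set.not_nonempty_iff_eq_empty.1 hemp)
  exact (h.iInter_nonempty_of_subset hM.1 (h.acl_red_eq hM.1 hC) J a ha X Y hX haX
    (fun i hi => (hY i hi).1) fun i hi => (hY i hi).2).ne_empty hYemp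

/-- The converse of `iInter_nonempty`; it suffices to consider the finite algebraically closed
sets, since the algebraic closure of a finite set is finite. -/
theorem isInterpolative_of_iInter_nonempty [Finite S] (h : TameFusion T iStar)
    {M : Struct (langUnion Lcap E)} (hM : M.Models (theoryUnion T))
    (H : ∀ (Δ : List S) (c : Env M.carrier Δ),
      (M.red iStar).acl (Tuple.range c) = Tuple.range c →
      ∀ (Γ : List S) (J : Finset I) (a : I → Env M.carrier Γ) (X : I → Set (Env M.carrier Γ)),
      (∀ i ∈ J, ∀ k ∈ J, SameTypeOver M.redCap (Tuple.range c) (a i) (a k)) →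
      (∀ i ∈ J, (M.red i).DefinableOver (Tuple.range c) (X i)) → (∀ i ∈ J, a i ∈ X i) →
      (⋂ i ∈ J, X i).Nonempty) : IsInterpolative T M := by
  refine ⟨hM, fun J Γ X hX hemp => ?_⟩
  choose! Δ φ b hb using hX
  have hB : ∀ s, (⋃ i : J, Tuple.range (Y := M.carrier) (b i) s).Finite := fun s =>
    Set.finite_iUnion fun i => Set.finite_range _
  have holi := h.oligomorphic_red hM iStar
  obtain ⟨Δ₀, c, hc⟩ := exists_env_range
    fun s => holi.acl_finite (A := fun s => ⋃ i : J, Tuple.range (Y := M.carrier) (b i) s) hB s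
  have hclosed : (M.red iStar).acl (Tuple.range c) = Tuple.range c := by
    rw [hc, acl_acl]
  have hbc : ∀ i ∈ J, ∀ t k, b i t k ∈ Tuple.range c t := fun i hi t k => by
    rw [hc]
    exact le_acl _ _ t (Set.mem_iUnion.2 ⟨⟨i, hi⟩, k, rfl⟩)
  -- The separating sets are the unions of the `L_∩`-types over `c` which meet `X i`.
  refine ⟨fun i => {y | ∃ x ∈ X i, SameType M.redCap M.redCap (Tuple.sum x c) (Tuple.sum y c)},
    fun i hi => ⟨?_, fun x hx => ⟨x, hx, SameType.refl _⟩⟩, ?_⟩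
  · exact (h.oligomorphic_redCap hM).definable_saturation c (X i)
  · rw [← Set.not_nonempty_iff_eq_empty]
    rintro ⟨y, hy⟩
    have hy' := Set.mem_iInter₂.1 hy
    choose! a haX hay using hy'
    refine (H Δ₀ c hclosed Γ J a X (fun i hi k hk => ?_) (fun i hi => ?_) haX).ne_empty hemp
    · exact sameTypeOver_range_iff.2 ((hay i hi).trans (hay k hk).symm)
    · exact ⟨Δ i, φ i, b i, hbc i hi, hb i hi⟩

/-- The models of the theory of the interpolative models are interpolative. For each finite
algebraically closed tuple `c` and each choice of formulas, the criterion of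
`isInterpolative_of_iInter_nonempty` is a single sentence, where `c` is quantified over the
realizations of its isolated type. -/
theorem isInterpolative_of_models [Finite S] (h : TameFusion T iStar)
    {M : Struct (langUnion Lcap E)} (hM : M.Models (interpolativeFusion T)) :
    IsInterpolative T M := by
  have hMT : M.Models (theoryUnion T) := fun φ hφ => hM φ fun K hK => hK.1 φ hφ
  refine h.isInterpolative_of_iInter_nonempty hMT ?_
  intro Δ c hc Γ J a X ha hX haX
  choose! φ hφ using fun i hi => (hX i hi).exists_formula
  obtain ⟨θ, hθ, hiso⟩ := (h.oligomorphic_red hMT iStar).exists_isolating c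
  let 𝒦 : Type (u + 1) := {K : Struct (langUnion Lcap E) // K.Models (theoryUnion T)}
  let 𝓜 : 𝒦 → Struct (langUnion Lcap E) := Subtype.val
  let W : S → Type u := fun s => J × Var Γ s
  let row : J → Tuple (Var Γ) W := fun i _ k => (i, k)
  -- The sentence `∀ c, Q c` is the criterion for the given formulas. The row of `x` with index `i` is a
  -- point of the set defined by `φ i`, and all rows have the same `L_∩`-type over `c`.
  let Q : ∀ K : 𝒦, Env K.1.carrier Δ → Prop := fun K c => θ.Realize (K.1.red iStar) c →
    (∃ x : Tuple W K.1.carrier, (∀ i : J, (φ i).Realize (K.1.red i)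
        (Env.append (x.comp (row i)) c)) ∧
      ∀ i k : J, SameType K.1.redCap K.1.redCap (Env.append (x.comp (row i)) c)
        (Env.append (x.comp (row k)) c)) →
      ∃ y : Env K.1.carrier Γ, ∀ i : J, (φ i).Realize (K.1.red i) (Env.append y c)
  have hFO : FO 𝓜 (fun _ => PEmpty) fun K _ => ∀ c, Q K c := by
    refine FO.all (Q := fun (K : 𝒦) _ c => Q K c) (FO.imp ?_ (FO.imp ?_ ?_))
    · exact FO.reduct (langToUnion Lcap E iStar) (FO.realize θ vinr)
    · refine FO.ex (X := VSum (fun _ => PEmpty) (Var Δ))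
        (Q := fun (K : 𝒦) z (x : Tuple W K.1.carrier) =>
        (∀ i : J, (φ i).Realize (K.1.red i) (Env.append (x.comp (row i)) (z.comp vinr))) ∧
        ∀ i k : J, SameType K.1.redCap K.1.redCap (Env.append (x.comp (row i)) (z.comp vinr))
          (Env.append (x.comp (row k)) (z.comp vinr))) (FO.and ?_ ?_)
      · exact FO.forall_finite fun i => FO.reduct (langToUnion Lcap E i)
          (FO.realize_append (X := VSum (VSum (fun _ => PEmpty) (Var Δ)) W) (φ i)
            (Tuple.comp vinr (row i)) (Tuple.comp vinl vinr))
      · refine FO.forall_finite fun i => FO.forall_finite fun k => ?_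
        have h1 := ((h.oligomorphic_redCap hMT).fo_sameType (Γ ++ Δ)).pull
          fun K : 𝒦 => ⟨K.1.redCap, h.elemEquiv_redCap hMT K.2⟩
        let pt : J → Env (VSum (VSum (fun _ => PEmpty) (Var Δ)) W) (Γ ++ Δ) := fun i =>
          Env.append (M := VSum (VSum (fun _ => PEmpty) (Var Δ)) W)
            (Tuple.comp vinr (row i)) (Tuple.comp vinl vinr)
        have h2 : FO 𝓜 _ fun K z => SameType K.1.redCap K.1.redCap (z.comp (pt i)) (z.comp (pt k)) :=
          FO.reduct (capToUnion Lcap E) (h1.comp (Tuple.sum (pt i) (pt k)))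
        refine h2.congr fun K z => ?_
        rw [comp_append, comp_append]
        exact Iff.rfl
    · refine FO.ex (X := VSum (fun _ => PEmpty) (Var Δ))
        (Q := fun (K : 𝒦) z (y : Env K.1.carrier Γ) =>
        ∀ i : J, (φ i).Realize (K.1.red i) (Env.append y (z.comp vinr))) ?_
      exact FO.forall_finite fun i => FO.reduct (langToUnion Lcap E i)
          (FO.realize_append (X := VSum (VSum (fun _ => PEmpty) (Var Δ)) (Var Γ)) (φ i)
            vinr (Tuple.comp vinl vinr))
  have hQ : ∀ K : 𝒦, IsInterpolative T K.1 → ∀ c, Q K c := by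
    classical
    rintro K hKint c' hc' ⟨x, hx, hxx⟩
    have htype := hiso _ (h.elemEquiv_red hMT K.2 iStar) c' hc'
    have hclosed := htype.acl_range hc
    let x' : I → Env K.1.carrier Γ := fun i =>
      if hi : i ∈ J then x.comp (row ⟨i, hi⟩) else fun s _ => Classical.arbitrary _
    have hx' : ∀ i (hi : i ∈ J), x' i = x.comp (row ⟨i, hi⟩) := fun i hi => dif_pos hi
    obtain ⟨y, hy⟩ := h.iInter_nonempty hKint hclosed J x' (fun i hi k hk => by
        rw [hx' i hi, hx' k hk]
        exact sameTypeOver_range_iff.2 (sameType_append_iff.1 (hxx ⟨i, hi⟩ ⟨k, hk⟩)))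
      (fun i => {y | (φ i).Realize (K.1.red i) (Env.append y c')})
      (fun i _ => ⟨Δ, φ i, c', fun t k => ⟨k, rfl⟩, rfl⟩) (fun i hi => by
        rw [hx' i hi]
        exact hx ⟨i, hi⟩)
    exact ⟨y, fun i => Set.mem_iInter₂.1 hy i.1 i.2⟩
  obtain ⟨Γ₀, σ, g, hσ⟩ := hFO
  obtain rfl : Γ₀ = [] := by
    cases Γ₀ with
    | nil => rfl
    | cons s Γ₀ => exact (g s .zero).elim
  have hσ' : ∀ K : 𝒦, (∀ c, Q K c) ↔ K.1.Satisfies σ := fun K =>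
    (hσ K fun _ k => k.elim).trans (iff_of_eq (congrArg _ (Env.eq_nil _ _)))
  have hMσ : M.Satisfies σ := hM σ fun K hK => (hσ' ⟨K, hK.1⟩).1 (hQ ⟨K, hK.1⟩ hK)
  obtain ⟨y, hy⟩ := (hσ' ⟨M, hMT⟩).2 hMσ c hθ ⟨fun s p => a p.1 s p.2, fun i => by
      have := haX i.1 i.2
      rw [hφ i.1 i.2] at this
      exact this, fun i k => sameType_append_iff.2 (sameTypeOver_range_iff.1
        (ha i.1 i.2 k.1 k.2))⟩
  refine ⟨y, Set.mem_iInter₂.2 fun i hi => ?_⟩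
  rw [hφ i hi]
  exact hy ⟨i, hi⟩

end TameFusion

end Fusion

end ManySorted

namespace ManySorted

variable {S : Type u} {L L' : SortedLanguage S}

/-! ### Limits of finite approximations -/

section Limit

variable {ι : Type*}

/-- A finite approximation to a system of bijections between the families of sets `M i`: a tuple
in each `M i`, in the same variables, such that the tuples are related by `R`. -/
structure Stage (M : ι → S → Type u) (R : ∀ Γ : List S, (∀ i, Env (M i) Γ) → Prop) where
  /-- The variables. -/
  ctx : List S
  /-- The tuples. -/
  pt : ∀ i, Env (M i) ctx
  rel : R ctx pt

variable {M : ι → S → Type u} {R : ∀ Γ : List S, (∀ i, Env (M i) Γ) → Prop}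

/-- A later stage contains the tuples of an earlier one. -/
instance : Preorder (Stage M R) where
  le p q := ∃ f : Tuple (Var p.ctx) (Var q.ctx), ∀ i, Tuple.comp (q.pt i) f = p.pt i
  le_refl p := ⟨fun _ k => k, fun _ => rfl⟩
  le_trans p q r := by
    rintro ⟨f, hf⟩ ⟨g, hg⟩
    refine ⟨g.comp f, fun i => ?_⟩
    rw [← hf i, ← hg i]

/-- If the countable families `M i` can be exhausted by stages, then there is a system of bijections
between them which is the limit of an increasing sequence of stages, and the sequence can be made to
meet countably many cofinal sets. -/
theorem exists_limit [Finite S] [Countable ι] (hM : ∀ i s, Countable (M i s))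
    (hR : ∀ p : Stage M R, ∀ i i' s k k', p.pt i s k = p.pt i s k' → p.pt i' s k = p.pt i' s k')
    (hext : ∀ (p : Stage M R) i s (m : M i s), ∃ q, p ≤ q ∧ ∃ k, q.pt i s k = m)
    {τ : Type*} [Countable τ] (C : τ → Set (Stage M R)) (hC : ∀ t, IsCofinal (C t))
    (p₀ : Stage M R) (i₀ : ι) :
    ∃ e : ∀ i s, M i₀ s ≃ M i s,
      (∀ t, ∃ q ∈ C t, ∀ i s k, q.pt i s k = e i s (q.pt i₀ s k)) ∧
      ∀ (Γ : List S) (d : Env (M i₀) Γ), ∃ q : Stage M R,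
        (∀ i s k, q.pt i s k = e i s (q.pt i₀ s k)) ∧
        ∃ f : Tuple (Var Γ) (Var q.ctx), Tuple.comp (q.pt i₀) f = d := by
  obtain ⟨q, hq, -, hqC⟩ := exists_generic_sequence (τ := τ ⊕ Σ (i : ι) (s : S), M i s) p₀
    (Sum.elim C fun m => {q | ∃ k, q.pt m.1 m.2.1 k = m.2.2}) (by
      rintro (t | ⟨i, s, m⟩)
      · exact hC t
      · intro p
        obtain ⟨q, hpq, hk⟩ := hext p i s m
        exact ⟨q, hk, hpq⟩)
  have hcover : ∀ i s (m : M i s), ∃ n k, (q n).pt i s k = m := fun i s m => hqC (.inr ⟨i, s, m⟩)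
  have huniq : ∀ i i' s n k n' k', (q n).pt i s k = (q n').pt i s k' →
      (q n).pt i' s k = (q n').pt i' s k' := by
    intro i i' s n k n' k' h
    obtain ⟨f, hf⟩ := hq (le_max_left n n')
    obtain ⟨f', hf'⟩ := hq (le_max_right n n')
    simp only [← hf, ← hf'] at h ⊢
    exact hR _ i i' s _ _ h
  choose N K hK using hcover
  let E : ∀ i s, M i₀ s → M i s := fun i s m => (q (N i₀ s m)).pt i s (K i₀ s m)
  have hE : ∀ i s n k, E i s ((q n).pt i₀ s k) = (q n).pt i s k := fun i s n k =>
    huniq i₀ i s _ _ _ _ (hK i₀ s _)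
  have hbij : ∀ i s, Function.Bijective (E i s) := by
    refine fun i s => ⟨fun m m' h => ?_, fun y => ?_⟩
    · have := huniq i i₀ s _ _ _ _ h
      rwa [hK, hK] at this
    · exact ⟨(q (N i s y)).pt i₀ s (K i s y), (hE i s _ _).trans (hK i s y)⟩
  refine ⟨fun i s => Equiv.ofBijective _ (hbij i s), fun t => ?_, fun Γ d => ?_⟩
  · obtain ⟨n, hn⟩ := hqC (.inl t)
    exact ⟨q n, hn, fun i s k => (hE i s n k).symm⟩
  · obtain ⟨n, hn⟩ := exists_uniform_bound (P := fun s (x : Var Γ s) n => ∃ k, (q n).pt i₀ s k = d s x)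
      (fun s x m n hmn ⟨k, hk⟩ => by
        obtain ⟨f, hf⟩ := hq hmn
        refine ⟨f s k, ?_⟩
        rw [← hk, ← hf])
      (fun s x => ⟨N i₀ s (d s x), K i₀ s (d s x), hK i₀ s (d s x)⟩)
    choose f hf using hn
    exact ⟨q n, fun i s k => (hE i s n k).symm, f, funext fun s => funext fun x => hf s x⟩

end Limit

/-- A bijective elementary embedding is an isomorphism. -/
def IsElementaryEmbedding.iso {M N : Struct L} (e : ∀ s, M.carrier s ≃ N.carrier s)
    (he : IsElementaryEmbedding M N fun s => e s) : Iso M N where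
  toEquiv := e
  map_func {σ s} f v := by
    have h := he (s :: σ) (.eq (.var .zero) (.app f fun t x => .var x.succ))
      (Env.cons (M.func f v) v)
    exact h.1 rfl
  map_rel {σ} R v := he σ (.rel R fun t x => .var x) v

theorem SameType.sum_of_comp {M N : Struct L} {X Y : S → Type u} {x : Tuple X M.carrier}
    {y : Tuple X N.carrier} (h : SameType M N x y) {f : Tuple Y X} {x' : Tuple Y M.carrier}
    {y' : Tuple Y N.carrier} (hx : x.comp f = x') (hy : y.comp f = y') :
    SameType M N (x.sum x') (y.sum y') := by
  subst hx hy
  have := h.comp (Y := VSum X Y) (Tuple.sum (fun _ k => k) f)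
  rwa [Tuple.sum_comp, Tuple.sum_comp] at this

/-! ### The back-and-forth system -/

section BackForth

variable {I : Type u} {Lcap : SortedLanguage S} {E : I → SortedLanguage S}
  {T : ∀ i, Theory (langOf Lcap E i)} {iStar : I}

/-- The back-and-forth system between two interpolative models: finite algebraically closed tuples
which have the same `L_i`-type for each `i`. -/
def BackForth (iStar : I) (M N : Struct (langUnion Lcap E)) {Γ : List S} (a : Env M.carrier Γ)
    (b : Env N.carrier Γ) : Prop :=
  (M.red iStar).acl (Tuple.range a) = Tuple.range a ∧ ∀ i, SameType (M.red i) (N.red i) a b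

theorem BackForth.symm [Finite S] {M N : Struct (langUnion Lcap E)} {Γ : List S}
    {a : Env M.carrier Γ} {b : Env N.carrier Γ} (hab : BackForth iStar M N a b) :
    BackForth iStar N M b a :=
  ⟨(hab.2 iStar).acl_range hab.1, fun i => (hab.2 i).symm⟩

theorem exists_onFunc (iStar : I) {σ : List S} {s : S} (f : (langUnion Lcap E).Func σ s) :
    ∃ (i : I) (f' : (langOf Lcap E i).Func σ s), (langToUnion Lcap E i).onFunc f' = f := by
  rcases f with f | ⟨i, f⟩
  · exact ⟨iStar, Sum.inl f, rfl⟩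
  · exact ⟨i, Sum.inr f, rfl⟩

theorem exists_onRel (iStar : I) {σ : List S} (R : (langUnion Lcap E).Rel σ) :
    ∃ (i : I) (R' : (langOf Lcap E i).Rel σ), (langToUnion Lcap E i).onRel R' = R := by
  rcases R with R | ⟨i, R⟩
  · exact ⟨iStar, Sum.inl R, rfl⟩
  · exact ⟨i, Sum.inr R, rfl⟩

namespace TameFusion

/-- An algebraically closed tuple is closed under the functions of `L_∪`, and corresponding terms have
corresponding values. -/
theorem exists_eval_eq [Finite S] (h : TameFusion T iStar) {M N : Struct (langUnion Lcap E)}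
    (hM : M.Models (theoryUnion T)) {Γ : List S} {a : Env M.carrier Γ} {b : Env N.carrier Γ}
    (hab : BackForth iStar M N a b) {Δ : List S} (g : Tuple (Var Δ) (Var Γ)) {s : S}
    (t : Term (langUnion Lcap E) Δ s) :
    ∃ k, t.eval M (Tuple.comp a g) = a s k ∧ t.eval N (Tuple.comp b g) = b s k := by
  induction t with
  | var x => exact ⟨g _ x, rfl, rfl⟩
  | @app σ s f ts ih =>
    choose k hka hkb using ih
    obtain ⟨i, f', rfl⟩ := exists_onFunc iStar f
    simp only [Term.eval, hka, hkb]
    have hmem : (M.red i).func f' (Tuple.comp a k) ∈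
        (M.red i).acl (Tuple.range (Y := (M.red i).carrier) a) s :=
      mem_acl_of_fo (M := M.red i) (A := Tuple.range (Y := (M.red i).carrier) a) (X := Var Γ)
        (x := a) (fun s k => Set.mem_range_self k)
        (Q := fun x c => c = (M.red i).func f' (x.comp k))
        (FO.realize_cons (X := VSum (Var Γ) (Var [s]))
          (.eq (.var .zero) (.app f' fun t x => .var x.succ)) (.inr .zero) (Tuple.comp vinl k))
        rfl (Set.finite_singleton _)
    obtain ⟨l, hl⟩ := (h.acl_red_eq hM hab.1 i).le s hmem
    refine ⟨l, hl.symm, ?_⟩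
    have := (hab.2 i).comp (Env.cons (M := Var Γ) l k)
    rw [comp_cons, comp_cons] at this
    exact ((sameType_env_iff.1 this (.eq (.var .zero) (.app f' fun t x => .var x.succ))).1 hl).symm

/-- The forth property: the extending tuple is found since the sets of its possible `L_i`-types
contain points of the same `L_∩`-type. -/
theorem exists_extension [Finite S] [Finite I] (h : TameFusion T iStar)
    {M N : Struct (langUnion Lcap E)} (hM : M.Models (theoryUnion T)) (hN : IsInterpolative T N)
    {Γ : List S} {a : Env M.carrier Γ} {b : Env N.carrier Γ} (hab : BackForth iStar M N a b)
    {s : S} (m : M.carrier s) :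
    ∃ (Γ' : List S) (a' : Env M.carrier Γ') (b' : Env N.carrier Γ') (f : Tuple (Var Γ) (Var Γ')),
      BackForth iStar M N a' b' ∧ Tuple.comp a' f = a ∧ Tuple.comp b' f = b ∧
        ∃ k, a' s k = m := by
  have := Fintype.ofFinite I
  -- The element `m` is adjoined together with the algebraic closure which it generates.
  let A : SubFamily M.carrier := (M.red iStar).acl (Tuple.range (Env.cons m a))
  obtain ⟨Γ', a', ha'⟩ := exists_env_range (A := A) fun t =>
    (h.oligomorphic_red hM iStar).acl_finite
      (A := Tuple.range (Y := M.carrier) (Env.cons m a))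
      (fun t => Set.finite_range (Env.cons m a t)) t
  have hclosed : (M.red iStar).acl (Tuple.range a') = Tuple.range a' := by
    have e : (M.red iStar).acl A = A := acl_acl (M.red iStar) _
    exact (congrArg (M.red iStar).acl ha').trans (e.trans ha'.symm)
  have hsub : ∀ t k, Env.cons m a t k ∈ Tuple.range a' t := fun t k => by
    rw [ha']
    exact le_acl (M.red iStar) _ t ⟨k, rfl⟩
  choose g hg using hsub
  let f : Tuple (Var Γ) (Var Γ') := fun t k => g t k.succ
  have hf : Tuple.comp a' f = a := funext fun t => funext fun k => hg t k.succ
  choose θ hθ hiso using fun i => (h.oligomorphic_red hM i).exists_isolating a'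
  -- For each `i` separately, `b` extends to a tuple of the `L_i`-type of `a'`.
  have hex : ∀ i, ∃ y : Env N.carrier Γ', (θ i).Realize (N.red i) y ∧ Tuple.comp y f = b := by
    intro i
    have hFO : FO (fun K : Struct (langOf Lcap E i) => K) (Var Γ) (fun K x =>
        ∃ y : Env K.carrier Γ', (θ i).Realize K y ∧ ∀ t k, y t (f t k) = x t k) :=
      FO.ex (Q := fun K x y => (θ i).Realize K y ∧ ∀ t k, y t (f t k) = x t k)
        ((FO.realize (θ i) vinr).and (FO.forall_finite fun t => FO.forall_finite fun k =>
          FO.eq (X := VSum (Var Γ) (Var Γ')) (s := t) (.inr (f t k)) (.inl k)))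
    obtain ⟨y, hy, hyb⟩ := ((hab.2 i).iff hFO).1 ⟨a', hθ i, fun t k => congrFun (congrFun hf t) k⟩
    exact ⟨y, hy, funext fun t => funext fun k => hyb t k⟩
  choose y hy hyb using hex
  have htype : ∀ i, SameType (M.red i) (N.red i) a' (y i) := fun i =>
    hiso i _ (h.elemEquiv_red hM hN.1 i) _ (hy i)
  have hpair : ∀ i, SameType M.redCap N.redCap (Tuple.sum a' a) (Tuple.sum (y i) b) := fun i =>
    ((htype i).reduct (capToLang Lcap E i)).sum_of_comp hf (hyb i)
  -- These extensions have the same `L_∩`-type over `b`.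
  obtain ⟨b', hb'⟩ := h.iInter_nonempty hN ((hab.2 iStar).acl_range hab.1) Finset.univ y
    (fun i _ k _ => sameTypeOver_range_iff.2 ((hpair i).symm.trans (hpair k)))
    (fun i => {x | (θ i).Realize (N.red i) x ∧ Tuple.comp x f = b})
    (fun i _ => by
      have hFO : FO (fun _ : Unit => N.red i) (VSum (Var Γ') (Var Γ)) (fun _ z =>
          (θ i).Realize (N.red i) (z.comp vinl) ∧ ∀ t k, z t (.inl (f t k)) = z t (.inr k)) :=
        (FO.realize (θ i) vinl).and (FO.forall_finite fun t => FO.forall_finite fun k =>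
          FO.eq (X := VSum (Var Γ') (Var Γ)) (s := t) (.inl (f t k)) (.inr k))
      obtain ⟨Δ, φ, g', hφ⟩ := hFO.exists_formula_append
      refine ⟨Δ, φ, Tuple.comp b g', fun t k => ⟨_, rfl⟩, Set.ext fun x => ?_⟩
      refine Iff.trans ?_ (hφ () x b)
      exact and_congr_right fun _ => ⟨fun hx t k => congrFun (congrFun hx t) k,
        fun hx => funext fun t => funext fun k => hx t k⟩)
    (fun i _ => ⟨hy i, hyb i⟩)
  have hb'' := fun i => Set.mem_iInter₂.1 hb' i (Finset.mem_univ i)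
  refine ⟨Γ', a', b', f, ⟨hclosed, fun i => hiso i _ (h.elemEquiv_red hM hN.1 i) _ (hb'' i).1⟩,
    hf, (hb'' iStar).2, g s .zero, hg s .zero⟩

/-- The pairs of the back-and-forth system have the same `L_∪`-type. -/
theorem sameType_of_backForth [Finite S] [Finite I] (h : TameFusion T iStar)
    {M N : Struct (langUnion Lcap E)} (hM : IsInterpolative T M) (hN : IsInterpolative T N)
    {Γ : List S} {a : Env M.carrier Γ} {b : Env N.carrier Γ} (hab : BackForth iStar M N a b) :
    SameType M N a b := by
  intro Δ φ g
  induction φ generalizing Γ with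
  | falsum => rfl
  | @eq Δ s t₁ t₂ =>
    obtain ⟨k₁, h₁, h₁'⟩ := h.exists_eval_eq hM.1 hab g t₁
    obtain ⟨k₂, h₂, h₂'⟩ := h.exists_eval_eq hM.1 hab g t₂
    change t₁.eval M (Tuple.comp a g) = t₂.eval M (Tuple.comp a g) ↔
      t₁.eval N (Tuple.comp b g) = t₂.eval N (Tuple.comp b g)
    rw [h₁, h₁', h₂, h₂']
    exact (hab.2 iStar).eq_iff k₁ k₂
  | @rel Δ σ R ts =>
    choose k hka hkb using fun t x => h.exists_eval_eq hM.1 hab g (ts t x)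
    obtain ⟨i, R', rfl⟩ := exists_onRel iStar R
    change M.rel _ (fun t x => (ts t x).eval M (Tuple.comp a g)) ↔
      N.rel _ (fun t x => (ts t x).eval N (Tuple.comp b g))
    simp only [hka, hkb]
    exact hab.2 i σ (.rel R' fun t x => .var x) k
  | imp φ ψ ih₁ ih₂ => exact imp_congr (ih₁ hab g) (ih₂ hab g)
  | all s φ ih =>
    have key : ∀ {Γ' : List S} {a' : Env M.carrier Γ'} {b' : Env N.carrier Γ'}
        {f : Tuple (Var Γ) (Var Γ')}, BackForth iStar M N a' b' → Tuple.comp a' f = a →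
        Tuple.comp b' f = b → ∀ k, φ.Realize M (Env.cons (a' s k) (Tuple.comp a g)) ↔
          φ.Realize N (Env.cons (b' s k) (Tuple.comp b g)) := by
      intro Γ' a' b' f hab' ha hb k
      have := ih hab' (Env.cons (M := Var Γ') k (f.comp g))
      have e1 := comp_cons (a' : Tuple _ _) k (f.comp g)
      have e2 := comp_cons (b' : Tuple _ _) k (f.comp g)
      change φ.Realize M (Tuple.comp a' _) ↔ φ.Realize N (Tuple.comp b' _) at this
      rw [e1, e2] at this
      subst ha hb
      exact this
    constructor
    · intro hall n
      obtain ⟨Γ', b', a', f, hab', hb, ha, k, rfl⟩ := h.exists_extension hN.1 hM hab.symm n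
      exact (key hab'.symm ha hb k).1 (hall _)
    · intro hall m
      obtain ⟨Γ', a', b', f, hab', ha, hb, k, rfl⟩ := h.exists_extension hM.1 hN hab m
      exact (key hab' ha hb k).2 (hall _)

/-- Countable interpolative models are isomorphic if there is a pair in the back-and-forth
system. -/
theorem nonempty_iso [Finite S] [Finite I] (h : TameFusion T iStar)
    {M N : Struct (langUnion Lcap E)} (hM : IsInterpolative T M) (hN : IsInterpolative T N)
    (hMc : ∀ s, Countable (M.carrier s)) (hNc : ∀ s, Countable (N.carrier s))
    {Γ : List S} {a : Env M.carrier Γ} {b : Env N.carrier Γ} (hab : BackForth iStar M N a b) :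
    Nonempty (Iso M N) := by
  let F : Bool → S → Type u := fun i => bif i then N.carrier else M.carrier
  let R : ∀ Γ : List S, (∀ i, Env (F i) Γ) → Prop := fun Γ p =>
    BackForth iStar M N (p false) (p true)
  have hpair : ∀ {Γ : List S} (a : Env M.carrier Γ) (b : Env N.carrier Γ),
      ∃ p : ∀ i, Env (F i) Γ, p false = a ∧ p true = b := fun a b =>
    ⟨fun | false => a | true => b, rfl, rfl⟩
  obtain ⟨p₀, rfl, rfl⟩ := hpair a b
  obtain ⟨e, -, he⟩ := exists_limit (M := F) (R := R) (τ := Empty) (by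
      rintro (_ | _) s
      · exact hMc s
      · exact hNc s) (by
      rintro p (_ | _) (_ | _) s k k' hk
      · exact hk
      · exact ((p.rel.2 iStar).eq_iff k k').1 hk
      · exact ((p.rel.2 iStar).eq_iff k k').2 hk
      · exact hk) (by
      rintro p (_ | _) s m
      · obtain ⟨Γ', a', b', f, hab', ha, hb, k, hk⟩ := h.exists_extension hM.1 hN p.rel m
        obtain ⟨q, rfl, rfl⟩ := hpair a' b'
        refine ⟨⟨Γ', q, hab'⟩, ⟨f, ?_⟩, k, hk⟩
        rintro (_ | _)
        exacts [ha, hb]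
      · obtain ⟨Γ', b', a', f, hab', hb, ha, k, hk⟩ := h.exists_extension hN.1 hM p.rel.symm m
        obtain ⟨q, rfl, rfl⟩ := hpair a' b'
        refine ⟨⟨Γ', q, hab'.symm⟩, ⟨f, ?_⟩, k, hk⟩
        rintro (_ | _)
        exacts [ha, hb]) (fun t => nomatch t) (fun t => nomatch t) ⟨Γ, p₀, hab⟩ false
  refine ⟨IsElementaryEmbedding.iso (M := M) (N := N) (e true) fun Δ φ d => ?_⟩
  obtain ⟨q, hq, f, rfl⟩ := he Δ d
  refine (h.sameType_of_backForth hM hN q.rel Δ φ f).trans (iff_of_eq (congrArg _ ?_))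
  funext s k
  exact hq true s (f s k)

end TameFusion

end BackForth

end ManySorted

namespace ManySorted

variable {S : Type u} {L L' : SortedLanguage S}

/-! ### The generic interpolative model -/

theorem Iso.isElementaryEmbedding {M N : Struct L} (e : Iso M N) :
    IsElementaryEmbedding M N fun s => e.toEquiv s := fun _ φ v => e.realize φ v

theorem Iso.definable_image {M N : Struct L} (e : Iso M N) {Γ : List S}
    {X : Set (Env M.carrier Γ)} (hX : M.Definable X) :
    N.Definable {y : Env N.carrier Γ | (fun s k => (e.toEquiv s).symm (y s k)) ∈ X} := by
  obtain ⟨Δ, φ, b, rfl⟩ := hX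
  refine ⟨Δ, φ, fun s k => e.toEquiv s (b s k), Set.ext fun y => ?_⟩
  change φ.Realize M _ ↔ φ.Realize N _
  rw [e.realize]
  have hy : Tuple.comp (fun s => e.toEquiv s) (fun s k => (e.toEquiv s).symm (y s k)) = y :=
    funext fun s => funext fun k => (e.toEquiv s).apply_symm_apply (y s k)
  have h := comp_append (fun s => e.toEquiv s) (fun s k => (e.toEquiv s).symm (y s k)) b
  rw [hy] at h
  exact iff_of_eq (congrArg _ h)

theorem ElemEquiv.sameType_nil {M N : Struct L} (h : ElemEquiv M N) (x : Env M.carrier [])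
    (y : Env N.carrier []) : SameType M N x y := by
  have := SameType.comp h (Y := Var []) (fun s x => nomatch x)
  rwa [Env.eq_nil (Tuple.comp _ _) x, Env.eq_nil (Tuple.comp _ _) y] at this

theorem countable_definable [Finite S] (hL : L.IsCountable) {M : Struct L}
    (hM : ∀ s, Countable (M.carrier s)) (Γ : List S) :
    Countable {X : Set (Env M.carrier Γ) // M.Definable X} := by
  have := Formula.countable hL
  refine Set.Countable.to_subtype (s := {X | M.Definable X}) ?_
  refine (Set.countable_range fun p : Σ Δ : List S, Formula L (Γ ++ Δ) × Env M.carrier Δ =>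
    ({a | p.2.1.Realize M (Env.append a p.2.2)} : Set (Env M.carrier Γ))).mono ?_
  rintro _ ⟨Δ, φ, b, rfl⟩
  exact ⟨⟨Δ, φ, b⟩, rfl⟩

section Fusion

variable {I : Type u} {Lcap : SortedLanguage S} {E : I → SortedLanguage S}
  {T : ∀ i, Theory (langOf Lcap E i)} {iStar : I}

/-- The `L_∪`-structure on the universe of `M iStar` which is obtained from `L_i`-structures `M i` by
transport along bijections. -/
def glue (M : ∀ i, Struct (langOf Lcap E i)) (iStar : I)
    (e : ∀ i s, (M iStar).carrier s ≃ (M i).carrier s) : Struct (langUnion Lcap E) where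
  carrier := (M iStar).carrier
  nonempty := (M iStar).nonempty
  func {_ s}
    | .inl f, v => (M iStar).func (.inl f) v
    | .inr ⟨i, f⟩, v => (e i s).symm ((M i).func (.inr f) fun t x => e i t (v t x))
  rel
    | .inl R, v => (M iStar).rel (.inl R) v
    | .inr ⟨i, R⟩, v => (M i).rel (.inr R) fun t x => e i t (v t x)

/-- If the bijections are isomorphisms for `L_∩`, then the reducts of the glued structure are isomorphic
to the given structures. -/
def glueIso (M : ∀ i, Struct (langOf Lcap E i)) (iStar : I)
    (e : ∀ i s, (M iStar).carrier s ≃ (M i).carrier s)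
    (he : ∀ i, IsElementaryEmbedding ((M iStar).reduct (capToLang Lcap E iStar))
      ((M i).reduct (capToLang Lcap E i)) fun s => e i s) (i : I) :
    Iso ((glue M iStar e).red i) (M i) where
  toEquiv := e i
  map_func
    | .inl _, _ => (IsElementaryEmbedding.iso (M := (M iStar).reduct (capToLang Lcap E iStar))
        (N := (M i).reduct (capToLang Lcap E i)) (e i) (he i)).map_func _ _
    | .inr _, _ => (e i _).apply_symm_apply _
  map_rel
    | .inl _, _ => (IsElementaryEmbedding.iso (M := (M iStar).reduct (capToLang Lcap E iStar))
        (N := (M i).reduct (capToLang Lcap E i)) (e i) (he i)).map_rel _ _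
    | .inr _, _ => Iff.rfl

/-- Over a finite index set there is an interpolative model. Countable models `M i` of the theories
`T_i` are identified by generic `L_∩`-isomorphisms. Finite tuples which have the same `L_∩`-type in all
`M i` are the approximations. Given sets `X i` which are definable in `M i`, generic approximations
either contain a common point of the `X i`, or forbid points of the `X i` with a common `L_∩`-type, and
then separate the `X i`. -/
theorem TameFusion.exists_isInterpolative [Finite S] [Finite I] (h : TameFusion T iStar)
    (hcount : ∀ i, (langOf Lcap E i).IsCountable) (hcons : (theoryUnion T).Consistent) :
    ∃ M, IsInterpolative T M := by
  classical
  obtain ⟨M₀, hM₀⟩ := hcons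
  have hLS := fun i => exists_countable_elementary (hcount i) (M₀.red i) (fun _ => ∅)
    fun s => Set.countable_empty
  choose M j hj hMc _ using hLS
  have hM₀M : ∀ i, ElemEquiv (M₀.red i) (M i) := fun i =>
    ((hj i).sameType (X := Var []) Env.nil).elemEquiv.symm
  have hMT : ∀ i, (M i).Models (T i) := fun i =>
    (hM₀M i).models (models_theoryUnion_iff.1 hM₀ i)
  let Mc : I → Struct Lcap := fun i => (M i).reduct (capToLang Lcap E i)
  have hMco : ∀ i, (Mc i).Oligomorphic := fun i =>
    (h.oligomorphic i _ (hMT i)).reduct (capToLang Lcap E i)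
  have hequiv : ∀ i k, ElemEquiv (Mc i) (Mc k) := fun i k =>
    ((hM₀M i).reduct (capToLang Lcap E i)).symm.trans ((hM₀M k).reduct (capToLang Lcap E k))
  let F : I → S → Type u := fun i => (M i).carrier
  let R : ∀ Γ : List S, (∀ i, Env (F i) Γ) → Prop := fun Γ a =>
    ∀ i k, SameType (Mc i) (Mc k) (a i) (a k)
  have hadd : ∀ (p : Stage F R) (Γ : List S) (x : ∀ i, Env (F i) Γ),
      (∀ i k, SameType (Mc i) (Mc k) (Tuple.sum (p.pt i) (x i)) (Tuple.sum (p.pt k) (x k))) →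
      ∃ q : Stage F R, p ≤ q ∧ ∃ f : Tuple (Var Γ) (Var q.ctx), ∀ i, Tuple.comp (q.pt i) f = x i :=
    fun p Γ x hx => ⟨⟨p.ctx ++ Γ, fun i => Env.append (p.pt i) (x i), fun i k =>
      sameType_append_iff.2 (hx i k)⟩, ⟨Var.left Γ, fun i => Env.append_left _ _⟩,
      Var.right p.ctx, fun i => Env.append_right _ _⟩
  -- A task is a family of sets, one definable in each `M i`.
  let τ : Type u := Σ Γ : List S, ∀ i, {X : Set (Env (M i).carrier Γ) // (M i).Definable X}
  have hτ : Countable τ := by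
    have := fun i Γ => countable_definable (hcount i) (hMc i) Γ
    infer_instance
  -- The tuples of the stage can be extended, compatibly, by points of the given sets.
  let common : (t : τ) → (p : Stage F R) → Prop := fun t p =>
    ∃ x : ∀ i, Env (M i).carrier t.1, (∀ i, x i ∈ (t.2 i).1) ∧
      ∀ i k, SameType (Mc i) (Mc k) (Tuple.sum (p.pt i) (x i)) (Tuple.sum (p.pt k) (x k))
  obtain ⟨e, hmeet, hcov⟩ := exists_limit (M := F) (R := R) (τ := τ) hMc
    (fun p i i' s k k' hk => ((p.rel i i').eq_iff k k').1 hk) (by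
      intro p i s m
      have hex : ∀ k, ∃ y : Env (F k) [s], (k = i → HEq y (Env.cons m Env.nil : Env (F i) [s])) ∧
          SameType (Mc i) (Mc k) (Tuple.sum (p.pt i) (Env.cons m Env.nil))
            (Tuple.sum (p.pt k) y) := by
        intro k
        by_cases hk : k = i
        · subst hk
          exact ⟨_, fun _ => HEq.rfl, SameType.refl _⟩
        · obtain ⟨y, hy⟩ := (hMco i).exists_extension (p.rel i k)
            (Env.cons m Env.nil : Env (Mc i).carrier [s])
          exact ⟨y, fun h => absurd h hk, hy⟩
      choose n hni hn using hex
      obtain ⟨q, hpq, f, hf⟩ := hadd p [s] n fun k l => (hn k).symm.trans (hn l)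
      exact ⟨q, hpq, f s .zero,
        congrFun (congrFun ((hf i).trans (eq_of_heq (hni i rfl))) s) .zero⟩)
    (fun t => {q | (∃ f : Tuple (Var t.1) (Var q.ctx), ∀ i, Tuple.comp (q.pt i) f ∈ (t.2 i).1) ∨
      ¬ common t q}) (by
      intro t p
      by_cases hp : common t p
      · obtain ⟨x, hx, hxx⟩ := hp
        obtain ⟨q, hpq, f, hf⟩ := hadd p t.1 x hxx
        exact ⟨q, Or.inl ⟨f, fun i => by rw [hf i]; exact hx i⟩, hpq⟩
      · exact ⟨p, Or.inr hp, le_rfl⟩)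
    ⟨[], fun i => Env.nil, fun i k => (hequiv i k).sameType_nil _ _⟩ iStar
  have helem : ∀ i, IsElementaryEmbedding (Mc iStar) (Mc i) fun s => e i s := by
    intro i Γ φ d
    obtain ⟨q, hq, f, rfl⟩ := hcov Γ d
    refine (q.rel iStar i Γ φ f).trans (iff_of_eq (congrArg _ ?_))
    funext s k
    exact hq i s (f s k)
  -- The bijections which exhaust the `M i` are `L_∩`-isomorphisms, along which the `M i` are glued.
  let D := glue M iStar e
  let ε : ∀ i, Iso (D.red i) (M i) := glueIso M iStar e helem
  have hεe : ∀ i s, (ε i).toEquiv s = e i s := fun i s => rfl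
  have hεcap : ∀ i, IsElementaryEmbedding D.redCap (Mc i) fun s => e i s := fun i =>
    IsElementaryEmbedding.reduct (M := D.red i) (N := M i) (j := fun s => (ε i).toEquiv s)
      (ε i).isElementaryEmbedding (capToLang Lcap E i)
  have hD : D.Models (theoryUnion T) := models_theoryUnion_iff.2 fun i =>
    (ε i).elemEquiv.symm.models (hMT i)
  refine ⟨D, hD, fun J Γ X hX hemp => ?_⟩
  -- A task concerns all indices, so the sets outside `J` are taken to be everything.
  let X' : ∀ i, Set (Env D.carrier Γ) := fun i => if i ∈ J then X i else Set.univ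
  have hX' : ∀ i, (D.red i).Definable (X' i) := fun i => by
    by_cases hi : i ∈ J
    · simp only [X', if_pos hi]
      exact hX i hi
    · simp only [X', if_neg hi]
      exact ⟨[], Formula.falsum.neg, Env.nil, (Set.eq_univ_of_forall fun a => id).symm⟩
  obtain ⟨q, hqC, hq⟩ := hmeet ⟨Γ, fun i => ⟨_, (ε i).definable_image (hX' i)⟩⟩
  rcases hqC with ⟨f, hf⟩ | hno
  · refine absurd hemp (Set.nonempty_iff_ne_empty.1 ⟨Tuple.comp (q.pt iStar) f, ?_⟩)
    refine Set.mem_iInter₂.2 fun i hi => ?_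
    have h1 : (fun s k => (e i s).symm (q.pt i s (f s k))) ∈ X' i := hf i
    simp only [X', if_pos hi, hq i, Equiv.symm_apply_apply] at h1
    exact h1
  -- Otherwise the unions of the `L_∩`-types over the stage `c` which meet `X i` are disjoint.
  · let c : Env D.carrier q.ctx := q.pt iStar
    refine ⟨fun i => {y | ∃ x ∈ X i, SameType D.redCap D.redCap (Tuple.sum x c) (Tuple.sum y c)},
      fun i hi => ⟨(h.oligomorphic_redCap hD).definable_saturation c (X i),
        fun x hx => ⟨x, hx, SameType.refl _⟩⟩, ?_⟩
    rw [← Set.not_nonempty_iff_eq_empty]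
    rintro ⟨y, hy⟩
    have hy' : ∀ i, ∃ x ∈ X' i,
        SameType D.redCap D.redCap (Tuple.sum x c) (Tuple.sum y c) := fun i => by
      by_cases hi : i ∈ J
      · simp only [X', if_pos hi]
        exact Set.mem_iInter₂.1 hy i hi
      · exact ⟨y, by simp [X', if_neg hi], SameType.refl _⟩
    choose x hx hxy using hy'
    refine hno ⟨fun i s k => e i s (x i s k), fun i => ?_, ?_⟩
    · have e1 : (fun s k => (e i s).symm (e i s (x i s k))) = x i :=
        funext fun s => funext fun k => (e i s).symm_apply_apply _
      have e2 : (fun s k => (e i s).symm (e i s (x i s k))) ∈ X' i := e1.symm ▸ hx i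
      exact e2
    · have key : ∀ i, SameType D.redCap (Mc i) (Tuple.sum c y)
          (Tuple.sum (q.pt i) fun s k => e i s (x i s k)) := fun i => by
        have h1 := (hεcap i).sameType (Tuple.sum c (x i))
        have h2 := (hxy i).comp (Y := VSum (Var q.ctx) (Var Γ)) (Tuple.sum vinr vinl)
        rw [Tuple.sum_comp, Tuple.sum_comp] at h2
        have e1 : (Tuple.comp (fun s => e i s) c : Env (F i) q.ctx) = q.pt i :=
          funext fun s => funext fun k => (hq i s k).symm
        have e2 : Tuple.comp (fun s => e i s) (Tuple.sum c (x i)) =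
            Tuple.sum (q.pt i) fun s k => e i s (x i s k) :=
          (Tuple.sum_comp (fun s => e i s) c (x i)).trans (congrArg (Tuple.sum · _) e1)
        exact (SameType.symm h2).trans (e2 ▸ h1)
      exact fun i k => (key i).symm.trans (key k)

end Fusion

end ManySorted

theorem mainTheorem8 {S : Type u} [Finite S] {I : Type u}
    (Lcap : SortedLanguage S) (E : I → SortedLanguage S)
    (hcount : ∀ i, (langOf Lcap E i).IsCountable)
    (Tcap : Theory Lcap) (T : ∀ i, Theory (langOf Lcap E i))
    (hcap : ∀ i, (capToLang Lcap E i).consequences (T i) = Tcap)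
    (hcons : (theoryUnion T).Consistent)
    (hind : AdmitsStationaryExtendable Tcap T)
    (hcat : ∀ i, (T i).Aleph0Categorical)
    (hacl : ∃ iStar : I, ∀ i, i ≠ iStar → ∀ M : Struct (langOf Lcap E i), M.Models (T i) →
      ∀ A : SubFamily M.carrier, M.acl A = (M.reduct (capToLang Lcap E i)).acl A) :
    FusionExists T ∧
    (Finite I →
      (∀ U : Theory (langUnion Lcap E),
        (interpolativeFusion T).IsCompletion U → U.Aleph0Categorical) ∧
      ((∀ i, ∀ M : Struct (langOf Lcap E i), M.Models (T i) → M.acl ⊥ = ⊥) →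
        (interpolativeFusion T).Complete ∧ (interpolativeFusion T).Aleph0Categorical)) := by
  obtain ⟨iStar, hacl⟩ := hacl
  have hred : ∀ i (M : Struct (langOf Lcap E i)), M.Models (T i) →
      (M.reduct (capToLang Lcap E i)).Models Tcap := fun i M hM φ hφ => by
    rw [← hcap i] at hφ
    exact (LHom.realize_onFormula _ M φ _).1 (hφ M hM)
  have hTcap : Tcap.Complete := by
    refine ⟨?_, fun φ => ?_⟩
    · obtain ⟨M, hM⟩ := (hcat iStar).1.1
      exact ⟨_, hred iStar M hM⟩
    · have hmem : ∀ ψ : Sentence Lcap, (T iStar).Entails ((capToLang Lcap E iStar).onFormula ψ) →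
          Tcap.Entails ψ := fun ψ hψ M hM => by
        rw [← hcap iStar] at hM
        exact hM ψ hψ
      exact ((hcat iStar).1.2 ((capToLang Lcap E iStar).onFormula φ)).imp (hmem φ) (hmem φ.neg)
  -- The theories are complete, so they are completions of themselves.
  obtain ⟨ind, hstat, hext⟩ := hind Tcap T ⟨hTcap, subset_rfl⟩ fun i =>
    ⟨⟨(hcat i).1, subset_rfl⟩, (hcap i).ge⟩
  have h : TameFusion T iStar :=
    { complete := fun i => (hcat i).1
      oligomorphic := fun i M hM => Aleph0Categorical.oligomorphic (hcount i) (hcat i) hM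
      independence := ⟨Tcap, ind, hstat, hext, hred⟩
      acl_eq := hacl }
  have hinterp : ∀ M, M.Models (interpolativeFusion T) → IsInterpolative T M :=
    fun M hM => h.isInterpolative_of_models hM
  have hcountable : ∀ M : Struct (langUnion Lcap E),
      Cardinal.mk (Σ s, M.carrier s) = Cardinal.aleph0 → ∀ s, Countable (M.carrier s) :=
    fun M hM s => by
      have : Countable (Σ s, M.carrier s) := Cardinal.mk_le_aleph0_iff.1 hM.le
      exact Function.Injective.countable (f := fun a => (⟨s, a⟩ : Σ s, M.carrier s))
        sigma_mk_injective
  refine ⟨⟨interpolativeFusion T, fun M => ⟨hinterp M, fun hM φ hφ => hφ M hM⟩⟩, fun hI => ⟨?_, ?_⟩⟩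
  · intro U hU
    refine ⟨hU.1, fun M N hM hN hMc hNc => ?_⟩
    have hMi := hinterp M fun φ hφ => hM φ (hU.2 hφ)
    have hNi := hinterp N fun φ hφ => hN φ (hU.2 hφ)
    -- The back-and-forth starts with the algebraic closure of the empty set, whose types are
    -- isolated by finitely many formulas.
    obtain ⟨Γ, a, ha⟩ := exists_env_range (A := (M.red iStar).acl ⊥) fun s =>
      (h.oligomorphic_red hMi.1 iStar).acl_finite (fun _ => Set.finite_empty) s
    choose θ hθ hiso using fun i => (h.oligomorphic_red hMi.1 i).exists_isolating a
    obtain ⟨b, hb⟩ := ((hU.1.elemEquiv hM hN).iff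
      (P := fun K => ∃ b : Env K.carrier Γ, ∀ i, (θ i).Realize (K.red i) b)
      (FO.ex (Q := fun (K : Struct (langUnion Lcap E)) _ b => ∀ i, (θ i).Realize (K.red i) b) (FO.forall_finite
        fun i => FO.reduct (langToUnion Lcap E i) (FO.realize (θ i) vinr)))).1 ⟨a, hθ⟩
    refine h.nonempty_iso hMi hNi (hcountable M hMc) (hcountable N hNc) (a := a) (b := b)
      ⟨?_, fun i => hiso i _ (h.elemEquiv_red hMi.1 hNi.1 i) b (hb i)⟩
    have e : (M.red iStar).acl ((M.red iStar).acl ⊥) = (M.red iStar).acl ⊥ :=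
      acl_acl (M.red iStar) _
    exact (congrArg (M.red iStar).acl ha).trans (e.trans ha.symm)
  · intro hempty
    -- The empty tuple is algebraically closed, so the back-and-forth can start with it in any two
    -- interpolative models.
    have hstart : ∀ M N : Struct (langUnion Lcap E), IsInterpolative T M → IsInterpolative T N →
        BackForth iStar M N (Env.nil : Env M.carrier []) (Env.nil : Env N.carrier []) := by
      intro M N hM hN
      have hrange : Tuple.range (Env.nil : Env M.carrier []) = ⊥ := by
        funext s
        exact Set.range_eq_empty_iff.2 ⟨fun x => nomatch x⟩
      refine ⟨?_, fun i => ?_⟩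
      · have e := hempty iStar (M.red iStar) (models_theoryUnion_iff.1 hM.1 iStar)
        exact (congrArg (M.red iStar).acl hrange).trans (e.trans hrange.symm)
      · exact (h.elemEquiv_red hM.1 hN.1 i).sameType_nil _ _
    have hcomplete : (interpolativeFusion T).Complete := by
      obtain ⟨M, hM⟩ := h.exists_isInterpolative hcount hcons
      refine ⟨⟨M, fun φ hφ => hφ M hM⟩, fun φ => ?_⟩
      have hequiv : ∀ N : Struct (langUnion Lcap E), N.Models (interpolativeFusion T) →
          (M.Satisfies φ ↔ N.Satisfies φ) :=
        fun N hN => elemEquiv_iff.1 (h.sameType_of_backForth hM (hinterp N hN)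
          (hstart M N hM (hinterp N hN))).elemEquiv φ
      by_cases hφ : M.Satisfies φ
      · exact Or.inl fun N hN => (hequiv N hN).1 hφ
      · exact Or.inr fun N hN hNφ => hφ ((hequiv N hN).2 hNφ)
    exact ⟨hcomplete, hcomplete, fun M N hM hN hMc hNc => h.nonempty_iso (hinterp M hM)
      (hinterp N hN) (hcountable M hMc) (hcountable N hNc)
      (hstart M N (hinterp M hM) (hinterp N hN))⟩
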